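/- **Conventions.** For a Lie group $K$ with Lie algebra $\mathfrak k$ (left-invariant fields) fix a positive definite $\mathrm{Ad}$-invariant inner product $(\cdot,\cdot)$ on $\mathfrak k$; products of groups carry the orthogonal sums, and the same inner product on $\mathfrak g$ is used for both copies of $G$ below. $\theta^l=g^{-1}dg$, $\theta^r=dg\,g^{-1}$, $\chi=\frac1{12}(\theta^l,[\theta^l,\theta^l])$; for $\mathfrak k$-valued one-forms $(a,b)(u,v)=(a(u),b(v))-(a(v),b(u))$; $v_\xi(p)=\frac{d}{dt}\big|_{0}\exp(t\xi)\cdot p$. Manifolds are smooth, finite-dimensional and without boundary, and actions are smooth. A *quasi-Hamiltonian $K$-space* is a manifold $M$ with a $K$-action, an invariant $2$-form $\sigma$ and a smooth map $\Phi:M\to K$ that is equivariant (for conjugation on $K$) such that (i) $d\sigma=-\Phi^*\chi$; (ii) $\iota(v_\xi)\sigma=\frac12\Phi^*(\theta^l+\theta^r,\xi)$ for all $\xi\in\mathfrak k$; (iii) $\ker\sigma_p\cap\ker d_p\Phi=0$ for all $p\in M$. Let $m\ge1$. A *$b^m$-manifold* $(M,Z)$ is a manifold $M$ with a closed hypersurface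 $Z$ and a smooth function $f$ on a neighbourhood of $Z$ with $Z=\{f=0\}$ and $df\neq0$ along $Z$. The bundle ${}^{b^m}TM$ has as smooth sections the vector fields $X$ with $Xf\in f^mC^\infty$ near $Z$; smooth sections of $\Lambda^k({}^{b^m}TM)^*$ are the $b^m$-forms; near $Z$ they are $\frac{df}{f^m}\wedge\alpha+\beta$ with $\alpha,\beta$ smooth. A *singular quasi-Hamiltonian $K$-space of $b^m$-type* is a $b^m$-manifold $(M,Z)$ with a $K$-action by automorphisms of the $b^m$-manifold whose fundamental fields are $b^m$-vector fields, an invariant $b^m$-form $\sigma$ of degree $2$, and an equivariant moment map $\Phi$ to $K$ satisfying (i), (ii) and (iii), with kernels taken in ${}^{b^m}T_pM$ for every $p\in M$, also on $Z$. Here $\Phi$ is smooth on $M\setminus Z$ and $\Phi^*\theta^l$ extends to a $b^m$-form on $M$, whose kernel at $p$ is what $\ker d_p\Phi$ means for $p\in Z$; this holds in particular when $\Phi$ is smooth on $M$. **Theorem ($b^m$ fusion product).** Let $(M_1,Z_1,\sigma_1,\Phi_1=(\Phi_1^G,\Phi_1^H))$ be a singular quasi-Hamiltonian $G\times H_1$-space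 of $b^m$-type, with $b^m$-manifold structure given by $f_1$, and let $(M_2,\sigma_2,\Phi_2=(\Phi_2^G,\Phi_2^H))$ be a quasi-Hamiltonian $G\times H_2$-space. Give $M_1\times M_2$ the $b^m$-structure with hypersurface $Z_1\times M_2$ and defining function $f_1\circ\mathrm{pr}_1$. Then: 1. $M_1\times M_2$ with the product action, $\sigma_1+\sigma_2$ and the moment map $(\Phi_1,\Phi_2)$ is a singular quasi-Hamiltonian $(G\times H_1)\times(G\times H_2)$-space of $b^m$-type. 2. The fusion product $M_1\circledast M_2$, that is, $M_1\times M_2$ with the action $(g,h_1,h_2)\cdot(p,q)=((g,h_1)\cdot p,(g,h_2)\cdot q)$, the $b^m$-form $$\hat\sigma=\sigma_1+\sigma_2+\tfrac12\big((\Phi_1^G)^*\theta^l,(\Phi_2^G)^*\theta^r\big)$$ and the moment map $\hat\Phi(p,q)=\big(\Phi_1^G(p)\,\Phi_2^G(q),\ \Phi_1^H(p),\ \Phi_2^H(q)\big)$, is a singular quasi-Hamiltonian $G\times H_1\times H_2$-space of $b^m$-type. 3. If $\Phi_1$ is smooth on all of $M_1$, then $\hat\Phi$ is smooth on all of $M_1\times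 M_2$. -/

import Mathlib

open Set Manifold
open scoped ContDiff Topology

noncomputable section

namespace BmFusion

/-! ### Differential forms on manifolds -/

section Forms

variable {E : Type*} [NormedAddCommGroup E] [NormedSpace ℝ E] {H : Type*} [TopologicalSpace H]
  (I : ModelWithCorners ℝ E H) {M : Type*} [TopologicalSpace M] [ChartedSpace H M]
  {F : Type*} [NormedAddCommGroup F] [NormedSpace ℝ F] {k : ℕ}

/-- The coordinate expression of an `F`-valued `k`-form in the preferred chart at `x₀`, i.e. its
pullback under the inverse of that chart. -/
def chartRep (η : ∀ x : M, TangentSpace I x [⋀^Fin k]→L[ℝ] F) (x₀ : M) (y : E) :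
    E [⋀^Fin k]→L[ℝ] F :=
  (η ((extChartAt I x₀).symm y)).compContinuousLinearMap
    (mfderiv 𝓘(ℝ, E) I (extChartAt I x₀).symm y)

/-- Smoothness of a form on a set `V` (in the applications `V` is open and `M` has no boundary). -/
def SmoothFormOn (η : ∀ x : M, TangentSpace I x [⋀^Fin k]→L[ℝ] F) (V : Set M) : Prop :=
  ∀ x₀ : M, ContDiffOn ℝ ∞ (chartRep I η x₀)
    ((extChartAt I x₀).target ∩ (extChartAt I x₀).symm ⁻¹' V)

/-- The exterior derivative on a manifold without boundary, computed in the chart at the point. -/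
def extDerivM (η : ∀ x : M, TangentSpace I x [⋀^Fin k]→L[ℝ] F) (x : M) :
    TangentSpace I x [⋀^Fin (k + 1)]→L[ℝ] F :=
  (extDeriv (chartRep I η x) (extChartAt I x x)).compContinuousLinearMap
    (mfderiv I 𝓘(ℝ, E) (extChartAt I x) x)

end Forms

/-- The `2`-form `(α ∧ β)`: for one-forms `a, b` with values in `𝔤` and a bilinear form `B` on `𝔤`,
this is `(a, b)(u, v) = B (a u, b v) - B (a v, b u)`. -/
def wedgePair {V 𝔤 : Type*} [AddCommGroup V] [Module ℝ V] [TopologicalSpace V]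
    [NormedAddCommGroup 𝔤] [NormedSpace ℝ 𝔤]
    (B : 𝔤 →L[ℝ] 𝔤 →L[ℝ] ℝ) (a b : V →L[ℝ] 𝔤) : V [⋀^Fin 2]→L[ℝ] ℝ where
  toFun w := B (a (w 0)) (b (w 1)) - B (a (w 1)) (b (w 0))
  map_update_add' w i x y := by
    rcases Fin.exists_fin_two.mp ⟨i, rfl⟩ with rfl | rfl <;> simp <;> ring
  map_update_smul' w i c x := by
    rcases Fin.exists_fin_two.mp ⟨i, rfl⟩ with rfl | rfl <;> simp <;> ring
  map_eq_zero_of_eq' w i j h hij := by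
    fin_cases i <;> fin_cases j <;> simp_all
  cont := by fun_prop

/-! ### Lie groups -/

section LieGroups

variable {E : Type*} [NormedAddCommGroup E] [NormedSpace ℝ E] {H : Type*} [TopologicalSpace H]
  (I : ModelWithCorners ℝ E H)
  {G : Type*} [TopologicalSpace G] [ChartedSpace H G] [Group G]

/-- The adjoint action `Ad_g`, the differential at `1` of `h ↦ g h g⁻¹`. -/
def Ad (g : G) (ξ : GroupLieAlgebra I G) : GroupLieAlgebra I G :=
  (mfderiv I I (fun h : G => g * h * g⁻¹) 1 ξ : E)

/-- The left-invariant Maurer-Cartan form `θˡ`, with `θˡ_a (v) = a⁻¹ v`. -/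
def thetaL (a : G) : TangentSpace I a →L[ℝ] GroupLieAlgebra I G :=
  (mfderiv I I (fun h : G => a⁻¹ * h) a : E →L[ℝ] E)

/-- The right-invariant Maurer-Cartan form `θʳ`, with `θʳ_a (v) = v a⁻¹`. -/
def thetaR (a : G) : TangentSpace I a →L[ℝ] GroupLieAlgebra I G :=
  (mfderiv I I (fun h : G => h * a⁻¹) a : E →L[ℝ] E)

variable (G) in
/-- A positive definite inner product on the Lie algebra of `G`, invariant under `Ad`. -/
structure InvariantInner where
  /-- the bilinear form -/
  form : GroupLieAlgebra I G →L[ℝ] GroupLieAlgebra I G →L[ℝ] ℝ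
  symm : ∀ ξ ζ, form ξ ζ = form ζ ξ
  pos : ∀ ξ, ξ ≠ 0 → 0 < form ξ ξ
  invariant : ∀ (g : G) (ξ ζ), form (Ad I g ξ) (Ad I g ζ) = form ξ ζ

/-- The canonical `3`-form `χ = (1/12) (θˡ, [θˡ, θˡ])`, where
`[θˡ, θˡ](u, v) = [θˡ u, θˡ v] - [θˡ v, θˡ u]`. -/
def chi (B : InvariantInner I G) (a : G) (u v w : TangentSpace I a) : ℝ :=
  let bb (x y : TangentSpace I a) : GroupLieAlgebra I G :=
    ⁅thetaL I a x, thetaL I a y⁆ - ⁅thetaL I a y, thetaL I a x⁆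
  (1 / 12) * (B.form (thetaL I a u) (bb v w) + B.form (thetaL I a v) (bb w u)
    + B.form (thetaL I a w) (bb u v))

end LieGroups

section LieGroupProducts

variable {E : Type*} [NormedAddCommGroup E] [NormedSpace ℝ E] {H : Type*} [TopologicalSpace H]
  {I : ModelWithCorners ℝ E H}
  {G : Type*} [TopologicalSpace G] [ChartedSpace H G] [Group G]
  {E' : Type*} [NormedAddCommGroup E'] [NormedSpace ℝ E'] {H' : Type*} [TopologicalSpace H']
  {I' : ModelWithCorners ℝ E' H'}
  {G' : Type*} [TopologicalSpace G'] [ChartedSpace H' G'] [Group G']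

/-- The projection `𝔤 ⊕ 𝔤' → 𝔤`. -/
def lieFst : GroupLieAlgebra (I.prod I') (G × G') →L[ℝ] GroupLieAlgebra I G :=
  (ContinuousLinearMap.fst ℝ E E' : E × E' →L[ℝ] E)

/-- The projection `𝔤 ⊕ 𝔤' → 𝔤'`. -/
def lieSnd : GroupLieAlgebra (I.prod I') (G × G') →L[ℝ] GroupLieAlgebra I' G' :=
  (ContinuousLinearMap.snd ℝ E E' : E × E' →L[ℝ] E')

theorem Ad_prod [LieGroup I ∞ G] [LieGroup I' ∞ G'] (g : G × G')
    (ξ : GroupLieAlgebra (I.prod I') (G × G')) :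
    Ad (I.prod I') g ξ = ((Ad I g.1 (lieFst ξ), Ad I' g.2 (lieSnd ξ)) : E × E') := by
  have h1 : MDifferentiableAt I I (fun h : G => g.1 * h * g.1⁻¹) 1 :=
    ((contMDiff_mul_left (I := I) (n := ∞) (a := g.1)).mul
      (contMDiff_const (c := g.1⁻¹))).mdifferentiableAt (by simp)
  have h2 : MDifferentiableAt I' I' (fun h : G' => g.2 * h * g.2⁻¹) 1 :=
    ((contMDiff_mul_left (I := I') (n := ∞) (a := g.2)).mul
      (contMDiff_const (c := g.2⁻¹))).mdifferentiableAt (by simp)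
  have key := mfderiv_prodMap (p := ((1 : G), (1 : G'))) h1 h2
  exact congrArg (fun L : E × E' →L[ℝ] E × E' => L ξ) key

/-- The orthogonal direct sum of two invariant inner products. -/
def InvariantInner.prod [LieGroup I ∞ G] [LieGroup I' ∞ G']
    (B : InvariantInner I G) (B' : InvariantInner I' G') :
    InvariantInner (I.prod I') (G × G') where
  form :=
    ContinuousLinearMap.bilinearComp (show E →L[ℝ] E →L[ℝ] ℝ from B.form)
        (ContinuousLinearMap.fst ℝ E E') (ContinuousLinearMap.fst ℝ E E')
      + ContinuousLinearMap.bilinearComp (show E' →L[ℝ] E' →L[ℝ] ℝ from B'.form)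
        (ContinuousLinearMap.snd ℝ E E') (ContinuousLinearMap.snd ℝ E E')
  symm ξ ζ := by
    change B.form (lieFst ξ) (lieFst ζ) + B'.form (lieSnd ξ) (lieSnd ζ)
      = B.form (lieFst ζ) (lieFst ξ) + B'.form (lieSnd ζ) (lieSnd ξ)
    rw [B.symm, B'.symm]
  pos ξ hξ := by
    change 0 < B.form (lieFst ξ) (lieFst ξ) + B'.form (lieSnd ξ) (lieSnd ξ)
    have p1 : 0 ≤ B.form (lieFst ξ) (lieFst ξ) := by
      by_cases h : (lieFst ξ : GroupLieAlgebra I G) = 0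
      · rw [h]; simp
      · exact (B.pos _ h).le
    have p2 : 0 ≤ B'.form (lieSnd ξ) (lieSnd ξ) := by
      by_cases h : (lieSnd ξ : GroupLieAlgebra I' G') = 0
      · rw [h]; simp
      · exact (B'.pos _ h).le
    by_cases h : (lieFst ξ : GroupLieAlgebra I G) = 0
    · have h' : (lieSnd ξ : GroupLieAlgebra I' G') ≠ 0 := fun h' => hξ (Prod.ext h h')
      linarith [B'.pos _ h']
    · linarith [B.pos _ h]
  invariant g ξ ζ := by
    change B.form (lieFst (Ad _ g ξ)) (lieFst (Ad _ g ζ))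
        + B'.form (lieSnd (Ad _ g ξ)) (lieSnd (Ad _ g ζ))
      = B.form (lieFst ξ) (lieFst ζ) + B'.form (lieSnd ξ) (lieSnd ζ)
    rw [Ad_prod, Ad_prod]
    exact congrArg₂ (· + ·) (B.invariant g.1 _ _) (B'.invariant g.2 _ _)

end LieGroupProducts

/-! ### `b^m`-manifolds -/

section BManifolds

variable {E : Type*} [NormedAddCommGroup E] [NormedSpace ℝ E] {H : Type*} [TopologicalSpace H]
  (I : ModelWithCorners ℝ E H) (M : Type*) [TopologicalSpace M] [ChartedSpace H M]

/-- A `b`-manifold `(M, Z, f)`: a closed hypersurface `Z = {f = 0}` of `M` with a defining function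
`f`, that is smooth with nonvanishing differential near `Z`.  The function need only be smooth on
the neighbourhood `nhd` of `Z` (if `Z` does not separate `M` there is no global one); away from
`nhd` its only role is to be nonzero.  The notions below depend only on the jet of `f` along `Z`. -/
structure BManifold where
  /-- the defining function -/
  f : M → ℝ
  /-- a neighbourhood of the hypersurface -/
  nhd : Set M
  isOpen_nhd : IsOpen nhd
  smooth : ContMDiffOn I 𝓘(ℝ) ∞ f nhd
  mem_nhd : ∀ p, f p = 0 → p ∈ nhd
  isClosed_zero : IsClosed {p | f p = 0}
  regular : ∀ p, f p = 0 → mfderiv I 𝓘(ℝ) f p ≠ 0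

variable {I M}

/-- The critical hypersurface. -/
def BManifold.Z (S : BManifold I M) : Set M := {p | S.f p = 0}

/-- The differential of the defining function. -/
def BManifold.df (S : BManifold I M) (p : M) : TangentSpace I p →L[ℝ] ℝ :=
  mfderiv I 𝓘(ℝ) S.f p

/-- The fibre at `p` of the `b^m`-tangent bundle, realised as the set of pairs `(v, c)` with
`df (v) = f(p)^m c`.  A vector field `X` with `X f = f^m c` has the value `(X_p, c(p))`; the
functional `(v, c) ↦ c` is the `b^m`-form `df / f^m`, and `(v, c) ↦ v` is the anchor to `T_p M`,
which is an isomorphism off `Z`, and on `Z` has image `T_p Z` and the kernel spanned by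
`f^m ∂/∂f = (0, 1)`. -/
def BmTangent (m : ℕ) (S : BManifold I M) (p : M) : Submodule ℝ (TangentSpace I p × ℝ) :=
  LinearMap.ker ((S.df p).toLinearMap ∘ₗ LinearMap.fst ℝ (TangentSpace I p) ℝ
    - S.f p ^ m • LinearMap.snd ℝ (TangentSpace I p) ℝ)

theorem mem_BmTangent {m : ℕ} {S : BManifold I M} {p : M} {x : TangentSpace I p × ℝ} :
    x ∈ BmTangent m S p ↔ S.df p x.1 = S.f p ^ m * x.2 := by
  simp [BmTangent, sub_eq_zero]

open Classical in
/-- The inverse `T_p M → ᵇᵐT_p M` of the anchor at the points `p ∉ Z` (on `Z`, the zero map). -/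
def toBm (m : ℕ) (S : BManifold I M) (p : M) : TangentSpace I p →L[ℝ] BmTangent m S p :=
  if h : S.f p = 0 then 0 else
    ((ContinuousLinearMap.id ℝ (TangentSpace I p)).prod ((S.f p ^ m)⁻¹ • S.df p)).codRestrict
      (BmTangent m S p) (fun v => by
        rw [mem_BmTangent]
        simp [mul_inv_cancel_left₀ (pow_ne_zero m h)])

/-- The restriction to `M ∖ Z` of a `2`-form on the `b^m`-tangent bundle, as an ordinary form. -/
def offZ {m : ℕ} {S : BManifold I M} (σ : ∀ p : M, BmTangent m S p [⋀^Fin 2]→L[ℝ] ℝ) (p : M) :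
    TangentSpace I p [⋀^Fin 2]→L[ℝ] ℝ :=
  (σ p).compContinuousLinearMap (toBm m S p)

/-- Smoothness of a `b^m`-form of degree two: it is smooth off `Z`, and near each point of `Z` it
is of the form `(df / f^m) ∧ α + β` with smooth forms `α` and `β`. -/
def IsBmTwoForm {m : ℕ} {S : BManifold I M}
    (σ : ∀ p : M, BmTangent m S p [⋀^Fin 2]→L[ℝ] ℝ) : Prop :=
  SmoothFormOn I (offZ σ) S.Zᶜ ∧
  ∀ p ∈ S.Z, ∃ W : Set M, IsOpen W ∧ p ∈ W ∧
    ∃ (α : ∀ q : M, TangentSpace I q [⋀^Fin 1]→L[ℝ] ℝ)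
      (β : ∀ q : M, TangentSpace I q [⋀^Fin 2]→L[ℝ] ℝ),
      SmoothFormOn I α W ∧ SmoothFormOn I β W ∧
      ∀ q ∈ W, ∀ X Y : BmTangent m S q, σ q ![X, Y] =
        X.1.2 * α q ![Y.1.1] - Y.1.2 * α q ![X.1.1] + β q ![X.1.1, Y.1.1]

/-- Smoothness near `Z` of a `b^m`-form of degree one with values in `F`: near each point of `Z`
it is of the form `a (df / f^m) + β` with `a` and `β` smooth. -/
def IsBmOneFormNearZ {F : Type*} [NormedAddCommGroup F] [NormedSpace ℝ F] {m : ℕ}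
    {S : BManifold I M} (A : ∀ p : M, BmTangent m S p →L[ℝ] F) : Prop :=
  ∀ p ∈ S.Z, ∃ W : Set M, IsOpen W ∧ p ∈ W ∧
    ∃ (a : M → F) (β : ∀ q : M, TangentSpace I q [⋀^Fin 1]→L[ℝ] F),
      ContMDiffOn I 𝓘(ℝ, F) ∞ a W ∧ SmoothFormOn I β W ∧
      ∀ q ∈ W, ∀ X : BmTangent m S q, A q X = X.1.2 • a q + β q ![X.1.1]

end BManifolds

/-! ### Group actions and quasi-Hamiltonian spaces -/

section QuasiHamiltonian

variable {E : Type*} [NormedAddCommGroup E] [NormedSpace ℝ E] {H : Type*} [TopologicalSpace H]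
  (I : ModelWithCorners ℝ E H) {M : Type*} [TopologicalSpace M] [ChartedSpace H M]
  {EK : Type*} [NormedAddCommGroup EK] [NormedSpace ℝ EK] {HK : Type*} [TopologicalSpace HK]
  (J : ModelWithCorners ℝ EK HK)
  {K : Type*} [TopologicalSpace K] [ChartedSpace HK K] [Group K]

/-- `g • p` for an explicitly given action `ρ`. -/
def act (ρ : MulAction K M) (g : K) (p : M) : M := ρ.toSMul.smul g p

/-- The action is smooth as a map `K × M → M`. -/
def IsSmoothAction (ρ : MulAction K M) : Prop :=
  ContMDiff (J.prod I) I ∞ (fun z : K × M => act ρ z.1 z.2)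

/-- The fundamental vector field `v_ξ (p) = d/dt (exp (t ξ) • p)` at `t = 0`, i.e. the image of `ξ`
under the differential at `1` of the orbit map of `p`. -/
def fundField (ρ : MulAction K M) (ξ : GroupLieAlgebra J K) (p : M) : TangentSpace I p :=
  (mfderiv J I (fun g : K => act ρ g p) 1 ξ : E)

/-- A smooth action by automorphisms of a `b^m`-manifold: it preserves `Z`, each group element pulls
`df / f^m` back to a `b^m`-form (so that it acts on the `b^m`-tangent bundle), and the fundamental
vector fields are `b^m`-vector fields. -/
structure IsBmAction (m : ℕ) (S : BManifold I M) (ρ : MulAction K M) : Prop where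
  smooth : IsSmoothAction I J ρ
  map_Z : ∀ (g : K) (p : M), act ρ g p ∈ S.Z ↔ p ∈ S.Z
  map_bm : ∀ g : K, ∀ p ∈ S.Z, ∃ W : Set M, IsOpen W ∧ p ∈ W ∧
    ∃ (a : M → ℝ) (β : ∀ q : M, TangentSpace I q [⋀^Fin 1]→L[ℝ] ℝ),
      ContMDiffOn I 𝓘(ℝ) ∞ a W ∧ SmoothFormOn I β W ∧
      ∀ q ∈ W, ∀ X : BmTangent m S q,
        S.df (act ρ g q) (mfderiv I I (act ρ g) q X.1.1)
          = S.f (act ρ g q) ^ m * (a q * X.1.2 + β q ![X.1.1])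
  fund_bm : ∀ ξ : GroupLieAlgebra J K, ∃ c : M → ℝ, ContMDiffOn I 𝓘(ℝ) ∞ c S.nhd ∧
    ∀ q ∈ S.nhd, S.df q (fundField I J ρ ξ q) = S.f q ^ m * c q

/-- A quasi-Hamiltonian `K`-space `(M, ρ, σ, Φ)`. -/
structure IsQuasiHamiltonian (B : InvariantInner J K) (ρ : MulAction K M)
    (σ : ∀ p : M, TangentSpace I p [⋀^Fin 2]→L[ℝ] ℝ) (Φ : M → K) : Prop where
  smooth_action : IsSmoothAction I J ρ
  smooth_form : SmoothFormOn I σ univ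
  invariant : ∀ (g : K) (p : M) (u v : TangentSpace I p),
    σ (act ρ g p) ![mfderiv I I (act ρ g) p u, mfderiv I I (act ρ g) p v] = σ p ![u, v]
  smooth_map : ContMDiff I J ∞ Φ
  equivariant : ∀ (g : K) (p : M), Φ (act ρ g p) = g * Φ p * g⁻¹
  closed : ∀ (p : M) (u v w : TangentSpace I p),
    extDerivM I σ p ![u, v, w]
      = -chi J B (Φ p) (mfderiv I J Φ p u) (mfderiv I J Φ p v) (mfderiv I J Φ p w)
  moment : ∀ (ξ : GroupLieAlgebra J K) (p : M) (w : TangentSpace I p),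
    σ p ![fundField I J ρ ξ p, w] = (1 / 2) *
      B.form (thetaL J (Φ p) (mfderiv I J Φ p w) + thetaR J (Φ p) (mfderiv I J Φ p w)) ξ
  nondegenerate : ∀ (p : M) (u : TangentSpace I p),
    (∀ w : TangentSpace I p, σ p ![u, w] = 0) → mfderiv I J Φ p u = 0 → u = 0

/-- A singular quasi-Hamiltonian `K`-space of `b^m`-type `(M, Z, ρ, σ, Φ)`.

The moment map is smooth off `Z`, and the pullback `Φ^* θˡ` is a `b^m`-form, that is, it extends
over `Z` to the (unique) smooth form `A` on the `b^m`-tangent bundle.  If `Φ` is smooth on all of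
`M`, then this holds with `A (v, c) = θˡ (dΦ v)`; the values of `Φ` on `Z` are not used.  As `Z` has
empty interior, identities between smooth `b^m`-forms hold if they hold off `Z`, and they are
stated there; the weak nondegeneracy `ker σ ∩ ker dΦ = 0` is required in the `b^m`-tangent spaces
at all points, those of `Z` included. -/
structure IsBmQuasiHamiltonian (m : ℕ) (S : BManifold I M) (B : InvariantInner J K)
    (ρ : MulAction K M) (σ : ∀ p : M, BmTangent m S p [⋀^Fin 2]→L[ℝ] ℝ) (Φ : M → K)
    (A : ∀ p : M, BmTangent m S p →L[ℝ] GroupLieAlgebra J K) : Prop where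
  action : IsBmAction I J m S ρ
  smooth_form : IsBmTwoForm σ
  invariant : ∀ (g : K), ∀ p ∉ S.Z, ∀ u v : TangentSpace I p,
    offZ σ (act ρ g p) ![mfderiv I I (act ρ g) p u, mfderiv I I (act ρ g) p v] = offZ σ p ![u, v]
  smooth_map : ContMDiffOn I J ∞ Φ S.Zᶜ
  dlog_eq : ∀ p ∉ S.Z, ∀ X : BmTangent m S p, A p X = thetaL J (Φ p) (mfderiv I J Φ p X.1.1)
  dlog_smooth : IsBmOneFormNearZ (F := EK) A
  equivariant : ∀ (g : K), ∀ p ∉ S.Z, Φ (act ρ g p) = g * Φ p * g⁻¹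
  closed : ∀ p ∉ S.Z, ∀ u v w : TangentSpace I p,
    extDerivM I (offZ σ) p ![u, v, w]
      = -chi J B (Φ p) (mfderiv I J Φ p u) (mfderiv I J Φ p v) (mfderiv I J Φ p w)
  moment : ∀ (ξ : GroupLieAlgebra J K), ∀ p ∉ S.Z, ∀ w : TangentSpace I p,
    offZ σ p ![fundField I J ρ ξ p, w] = (1 / 2) *
      B.form (thetaL J (Φ p) (mfderiv I J Φ p w) + thetaR J (Φ p) (mfderiv I J Φ p w)) ξ
  nondegenerate : ∀ (p : M) (X : BmTangent m S p),
    (∀ Y : BmTangent m S p, σ p ![X, Y] = 0) → A p X = 0 → X = 0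

end QuasiHamiltonian

/-! ### Products and fusion -/

section Products

variable {E : Type*} [NormedAddCommGroup E] [NormedSpace ℝ E] {H : Type*} [TopologicalSpace H]
  {I : ModelWithCorners ℝ E H} {M : Type*} [TopologicalSpace M] [ChartedSpace H M]
  {E' : Type*} [NormedAddCommGroup E'] [NormedSpace ℝ E'] {H' : Type*} [TopologicalSpace H']
  {I' : ModelWithCorners ℝ E' H'} {M' : Type*} [TopologicalSpace M'] [ChartedSpace H' M']

theorem df_comp_fst (f : M → ℝ) (z : M × M') (v : TangentSpace (I.prod I') z) :
    mfderiv (I.prod I') 𝓘(ℝ) (fun z : M × M' => f z.1) z v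
      = mfderiv I 𝓘(ℝ) f z.1 ((v : E × E').1 : E) := by
  by_cases h : MDifferentiableAt I 𝓘(ℝ) f z.1
  · have := mfderiv_comp (I := I.prod I') (I' := I) (I'' := 𝓘(ℝ)) z (g := f)
      (f := (Prod.fst : M × M' → M)) h mdifferentiableAt_fst
    rw [mfderiv_fst] at this
    exact congrArg (fun L : E × E' →L[ℝ] ℝ => L v) this
  · have h' : ¬ MDifferentiableAt (I.prod I') 𝓘(ℝ) (fun z : M × M' => f z.1) z := by
      intro hd
      have hc : MDifferentiableAt I (I.prod I') (fun x : M => (x, z.2)) z.1 :=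
        mdifferentiableAt_id.prodMk mdifferentiableAt_const
      exact h (MDifferentiableAt.comp (I' := I.prod I') z.1
        (g := fun z : M × M' => f z.1) (f := fun x : M => (x, z.2)) hd hc)
    rw [mfderiv_zero_of_not_mdifferentiableAt h, mfderiv_zero_of_not_mdifferentiableAt h']
    rfl

variable (I' M') in
/-- The `b`-manifold `(M × M', Z × M', f ∘ pr₁)`. -/
def BManifold.prod (S : BManifold I M) : BManifold (I.prod I') (M × M') where
  f z := S.f z.1
  nhd := Prod.fst ⁻¹' S.nhd
  isOpen_nhd := S.isOpen_nhd.preimage continuous_fst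
  smooth := S.smooth.comp contMDiffOn_fst (fun _ h => h)
  mem_nhd z h := S.mem_nhd z.1 h
  isClosed_zero := S.isClosed_zero.preimage continuous_fst
  regular z h h0 := by
    refine S.regular z.1 h (ContinuousLinearMap.ext fun v => ?_)
    have := df_comp_fst (I := I) (I' := I') S.f z ((v, 0) : E × E')
    rw [h0] at this
    exact this.symm

/-- The projection `ᵇᵐT_(p, q) (M × M') → ᵇᵐT_p M`, `((v, w), c) ↦ (v, c)`. -/
def bmFst (m : ℕ) (S : BManifold I M) (z : M × M') :
    BmTangent m (S.prod I' M') z →L[ℝ] BmTangent m S z.1 :=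
  ((ContinuousLinearMap.prodMap (ContinuousLinearMap.fst ℝ E E' : E × E' →L[ℝ] E)
      (ContinuousLinearMap.id ℝ ℝ) : (E × E') × ℝ →L[ℝ] E × ℝ).comp
    (BmTangent m (S.prod I' M') z).subtypeL).codRestrict (BmTangent m S z.1) (fun x => by
      have h := mem_BmTangent.1 x.2
      have h' := df_comp_fst (I := I) (I' := I') S.f z x.1.1
      exact mem_BmTangent.2 (h'.symm.trans h))

/-- The projection `ᵇᵐT_(p, q) (M × M') → T_q M'`, `((v, w), c) ↦ w`. -/
def bmSnd (m : ℕ) (S : BManifold I M) (z : M × M') :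
    BmTangent m (S.prod I' M') z →L[ℝ] TangentSpace I' z.2 :=
  ((ContinuousLinearMap.snd ℝ E E').comp (ContinuousLinearMap.fst ℝ (E × E') ℝ) :
    (E × E') × ℝ →L[ℝ] E').comp (BmTangent m (S.prod I' M') z).subtypeL

/-- The product form `pr₁^* σ + pr₂^* σ'`. -/
def prodForm {m : ℕ} {S : BManifold I M} (σ : ∀ p : M, BmTangent m S p [⋀^Fin 2]→L[ℝ] ℝ)
    (σ' : ∀ q : M', TangentSpace I' q [⋀^Fin 2]→L[ℝ] ℝ) (z : M × M') :
    BmTangent m (S.prod I' M') z [⋀^Fin 2]→L[ℝ] ℝ :=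
  (σ z.1).compContinuousLinearMap (bmFst m S z) + (σ' z.2).compContinuousLinearMap (bmSnd m S z)

/-- The product action of `K × K'` on `M × M'`. -/
abbrev prodAction {M K M' K' : Type*} [Group K] [Group K'] (ρ : MulAction K M) (ρ' : MulAction K' M') :
    MulAction (K × K') (M × M') where
  smul k z := (act ρ k.1 z.1, act ρ' k.2 z.2)
  one_smul z := Prod.ext (ρ.one_smul z.1) (ρ'.one_smul z.2)
  mul_smul k l z := Prod.ext (ρ.mul_smul k.1 l.1 z.1) (ρ'.mul_smul k.2 l.2 z.2)

end Products

section Fusion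

/-- The homomorphism `(g, h₁, h₂) ↦ ((g, h₁), (g, h₂))`, which embeds `G` diagonally. -/
def diagHom (G H₁ H₂ : Type*) [Group G] [Group H₁] [Group H₂] :
    G × H₁ × H₂ →* (G × H₁) × (G × H₂) where
  toFun k := ((k.1, k.2.1), (k.1, k.2.2))
  map_one' := rfl
  map_mul' _ _ := rfl

/-- The action of `G × H₁ × H₂` on `M₁ × M₂`, with `G` acting diagonally. -/
abbrev fusionAction {G H₁ H₂ M₁ M₂ : Type*} [Group G] [Group H₁] [Group H₂]
    (ρ₁ : MulAction (G × H₁) M₁) (ρ₂ : MulAction (G × H₂) M₂) :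
    MulAction (G × H₁ × H₂) (M₁ × M₂) :=
  letI := prodAction ρ₁ ρ₂
  MulAction.compHom (M₁ × M₂) (diagHom G H₁ H₂)

/-- The fused moment map `(p, q) ↦ (Φ₁ᴳ(p) Φ₂ᴳ(q), Φ₁ᴴ(p), Φ₂ᴴ(q))`. -/
def fusionMap {G H₁ H₂ M₁ M₂ : Type*} [Group G] (Φ₁ : M₁ → G × H₁) (Φ₂ : M₂ → G × H₂)
    (z : M₁ × M₂) : G × H₁ × H₂ :=
  ((Φ₁ z.1).1 * (Φ₂ z.2).1, (Φ₁ z.1).2, (Φ₂ z.2).2)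

variable {EG : Type*} [NormedAddCommGroup EG] [NormedSpace ℝ EG]
  {HG : Type*} [TopologicalSpace HG] {JG : ModelWithCorners ℝ EG HG}
  {G : Type*} [TopologicalSpace G] [ChartedSpace HG G] [Group G]
  {EH₁ : Type*} [NormedAddCommGroup EH₁] [NormedSpace ℝ EH₁]
  {HH₁ : Type*} [TopologicalSpace HH₁] {J₁ : ModelWithCorners ℝ EH₁ HH₁}
  {H₁ : Type*} [TopologicalSpace H₁] [ChartedSpace HH₁ H₁] [Group H₁]
  {H₂ : Type*}
  {E₁ : Type*} [NormedAddCommGroup E₁] [NormedSpace ℝ E₁]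
  {HM₁ : Type*} [TopologicalSpace HM₁] {I₁ : ModelWithCorners ℝ E₁ HM₁}
  {M₁ : Type*} [TopologicalSpace M₁] [ChartedSpace HM₁ M₁]
  {E₂ : Type*} [NormedAddCommGroup E₂] [NormedSpace ℝ E₂]
  {HM₂ : Type*} [TopologicalSpace HM₂] {I₂ : ModelWithCorners ℝ E₂ HM₂}
  {M₂ : Type*} [TopologicalSpace M₂] [ChartedSpace HM₂ M₂]

/-- The fused form `σ₁ + σ₂ + (1/2) (Φ₁ᴳ^* θˡ, Φ₂ᴳ^* θʳ)` on `M₁ × M₂`.  Here `A₁` is the `b^m`-form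
`Φ₁^* θˡ`, and `lieFst ∘ A₁` is its component `Φ₁ᴳ^* θˡ` in the Lie algebra of `G`. -/
def fusionForm {m : ℕ} {S₁ : BManifold I₁ M₁} (B : InvariantInner JG G)
    (σ₁ : ∀ p : M₁, BmTangent m S₁ p [⋀^Fin 2]→L[ℝ] ℝ)
    (A₁ : ∀ p : M₁, BmTangent m S₁ p →L[ℝ] GroupLieAlgebra (JG.prod J₁) (G × H₁))
    (σ₂ : ∀ q : M₂, TangentSpace I₂ q [⋀^Fin 2]→L[ℝ] ℝ) (Φ₂ : M₂ → G × H₂) (z : M₁ × M₂) :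
    BmTangent m (S₁.prod I₂ M₂) z [⋀^Fin 2]→L[ℝ] ℝ :=
  prodForm σ₁ σ₂ z + (1 / 2 : ℝ) • wedgePair (𝔤 := EG) B.form
    ((lieFst.comp (A₁ z.1)).comp (bmFst m S₁ z))
    (((thetaR JG (Φ₂ z.2).1).comp (mfderiv I₂ JG (fun q => (Φ₂ q).1) z.2)).comp (bmSnd m S₁ z))

end Fusion

end BmFusion

end

namespace BmFusion

set_option linter.unusedSectionVars false

/-! ### Forms on normed spaces -/

section NormedSpaces

theorem minSmoothness_two_le : minSmoothness ℝ 2 ≤ (∞ : WithTop ℕ∞) := by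
  rw [minSmoothness_of_isRCLikeNormedField]
  exact WithTop.coe_le_coe.2 (le_top : (2 : ℕ∞) ≤ ⊤)

variable {D E F V : Type*} [NormedAddCommGroup D] [NormedSpace ℝ D]
  [NormedAddCommGroup E] [NormedSpace ℝ E] [NormedAddCommGroup F] [NormedSpace ℝ F]
  [NormedAddCommGroup V] [NormedSpace ℝ V]

theorem finiteDimensional_alternating [FiniteDimensional ℝ E] [FiniteDimensional ℝ F] (k : ℕ) :
    FiniteDimensional ℝ (E [⋀^Fin k]→L[ℝ] F) := by
  let T : (E [⋀^Fin k]→L[ℝ] F) →ₗ[ℝ] MultilinearMap ℝ (fun _ : Fin k => E) F :=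
    { toFun := fun f => f.toMultilinearMap
      map_add' := fun _ _ => rfl
      map_smul' := fun _ _ => rfl }
  refine Module.Finite.of_injective T fun f g h => ?_
  ext v
  exact congrArg (fun L : MultilinearMap ℝ (fun _ : Fin k => E) F => L v) h

/-- A family of alternating maps between finite dimensional spaces is smooth if all its evaluations
are. -/
theorem contDiffAt_alternating [FiniteDimensional ℝ E] [FiniteDimensional ℝ F] {k : ℕ}
    {n : WithTop ℕ∞} {f : D → E [⋀^Fin k]→L[ℝ] F} {x : D}
    (h : ∀ v : Fin k → E, ContDiffAt ℝ n (fun y => f y v) x) : ContDiffAt ℝ n f x := by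
  have := finiteDimensional_alternating (E := E) (F := F) k
  let b := Module.finBasis ℝ E
  let T : (E [⋀^Fin k]→L[ℝ] F) →ₗ[ℝ] ((Fin k → Fin (Module.finrank ℝ E)) → F) :=
    { toFun := fun f s => f (fun i => b (s i))
      map_add' := fun _ _ => rfl
      map_smul' := fun _ _ => rfl }
  have hT : LinearMap.ker T = ⊥ := by
    rw [LinearMap.ker_eq_bot]
    intro f g hfg
    have : f.toMultilinearMap = g.toMultilinearMap :=
      Module.Basis.ext_multilinear (fun _ => b) fun s => congrFun hfg s
    ext v
    exact congrArg (fun L : MultilinearMap ℝ (fun _ : Fin k => E) F => L v) this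
  obtain ⟨U, hU⟩ := T.exists_leftInverse_of_injective hT
  have hf : f = fun y => (LinearMap.toContinuousLinearMap U) (T (f y)) := by
    funext y
    exact (congrArg (fun L : (E [⋀^Fin k]→L[ℝ] F) →ₗ[ℝ] _ => L (f y)) hU).symm
  rw [hf]
  exact (LinearMap.toContinuousLinearMap U).contDiff.contDiffAt.comp x
    (contDiffAt_pi.2 fun s => h _)

theorem extDeriv_two_apply {η : E → E [⋀^Fin 2]→L[ℝ] ℝ} {x : E} (h : DifferentiableAt ℝ η x)
    (u v w : E) : extDeriv η x ![u, v, w] = fderiv ℝ (fun y => η y ![v, w]) x u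
      - fderiv ℝ (fun y => η y ![u, w]) x v + fderiv ℝ (fun y => η y ![u, v]) x w := by
  have e0 : (0 : Fin 3).removeNth ![u, v, w] = ![v, w] := by
    funext i; fin_cases i <;> rfl
  have e1 : (1 : Fin 3).removeNth ![u, v, w] = ![u, w] := by
    funext i; fin_cases i <;> rfl
  have e2 : (2 : Fin 3).removeNth ![u, v, w] = ![u, v] := by
    funext i; fin_cases i <;> rfl
  rw [extDeriv_apply h, Fin.sum_univ_three, e0, e1, e2]
  simp [sub_eq_add_neg]

theorem wedgePair_apply (B : V →L[ℝ] V →L[ℝ] ℝ) (a b : E →L[ℝ] V) (u v : E) :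
    wedgePair B a b ![u, v] = B (a u) (b v) - B (a v) (b u) := rfl

/-- The exterior derivative of `(α ∧ β)` when `dα(u, v) = P u v` and `dβ(u, v) = Q u v`. -/
theorem extDeriv_wedgePair [FiniteDimensional ℝ E] (B : V →L[ℝ] V →L[ℝ] ℝ)
    {α β : E → E →L[ℝ] V} {x : E}
    (hα : ContDiffAt ℝ 1 α x) (hβ : ContDiffAt ℝ 1 β x) {P Q : E → E → V}
    (hP : ∀ u v, fderiv ℝ α x u v - fderiv ℝ α x v u = P u v)
    (hQ : ∀ u v, fderiv ℝ β x u v - fderiv ℝ β x v u = Q u v) (u v w : E) :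
    extDeriv (fun y => wedgePair B (α y) (β y)) x ![u, v, w] =
      B (P u v) (β x w) + B (P v w) (β x u) + B (P w u) (β x v)
      - B (α x u) (Q v w) - B (α x v) (Q w u) - B (α x w) (Q u v) := by
  have hα1 := hα.differentiableAt one_ne_zero
  have hβ1 := hβ.differentiableAt one_ne_zero
  have key : ∀ u v : E, HasFDerivAt (fun y => B (α y u) (β y v))
      ((B (α x u)).comp ((fderiv ℝ β x).flip v) + (B.flip (β x v)).comp ((fderiv ℝ α x).flip u))
      x := by
    intro u v
    have h1 : HasFDerivAt (fun y => α y u) ((fderiv ℝ α x).flip u) x :=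
      hα1.hasFDerivAt.clm_apply (hasFDerivAt_const u x) |>.congr_fderiv (by ext; simp)
    have h2 : HasFDerivAt (fun y => β y v) ((fderiv ℝ β x).flip v) x :=
      hβ1.hasFDerivAt.clm_apply (hasFDerivAt_const v x) |>.congr_fderiv (by ext; simp)
    exact (B.hasFDerivAt_of_bilinear h1 h2).congr_fderiv (by ext; simp)
  have hd : DifferentiableAt ℝ (fun y => wedgePair B (α y) (β y)) x := by
    refine ContDiffAt.differentiableAt (n := 1) (contDiffAt_alternating fun s => ?_) one_ne_zero
    change ContDiffAt ℝ 1 (fun y => B (α y (s 0)) (β y (s 1)) - B (α y (s 1)) (β y (s 0))) x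
    have hB : ∀ u v : E, ContDiffAt ℝ 1 (fun y => B (α y u) (β y v)) x := fun u v =>
      (B.contDiff.contDiffAt.comp x (hα.clm_apply contDiffAt_const)).clm_apply
        (hβ.clm_apply contDiffAt_const)
    exact (hB _ _).sub (hB _ _)
  rw [extDeriv_two_apply hd]
  simp only [wedgePair_apply]
  rw [((key v w).fun_sub (key w v)).fderiv, ((key u w).fun_sub (key w u)).fderiv,
    ((key u v).fun_sub (key v u)).fderiv]
  simp only [sub_apply, add_apply,
    ContinuousLinearMap.comp_apply, ContinuousLinearMap.flip_apply, ← hP, ← hQ, map_sub]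
  ring

/-- The exterior derivative commutes with linear pullbacks. -/
theorem extDeriv_comp_clm {k : ℕ} {η : F → F [⋀^Fin k]→L[ℝ] V} (L : E →L[ℝ] F) {x : E}
    (hη : DifferentiableAt ℝ η (L x)) :
    extDeriv (fun y => (η (L y)).compContinuousLinearMap L) x =
      (extDeriv η (L x)).compContinuousLinearMap L := by
  have h := extDeriv_pullback (r := 2) (f := L) hη L.contDiff.contDiffAt (by simp)
  simpa only [ContinuousLinearMap.fderiv] using h

end NormedSpaces

/-! ### Differentials between manifolds -/

section Differentials

variable {E : Type*} [NormedAddCommGroup E] [NormedSpace ℝ E] {H : Type*} [TopologicalSpace H]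
  (I : ModelWithCorners ℝ E H) {M : Type*} [TopologicalSpace M] [ChartedSpace H M]
  {E' : Type*} [NormedAddCommGroup E'] [NormedSpace ℝ E'] {H' : Type*} [TopologicalSpace H']
  (I' : ModelWithCorners ℝ E' H') {M' : Type*} [TopologicalSpace M'] [ChartedSpace H' M']
  {E'' : Type*} [NormedAddCommGroup E''] [NormedSpace ℝ E''] {H'' : Type*} [TopologicalSpace H'']
  (I'' : ModelWithCorners ℝ E'' H'') {M'' : Type*} [TopologicalSpace M''] [ChartedSpace H'' M'']

/-- The differential of a map, as a linear map between the model spaces. -/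
noncomputable def dM (f : M → M') (x : M) : E →L[ℝ] E' := mfderiv I I' f x

variable {I I' I''}

theorem dM_comp {g : M' → M''} {f : M → M'} {x : M} (hg : MDifferentiableAt I' I'' g (f x))
    (hf : MDifferentiableAt I I' f x) :
    dM I I'' (fun y => g (f y)) x = (dM I' I'' g (f x)).comp (dM I I' f x) :=
  mfderiv_comp x hg hf

theorem dM_congr {f g : M → M'} {x : M} (h : f =ᶠ[𝓝 x] g) : dM I I' f x = dM I I' g x := by
  unfold dM
  exact h.mfderiv_eq

theorem dM_id (x : M) : dM I I (fun y : M => y) x = ContinuousLinearMap.id ℝ E :=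
  mfderiv_id

theorem dM_const (c : M') (x : M) : dM I I' (fun _ : M => c) x = 0 :=
  mfderiv_const

theorem dM_eq_fderiv (f : E → E') (x : E) : dM 𝓘(ℝ, E) 𝓘(ℝ, E') f x = fderiv ℝ f x :=
  mfderiv_eq_fderiv

theorem dM_prodMk {f : M → M'} {g : M → M''} {x : M} (hf : MDifferentiableAt I I' f x)
    (hg : MDifferentiableAt I I'' g x) :
    dM I (I'.prod I'') (fun y => (f y, g y)) x = (dM I I' f x).prod (dM I I'' g x) :=
  mfderiv_prodMk hf hg

theorem dM_fst (z : M × M') :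
    dM (I.prod I') I (Prod.fst : M × M' → M) z = ContinuousLinearMap.fst ℝ E E' :=
  mfderiv_fst

theorem dM_snd (z : M × M') :
    dM (I.prod I') I' (Prod.snd : M × M' → M') z = ContinuousLinearMap.snd ℝ E E' :=
  mfderiv_snd

/-- The differential of a function of two variables, by partial differentials. -/
theorem dM_two {g : M × M' → M''} {z : M × M'} (hg : MDifferentiableAt (I.prod I') I'' g z)
    (v : E) (w : E') :
    dM (I.prod I') I'' g z (v, w)
      = dM I I'' (fun x => g (x, z.2)) z.1 v + dM I' I'' (fun y => g (z.1, y)) z.2 w := by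
  have h1 : MDifferentiableAt I (I.prod I') (fun x : M => (x, z.2)) z.1 :=
    mdifferentiableAt_id.prodMk mdifferentiableAt_const
  have h2 : MDifferentiableAt I' (I.prod I') (fun y : M' => (z.1, y)) z.2 :=
    mdifferentiableAt_const.prodMk mdifferentiableAt_id
  rw [dM_comp (I' := I.prod I') (g := g) (f := fun x : M => (x, z.2)) hg h1,
    dM_comp (I' := I.prod I') (g := g) (f := fun y : M' => (z.1, y)) hg h2,
    dM_prodMk (f := fun x : M => x) (g := fun _ => z.2) mdifferentiableAt_id
      mdifferentiableAt_const,
    dM_prodMk (f := fun _ : M' => z.1) (g := fun y => y) mdifferentiableAt_const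
      mdifferentiableAt_id, dM_id, dM_id, dM_const, dM_const]
  simp only [ContinuousLinearMap.comp_apply, ContinuousLinearMap.prod_apply]
  change _ = dM (I.prod I') I'' g z (v, 0) + dM (I.prod I') I'' g z (0, w)
  rw [← map_add]
  simp

theorem eventually_mdifferentiableAt [IsManifold I ∞ M] [IsManifold I' ∞ M'] {f : M → M'} {x : M}
    (h : ContMDiffAt I I' ∞ f x) : ∀ᶠ y in 𝓝 x, MDifferentiableAt I I' f y := by
  have : IsManifold I 1 M := IsManifold.of_le (n := ∞) (by simp)
  have : IsManifold I' 1 M' := IsManifold.of_le (n := ∞) (by simp)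
  filter_upwards [(contMDiffAt_iff_contMDiffAt_nhds (by simp)).1 (h.of_le (m := 1) (by simp))]
    with y hy using hy.mdifferentiableAt one_ne_zero

/-! #### Charts -/

section Charts

variable [I.Boundaryless] [IsManifold I ∞ M]

theorem target_mem_nhds {x₀ : M} {y : E} (hy : y ∈ (extChartAt I x₀).target) :
    (extChartAt I x₀).target ∈ 𝓝 y :=
  (isOpen_extChartAt_target x₀).mem_nhds hy

theorem contMDiffAt_symm {x₀ : M} {y : E} (hy : y ∈ (extChartAt I x₀).target) :
    ContMDiffAt 𝓘(ℝ, E) I ∞ (extChartAt I x₀).symm y :=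
  (contMDiffOn_extChartAt_symm x₀).contMDiffAt (target_mem_nhds hy)

theorem contMDiffAt_chart {x₀ p : M} (hp : p ∈ (extChartAt I x₀).source) :
    ContMDiffAt I 𝓘(ℝ, E) ∞ (extChartAt I x₀) p :=
  contMDiffAt_extChartAt' (by rwa [extChartAt_source] at hp)

theorem dM_chart_comp_symm {x₀ : M} {y : E} (hy : y ∈ (extChartAt I x₀).target) :
    (dM I 𝓘(ℝ, E) (extChartAt I x₀) ((extChartAt I x₀).symm y)).comp
      (dM 𝓘(ℝ, E) I (extChartAt I x₀).symm y) = ContinuousLinearMap.id ℝ E := by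
  rw [← dM_comp ((contMDiffAt_chart ((extChartAt I x₀).map_target hy)).mdifferentiableAt (by simp))
    ((contMDiffAt_symm hy).mdifferentiableAt (by simp)), ← dM_id (I := 𝓘(ℝ, E)) y]
  refine dM_congr ?_
  filter_upwards [target_mem_nhds hy] with z hz using (extChartAt I x₀).right_inv hz

theorem dM_symm_comp_chart {x₀ : M} {y : E} (hy : y ∈ (extChartAt I x₀).target) :
    (dM 𝓘(ℝ, E) I (extChartAt I x₀).symm y).comp
      (dM I 𝓘(ℝ, E) (extChartAt I x₀) ((extChartAt I x₀).symm y))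
      = ContinuousLinearMap.id ℝ E := by
  have hp := (extChartAt I x₀).map_target hy
  have h2 := (contMDiffAt_chart hp).mdifferentiableAt (n := ∞) (by simp)
  have h1 : MDifferentiableAt 𝓘(ℝ, E) I (extChartAt I x₀).symm
      (extChartAt I x₀ ((extChartAt I x₀).symm y)) := by
    rw [(extChartAt I x₀).right_inv hy]
    exact (contMDiffAt_symm hy).mdifferentiableAt (by simp)
  have := dM_comp h1 h2
  rw [(extChartAt I x₀).right_inv hy] at this
  rw [← this, ← dM_id (I := I) ((extChartAt I x₀).symm y)]
  refine dM_congr ?_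
  filter_upwards [extChartAt_source_mem_nhds' hp] with z hz using (extChartAt I x₀).left_inv hz

theorem dM_chart_self (x : M) :
    dM I 𝓘(ℝ, E) (extChartAt I x) x = ContinuousLinearMap.id ℝ E :=
  have : IsManifold I 1 M := IsManifold.of_le (n := ∞) (by simp)
  mfderiv_extChartAt_self

theorem dM_symm_self (x : M) :
    dM 𝓘(ℝ, E) I (extChartAt I x).symm (extChartAt I x x) = ContinuousLinearMap.id ℝ E := by
  have h := dM_symm_comp_chart (mem_extChartAt_target (I := I) x)
  rwa [extChartAt_to_inv, dM_chart_self, ContinuousLinearMap.comp_id] at h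

theorem extDerivM_apply {k : ℕ} {F : Type*} [NormedAddCommGroup F] [NormedSpace ℝ F]
    (η : ∀ x : M, TangentSpace I x [⋀^Fin k]→L[ℝ] F) (x : M) (v : Fin (k + 1) → E) :
    extDerivM I η x v = extDeriv (chartRep I η x) (extChartAt I x x) v := by
  change extDeriv (chartRep I η x) (extChartAt I x x)
    (fun i => dM I 𝓘(ℝ, E) (extChartAt I x) x (v i)) = _
  have : IsManifold I 1 M := IsManifold.of_le (n := ∞) (by simp)
  have h : dM I 𝓘(ℝ, E) (extChartAt I x) x = ContinuousLinearMap.id ℝ E :=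
    mfderiv_extChartAt_self
  rw [h]
  rfl

end Charts

end Differentials

/-! ### Pullbacks of the Maurer-Cartan forms -/

section MaurerCartan

variable {E : Type*} [NormedAddCommGroup E] [NormedSpace ℝ E] {H : Type*} [TopologicalSpace H]
  (I : ModelWithCorners ℝ E H) {M : Type*} [TopologicalSpace M] [ChartedSpace H M]
  {E' : Type*} [NormedAddCommGroup E'] [NormedSpace ℝ E'] {H' : Type*} [TopologicalSpace H']
  {I' : ModelWithCorners ℝ E' H'} {M' : Type*} [TopologicalSpace M'] [ChartedSpace H' M']
  {EK : Type*} [NormedAddCommGroup EK] [NormedSpace ℝ EK] {HK : Type*} [TopologicalSpace HK]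
  (J : ModelWithCorners ℝ EK HK)
  {K : Type*} [TopologicalSpace K] [ChartedSpace HK K] [Group K]

/-- The pullback `φ^* θˡ` of the left Maurer-Cartan form. -/
noncomputable def mcL (φ : M → K) (p : M) : E →L[ℝ] EK :=
  (dM J J (fun h : K => (φ p)⁻¹ * h) (φ p)).comp (dM I J φ p)

/-- The pullback `φ^* θʳ` of the right Maurer-Cartan form. -/
noncomputable def mcR (φ : M → K) (p : M) : E →L[ℝ] EK :=
  (dM J J (fun h : K => h * (φ p)⁻¹) (φ p)).comp (dM I J φ p)

/-- The adjoint action as a continuous linear map. -/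
noncomputable def AdL (g : K) : EK →L[ℝ] EK := dM J J (fun h : K => g * h * g⁻¹) 1

/-- The Lie bracket on the model space of a Lie group. -/
noncomputable def br (J : ModelWithCorners ℝ EK HK) (K : Type*) [TopologicalSpace K]
    [ChartedSpace HK K] [Group K] (ξ ζ : EK) : EK :=
  @Bracket.bracket (GroupLieAlgebra J K) (GroupLieAlgebra J K) _ ξ ζ

variable {I J}
variable [LieGroup J ∞ K]

theorem mdifferentiableAt_mul_left (a x : K) : MDifferentiableAt J J (fun h : K => a * h) x :=
  (contMDiff_mul_left (I := J) (n := ∞) (a := a)).mdifferentiableAt (by simp)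

theorem mdifferentiableAt_mul_right (a x : K) : MDifferentiableAt J J (fun h : K => h * a) x :=
  (contMDiff_mul_right (I := J) (n := ∞) (a := a)).mdifferentiableAt (by simp)

theorem contMDiff_conj (g : K) : ContMDiff J J ∞ (fun h : K => g * h * g⁻¹) :=
  (contMDiff_mul_left (I := J) (n := ∞) (a := g)).mul contMDiff_const

theorem mdifferentiableAt_conj (g x : K) : MDifferentiableAt J J (fun h : K => g * h * g⁻¹) x :=
  (contMDiff_conj g).mdifferentiableAt (by simp)

theorem _root_.MDifferentiableAt.mul_lie {φ ψ : M → K} {p : M} (hφ : MDifferentiableAt I J φ p)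
    (hψ : MDifferentiableAt I J ψ p) : MDifferentiableAt I J (fun q => φ q * ψ q) p :=
  ((contMDiff_mul J ∞ (G := K)).mdifferentiableAt (by simp)).comp
    (f := fun q => (φ q, ψ q)) p (hφ.prodMk hψ)

theorem mdifferentiableAt_inv_lie (x : K) : MDifferentiableAt J J (fun h : K => h⁻¹) x :=
  (contMDiff_inv J ∞ (G := K)).mdifferentiableAt (by simp)

theorem mcL_eq {φ : M → K} {p : M} (h : MDifferentiableAt I J φ p) :
    mcL I J φ p = dM I J (fun q => (φ p)⁻¹ * φ q) p :=
  (dM_comp (g := fun h : K => (φ p)⁻¹ * h) (mdifferentiableAt_mul_left _ _) h).symm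

theorem mcR_eq {φ : M → K} {p : M} (h : MDifferentiableAt I J φ p) :
    mcR I J φ p = dM I J (fun q => φ q * (φ p)⁻¹) p :=
  (dM_comp (g := fun h : K => h * (φ p)⁻¹) (mdifferentiableAt_mul_right _ _) h).symm

theorem mcL_congr {φ ψ : M → K} {p : M} (h : φ =ᶠ[𝓝 p] ψ) : mcL I J φ p = mcL I J ψ p := by
  rw [mcL, mcL, dM_congr h, h.self_of_nhds]

theorem mcR_congr {φ ψ : M → K} {p : M} (h : φ =ᶠ[𝓝 p] ψ) : mcR I J φ p = mcR I J ψ p := by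
  rw [mcR, mcR, dM_congr h, h.self_of_nhds]

theorem mcL_comp {φ : M' → K} {f : M → M'} {p : M} (hφ : MDifferentiableAt I' J φ (f p))
    (hf : MDifferentiableAt I I' f p) :
    mcL I J (fun q => φ (f q)) p = (mcL I' J φ (f p)).comp (dM I I' f p) := by
  rw [mcL, dM_comp hφ hf]; rfl

theorem mcR_comp {φ : M' → K} {f : M → M'} {p : M} (hφ : MDifferentiableAt I' J φ (f p))
    (hf : MDifferentiableAt I I' f p) :
    mcR I J (fun q => φ (f q)) p = (mcR I' J φ (f p)).comp (dM I I' f p) := by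
  rw [mcR, dM_comp hφ hf]; rfl

theorem mcL_const (c : K) (p : M) : mcL I J (fun _ : M => c) p = 0 := by
  rw [mcL, dM_const, ContinuousLinearMap.comp_zero]

theorem mcL_mul_left {φ : M → K} {p : M} (h : MDifferentiableAt I J φ p) (g : K) :
    mcL I J (fun q => g * φ q) p = mcL I J φ p := by
  rw [mcL_eq (φ := fun q => g * φ q) (mdifferentiableAt_const.mul_lie h), mcL_eq h]
  congr 1
  funext q
  group

theorem mcR_mul_right {φ : M → K} {p : M} (h : MDifferentiableAt I J φ p) (g : K) :
    mcR I J (fun q => φ q * g) p = mcR I J φ p := by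
  rw [mcR_eq (φ := fun q => φ q * g) (h.mul_lie mdifferentiableAt_const), mcR_eq h]
  congr 1
  funext q
  group

theorem dM_conj_comp {φ : M → K} {p : M} (h : MDifferentiableAt I J φ p) (h1 : φ p = 1) (g : K) :
    dM I J (fun q => g * φ q * g⁻¹) p = (AdL J g).comp (dM I J φ p) := by
  rw [dM_comp (g := fun h : K => g * h * g⁻¹) (mdifferentiableAt_conj _ _) h, h1]
  rfl

theorem mcR_eq_AdL_comp_mcL {φ : M → K} {p : M} (h : MDifferentiableAt I J φ p) :
    mcR I J φ p = (AdL J (φ p)).comp (mcL I J φ p) := by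
  rw [mcR_eq h, mcL_eq h, ← dM_conj_comp (φ := fun q => (φ p)⁻¹ * φ q)
    (mdifferentiableAt_const.mul_lie h) (by simp)]
  congr 1
  funext q
  group

theorem AdL_one : AdL J (1 : K) = ContinuousLinearMap.id ℝ EK := by
  rw [AdL, ← dM_id (I := J) (1 : K)]
  congr 1
  funext h
  simp

theorem AdL_mul (g h : K) : AdL J (g * h) = (AdL J g).comp (AdL J h) := by
  have := dM_conj_comp (φ := fun x : K => h * x * h⁻¹) (p := 1) (mdifferentiableAt_conj (J := J) h 1)
    (by simp) g
  rw [AdL, AdL.eq_1 J h, ← this]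
  congr 1
  funext x
  group

theorem AdL_inv_comp (g : K) : (AdL J g⁻¹).comp (AdL J g) = ContinuousLinearMap.id ℝ EK := by
  rw [← AdL_mul, inv_mul_cancel, AdL_one]

theorem AdL_inv_apply (g : K) (ξ : EK) : AdL J g⁻¹ (AdL J g ξ) = ξ :=
  congrArg (fun L : EK →L[ℝ] EK => L ξ) (AdL_inv_comp g)

theorem AdL_apply_inv (g : K) (ξ : EK) : AdL J g (AdL J g⁻¹ ξ) = ξ := by
  simpa using AdL_inv_apply g⁻¹ ξ

/-- At the identity the differential of a product is the sum of the differentials. -/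
theorem dM_mul_of_eq_one {φ ψ : M → K} {p : M} (hφ : MDifferentiableAt I J φ p)
    (hψ : MDifferentiableAt I J ψ p) (h1 : φ p = 1) (h2 : ψ p = 1) :
    dM I J (fun q => φ q * ψ q) p = dM I J φ p + dM I J ψ p := by
  have hm : MDifferentiableAt (J.prod J) J (fun z : K × K => z.1 * z.2) (φ p, ψ p) :=
    (contMDiff_mul J ∞ (G := K)).mdifferentiableAt (by simp)
  rw [dM_comp (g := fun z : K × K => z.1 * z.2) (f := fun q => (φ q, ψ q)) hm (hφ.prodMk hψ),
    dM_prodMk hφ hψ]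
  ext v
  simp only [ContinuousLinearMap.comp_apply, ContinuousLinearMap.prod_apply]
  rw [dM_two hm]
  simp only [h1, h2, one_mul, mul_one, dM_id]
  rfl

theorem mcL_mul {φ ψ : M → K} {p : M} (hφ : MDifferentiableAt I J φ p)
    (hψ : MDifferentiableAt I J ψ p) :
    mcL I J (fun q => φ q * ψ q) p = (AdL J (ψ p)⁻¹).comp (mcL I J φ p) + mcL I J ψ p := by
  have h1 : MDifferentiableAt I J (fun q => (φ p)⁻¹ * φ q) p := mdifferentiableAt_const.mul_lie hφ
  have h2 : MDifferentiableAt I J (fun q => (ψ p)⁻¹ * ψ q) p := mdifferentiableAt_const.mul_lie hψ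
  have h3 : MDifferentiableAt I J (fun q => (ψ p)⁻¹ * ((φ p)⁻¹ * φ q) * ((ψ p)⁻¹)⁻¹) p :=
    (mdifferentiableAt_const.mul_lie h1).mul_lie mdifferentiableAt_const
  rw [mcL_eq (hφ.mul_lie hψ), mcL_eq hφ, mcL_eq hψ, ← dM_conj_comp h1 (by simp),
    ← dM_mul_of_eq_one h3 h2 (by simp) (by simp)]
  congr 1
  funext q
  group

theorem mcR_mul {φ ψ : M → K} {p : M} (hφ : MDifferentiableAt I J φ p)
    (hψ : MDifferentiableAt I J ψ p) :
    mcR I J (fun q => φ q * ψ q) p = mcR I J φ p + (AdL J (φ p)).comp (mcR I J ψ p) := by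
  have h1 : MDifferentiableAt I J (fun q => φ q * (φ p)⁻¹) p := hφ.mul_lie mdifferentiableAt_const
  have h2 : MDifferentiableAt I J (fun q => ψ q * (ψ p)⁻¹) p := hψ.mul_lie mdifferentiableAt_const
  have h3 : MDifferentiableAt I J (fun q => φ p * (ψ q * (ψ p)⁻¹) * (φ p)⁻¹) p :=
    (mdifferentiableAt_const.mul_lie h2).mul_lie mdifferentiableAt_const
  rw [mcR_eq (hφ.mul_lie hψ), mcR_eq hφ, mcR_eq hψ, ← dM_conj_comp h2 (by simp),
    ← dM_mul_of_eq_one h1 h3 (by simp) (by simp)]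
  congr 1
  funext q
  group

theorem mcL_conj {φ : M → K} {p : M} (hφ : MDifferentiableAt I J φ p) (g : K) :
    mcL I J (fun q => g * φ q * g⁻¹) p = (AdL J g).comp (mcL I J φ p) := by
  rw [mcL_mul (mdifferentiableAt_const.mul_lie hφ) mdifferentiableAt_const, mcL_const,
    mcL_mul_left hφ, inv_inv, add_zero]

theorem mcR_conj {φ : M → K} {p : M} (hφ : MDifferentiableAt I J φ p) (g : K) :
    mcR I J (fun q => g * φ q * g⁻¹) p = (AdL J g).comp (mcR I J φ p) := by
  rw [mcR_eq_AdL_comp_mcL ((mdifferentiableAt_const.mul_lie hφ).mul_lie mdifferentiableAt_const),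
    mcL_conj hφ, mcR_eq_AdL_comp_mcL hφ, AdL_mul, AdL_mul]
  ext v
  simp [AdL_inv_apply]

theorem mcL_id_one : mcL J J (fun k : K => k) 1 = ContinuousLinearMap.id ℝ EK := by
  rw [mcL_eq (φ := fun k : K => k) mdifferentiableAt_id, ← dM_id (I := J) (1 : K)]
  congr 1
  funext q
  simp

theorem mcL_inv_one : mcL J J (fun k : K => k⁻¹) 1 = - ContinuousLinearMap.id ℝ EK := by
  have h := mcL_mul (p := (1 : K)) (mdifferentiableAt_id (I := J)) (mdifferentiableAt_inv_lie 1)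
  simp only [mul_inv_cancel, inv_one, AdL_one, mcL_const, ContinuousLinearMap.id_comp,
    id_eq] at h
  erw [mcL_id_one] at h
  exact (neg_eq_of_add_eq_zero_right h.symm).symm

/-- The left Maurer-Cartan form along a conjugacy class. -/
theorem mcL_orbit (a : K) :
    mcL J J (fun k : K => k * a * k⁻¹) 1 = AdL J a⁻¹ - ContinuousLinearMap.id ℝ EK := by
  rw [mcL_mul (mdifferentiableAt_mul_right a 1) (mdifferentiableAt_inv_lie 1), mcL_inv_one,
    mcL_mul (φ := fun k : K => k) mdifferentiableAt_id mdifferentiableAt_const, mcL_const,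
    mcL_id_one]
  simp [AdL_one, sub_eq_add_neg]

end MaurerCartan

section Products

variable {E : Type*} [NormedAddCommGroup E] [NormedSpace ℝ E] {H : Type*} [TopologicalSpace H]
  {I : ModelWithCorners ℝ E H} {M : Type*} [TopologicalSpace M] [ChartedSpace H M]
  {EK : Type*} [NormedAddCommGroup EK] [NormedSpace ℝ EK] {HK : Type*} [TopologicalSpace HK]
  {J : ModelWithCorners ℝ EK HK}
  {K : Type*} [TopologicalSpace K] [ChartedSpace HK K] [Group K] [LieGroup J ∞ K]
  {EK' : Type*} [NormedAddCommGroup EK'] [NormedSpace ℝ EK'] {HK' : Type*} [TopologicalSpace HK']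
  {J' : ModelWithCorners ℝ EK' HK'}
  {K' : Type*} [TopologicalSpace K'] [ChartedSpace HK' K'] [Group K'] [LieGroup J' ∞ K']

theorem mcL_prodMk {φ : M → K} {ψ : M → K'} {p : M} (hφ : MDifferentiableAt I J φ p)
    (hψ : MDifferentiableAt I J' ψ p) :
    mcL I (J.prod J') (fun q => (φ q, ψ q)) p = (mcL I J φ p).prod (mcL I J' ψ p) := by
  rw [mcL_eq (hφ.prodMk hψ), mcL_eq hφ, mcL_eq hψ,
    ← dM_prodMk (mdifferentiableAt_const.mul_lie hφ) (mdifferentiableAt_const.mul_lie hψ)]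
  rfl

theorem mcR_prodMk {φ : M → K} {ψ : M → K'} {p : M} (hφ : MDifferentiableAt I J φ p)
    (hψ : MDifferentiableAt I J' ψ p) :
    mcR I (J.prod J') (fun q => (φ q, ψ q)) p = (mcR I J φ p).prod (mcR I J' ψ p) := by
  rw [mcR_eq (hφ.prodMk hψ), mcR_eq hφ, mcR_eq hψ,
    ← dM_prodMk (hφ.mul_lie mdifferentiableAt_const) (hψ.mul_lie mdifferentiableAt_const)]
  rfl

end Products

/-! ### Lie groups near the identity -/

section LocalLie

variable {E : Type*} [NormedAddCommGroup E] [NormedSpace ℝ E] [FiniteDimensional ℝ E]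
  {H : Type*} [TopologicalSpace H]
  (I : ModelWithCorners ℝ E H) [I.Boundaryless]
  (G : Type*) [TopologicalSpace G] [ChartedSpace H G] [Group G] [LieGroup I ∞ G]

/-- The chart at the identity, as a map to the model vector space. -/
local notation "κ" => extChartAt I (1 : G)

/-- The coordinates of the identity. -/
local notation "x₁" => extChartAt I (1 : G) (1 : G)

/-- The multiplication in the chart at the identity. -/
noncomputable def locMul (z : E × E) : E := κ ((κ).symm z.1 * (κ).symm z.2)

/-- The left-invariant frame in the chart at the identity. -/
noncomputable def frameL (x : E) : E →L[ℝ] E :=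
  (fderiv ℝ (locMul I G) (x, x₁)).comp (ContinuousLinearMap.inr ℝ E E)

/-- The right-invariant frame in the chart at the identity. -/
noncomputable def frameR (x : E) : E →L[ℝ] E :=
  (fderiv ℝ (locMul I G) (x₁, x)).comp (ContinuousLinearMap.inl ℝ E E)

/-- The mixed second derivative at the identity of the multiplication. -/
noncomputable def hess (u v : E) : E :=
  fderiv ℝ (fderiv ℝ (locMul I G)) (x₁, x₁) (u, 0) (0, v)

variable {I G}

theorem symm_one : (κ).symm x₁ = (1 : G) := extChartAt_to_inv 1

theorem one_mem_target : x₁ ∈ (κ).target := mem_extChartAt_target 1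

theorem contMDiffAt_locMul {z : E × E} (h1 : z.1 ∈ (κ).target) (h2 : z.2 ∈ (κ).target)
    (h : (κ).symm z.1 * (κ).symm z.2 ∈ (κ).source) : ContDiffAt ℝ ∞ (locMul I G) z := by
  rw [← contMDiffAt_iff_contDiffAt]
  have a1 : ContMDiffAt 𝓘(ℝ, E × E) I ∞ (fun z : E × E => (κ).symm z.1) z :=
    (contMDiffAt_symm h1).comp z contDiff_fst.contMDiff.contMDiffAt
  have a2 : ContMDiffAt 𝓘(ℝ, E × E) I ∞ (fun z : E × E => (κ).symm z.2) z :=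
    (contMDiffAt_symm h2).comp z contDiff_snd.contMDiff.contMDiffAt
  exact (contMDiffAt_chart h).comp z (a1.mul a2)

theorem contDiffAt_locMul_one : ContDiffAt ℝ ∞ (locMul I G) (x₁, x₁) :=
  contMDiffAt_locMul one_mem_target one_mem_target (by
    simp only [symm_one, mul_one]
    exact mem_extChartAt_source 1)

theorem contDiffAt_fderiv_locMul : ContDiffAt ℝ ∞ (fderiv ℝ (locMul I G)) (x₁, x₁) :=
  contDiffAt_locMul_one.fderiv_right (by simp)

theorem contDiffAt_frameL : ContDiffAt ℝ ∞ (frameL I G) x₁ :=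
  (ContDiffAt.comp x₁ (f := fun x : E => (x, x₁)) contDiffAt_fderiv_locMul
    (contDiffAt_id.prodMk contDiffAt_const)).clm_comp contDiffAt_const

theorem contDiffAt_frameR : ContDiffAt ℝ ∞ (frameR I G) x₁ :=
  (ContDiffAt.comp x₁ (f := fun x : E => (x₁, x)) contDiffAt_fderiv_locMul
    (contDiffAt_const.prodMk contDiffAt_id)).clm_comp contDiffAt_const

theorem fderiv_frameL (u v : E) : fderiv ℝ (frameL I G) x₁ u v = hess I G u v := by
  have h1 : HasFDerivAt (fun x : E => (x, x₁)) (ContinuousLinearMap.inl ℝ E E) x₁ :=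
    (hasFDerivAt_id x₁).prodMk (hasFDerivAt_const _ _)
  have h2 := (contDiffAt_fderiv_locMul (I := I) (G := G)).differentiableAt (by simp)
  have h3 := (HasFDerivAt.comp x₁ (f := fun x : E => (x, x₁)) h2.hasFDerivAt h1).clm_comp
    (hasFDerivAt_const (ContinuousLinearMap.inr ℝ E E) x₁)
  rw [show fderiv ℝ (frameL I G) x₁ = _ from h3.fderiv]
  simp [hess]

theorem fderiv_frameR (u v : E) : fderiv ℝ (frameR I G) x₁ u v = hess I G v u := by
  have h1 : HasFDerivAt (fun x : E => (x₁, x)) (ContinuousLinearMap.inr ℝ E E) x₁ :=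
    (hasFDerivAt_const _ _).prodMk (hasFDerivAt_id x₁)
  have h2 := (contDiffAt_fderiv_locMul (I := I) (G := G)).differentiableAt (by simp)
  have h3 := (HasFDerivAt.comp x₁ (f := fun x : E => (x₁, x)) h2.hasFDerivAt h1).clm_comp
    (hasFDerivAt_const (ContinuousLinearMap.inl ℝ E E) x₁)
  have hs := (contDiffAt_locMul_one (I := I) (G := G)).isSymmSndFDerivAt minSmoothness_two_le (v, 0) (0, u)
  rw [hess, hs, show fderiv ℝ (frameR I G) x₁ = _ from h3.fderiv]
  simp

theorem hess_add_left (u u' v : E) : hess I G (u + u') v = hess I G u v + hess I G u' v := by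
  simp [← fderiv_frameL]

theorem hess_add_right (u v v' : E) : hess I G u (v + v') = hess I G u v + hess I G u v' := by
  simp [← fderiv_frameL]

theorem frameL_eq {x : E} (hx : x ∈ (κ).target) :
    frameL I G x = (dM I 𝓘(ℝ, E) κ ((κ).symm x)).comp
      (dM I I (fun h : G => (κ).symm x * h) 1) := by
  have hs : (κ).symm x ∈ (κ).source := (κ).map_target hx
  have hd : DifferentiableAt ℝ (locMul I G) (x, x₁) :=
    (contMDiffAt_locMul hx one_mem_target (by
      simpa only [symm_one, mul_one] using hs)).differentiableAt (by simp)
  have h1 : HasFDerivAt (fun y : E => (x, y)) (ContinuousLinearMap.inr ℝ E E) x₁ :=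
    (hasFDerivAt_const _ _).prodMk (hasFDerivAt_id x₁)
  have h2 : frameL I G x = fderiv ℝ (fun y => locMul I G (x, y)) x₁ :=
    (HasFDerivAt.comp x₁ (f := fun y : E => (x, y)) hd.hasFDerivAt h1).fderiv.symm
  have e1 : MDifferentiableAt 𝓘(ℝ, E) I (κ).symm x₁ :=
    (contMDiffAt_symm one_mem_target).mdifferentiableAt (by simp)
  have e2 : MDifferentiableAt I I (fun h : G => (κ).symm x * h) ((κ).symm x₁) :=
    mdifferentiableAt_mul_left _ _
  have e3 : MDifferentiableAt I 𝓘(ℝ, E) κ ((κ).symm x * (κ).symm x₁) := by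
    rw [symm_one, mul_one]
    exact (contMDiffAt_chart hs).mdifferentiableAt (by simp)
  rw [h2, ← dM_eq_fderiv]
  change dM 𝓘(ℝ, E) 𝓘(ℝ, E) (fun y => κ ((κ).symm x * (κ).symm y)) x₁ = _
  rw [dM_comp (g := κ) (f := fun y => (κ).symm x * (κ).symm y) e3 (e2.comp x₁ e1),
    dM_comp (g := fun h : G => (κ).symm x * h) e2 e1, dM_symm_self, symm_one, mul_one]
  rfl

theorem frameR_eq {x : E} (hx : x ∈ (κ).target) :
    frameR I G x = (dM I 𝓘(ℝ, E) κ ((κ).symm x)).comp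
      (dM I I (fun h : G => h * (κ).symm x) 1) := by
  have hs : (κ).symm x ∈ (κ).source := (κ).map_target hx
  have hd : DifferentiableAt ℝ (locMul I G) (x₁, x) :=
    (contMDiffAt_locMul one_mem_target hx (by
      simpa only [symm_one, one_mul] using hs)).differentiableAt (by simp)
  have h1 : HasFDerivAt (fun y : E => (y, x)) (ContinuousLinearMap.inl ℝ E E) x₁ :=
    (hasFDerivAt_id x₁).prodMk (hasFDerivAt_const _ _)
  have h2 : frameR I G x = fderiv ℝ (fun y => locMul I G (y, x)) x₁ :=
    (HasFDerivAt.comp x₁ (f := fun y : E => (y, x)) hd.hasFDerivAt h1).fderiv.symm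
  have e1 : MDifferentiableAt 𝓘(ℝ, E) I (κ).symm x₁ :=
    (contMDiffAt_symm one_mem_target).mdifferentiableAt (by simp)
  have e2 : MDifferentiableAt I I (fun h : G => h * (κ).symm x) ((κ).symm x₁) :=
    mdifferentiableAt_mul_right _ _
  have e3 : MDifferentiableAt I 𝓘(ℝ, E) κ ((κ).symm x₁ * (κ).symm x) := by
    rw [symm_one, one_mul]
    exact (contMDiffAt_chart hs).mdifferentiableAt (by simp)
  rw [h2, ← dM_eq_fderiv]
  change dM 𝓘(ℝ, E) 𝓘(ℝ, E) (fun y => κ ((κ).symm y * (κ).symm x)) x₁ = _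
  rw [dM_comp (g := κ) (f := fun y => (κ).symm y * (κ).symm x) e3 (e2.comp x₁ e1),
    dM_comp (g := fun h : G => h * (κ).symm x) e2 e1, dM_symm_self, symm_one, one_mul]
  rfl

theorem mul_left_inv_comp (g : G) : (dM I I (fun h : G => g⁻¹ * h) g).comp
    (dM I I (fun h : G => g * h) 1) = ContinuousLinearMap.id ℝ E := by
  have := dM_comp (g := fun h : G => g⁻¹ * h) (f := fun h : G => g * h) (x := (1 : G))
    (mdifferentiableAt_mul_left (J := I) _ _) (mdifferentiableAt_mul_left (J := I) _ _)
  simp only [inv_mul_cancel_left, mul_one, dM_id] at this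
  exact this.symm

theorem mul_right_inv_comp (g : G) : (dM I I (fun h : G => h * g⁻¹) g).comp
    (dM I I (fun h : G => h * g) 1) = ContinuousLinearMap.id ℝ E := by
  have := dM_comp (g := fun h : G => h * g⁻¹) (f := fun h : G => h * g) (x := (1 : G))
    (mdifferentiableAt_mul_right (J := I) _ _) (mdifferentiableAt_mul_right (J := I) _ _)
  simp only [mul_inv_cancel_right, one_mul, dM_id] at this
  exact this.symm

theorem mcL_symm_comp_frameL {x : E} (hx : x ∈ (κ).target) :
    (mcL 𝓘(ℝ, E) I (κ).symm x).comp (frameL I G x) = ContinuousLinearMap.id ℝ E := by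
  rw [frameL_eq hx, mcL]
  ext v
  have h1 := fun w => congrArg (fun L : E →L[ℝ] E => L w) (dM_symm_comp_chart hx)
  have h2 := congrArg (fun L : E →L[ℝ] E => L v) (mul_left_inv_comp (I := I) ((κ).symm x))
  simp only [ContinuousLinearMap.comp_apply, ContinuousLinearMap.id_apply] at h1 h2 ⊢
  rw [h1, h2]

theorem mcR_symm_comp_frameR {x : E} (hx : x ∈ (κ).target) :
    (mcR 𝓘(ℝ, E) I (κ).symm x).comp (frameR I G x) = ContinuousLinearMap.id ℝ E := by
  rw [frameR_eq hx, mcR]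
  ext v
  have h1 := fun w => congrArg (fun L : E →L[ℝ] E => L w) (dM_symm_comp_chart hx)
  have h2 := congrArg (fun L : E →L[ℝ] E => L v) (mul_right_inv_comp (I := I) ((κ).symm x))
  simp only [ContinuousLinearMap.comp_apply, ContinuousLinearMap.id_apply] at h1 h2 ⊢
  rw [h1, h2]

/-- A one-sided inverse of a smooth family of endomorphisms, with the identity as its value at a
point, is smooth there, with the opposite derivative. -/
theorem contDiffAt_of_comp_eq_id {T S : E → E →L[ℝ] E} {x : E}
    (h : ∀ᶠ y in 𝓝 x, (T y).comp (S y) = ContinuousLinearMap.id ℝ E)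
    (hS : ContDiffAt ℝ ∞ S x) (h1 : S x = ContinuousLinearMap.id ℝ E) :
    ContDiffAt ℝ ∞ T x ∧ T x = ContinuousLinearMap.id ℝ E ∧
      ∀ u v, fderiv ℝ T x u v = - fderiv ℝ S x u v := by
  have hinv : ContDiffAt ℝ ∞ (fun y => (S y).inverse) x := by
    refine ContDiffAt.comp x (g := ContinuousLinearMap.inverse) ?_ hS
    rw [h1]
    exact contDiffAt_map_inverse (ContinuousLinearEquiv.refl ℝ E)
  have hT : T =ᶠ[𝓝 x] fun y => (S y).inverse := by
    filter_upwards [h] with y hy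
    have hy' : (S y).comp (T y) = ContinuousLinearMap.id ℝ E := by
      have h0 : (T y : E →ₗ[ℝ] E) ∘ₗ (S y : E →ₗ[ℝ] E) = LinearMap.id :=
        congrArg (fun L : E →L[ℝ] E => (L : E →ₗ[ℝ] E)) hy
      have h2 : (S y : E →ₗ[ℝ] E) ∘ₗ (T y : E →ₗ[ℝ] E) = LinearMap.id :=
        (mul_eq_one_comm (M := Module.End ℝ E)).1 h0
      ext v
      exact congrArg (fun L : E →ₗ[ℝ] E => L v) h2
    exact (ContinuousLinearMap.inverse_eq hy' hy).symm
  have hTx : T x = ContinuousLinearMap.id ℝ E := by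
    have := h.self_of_nhds
    rwa [h1, ContinuousLinearMap.comp_id] at this
  have hTs : ContDiffAt ℝ ∞ T x := hinv.congr_of_eventuallyEq hT
  refine ⟨hTs, hTx, fun u v => ?_⟩
  have e1 := (hTs.differentiableAt (by simp)).hasFDerivAt.clm_comp
    (hS.differentiableAt (by simp)).hasFDerivAt
  have e2 : HasFDerivAt (fun y => (T y).comp (S y)) (0 : E →L[ℝ] (E →L[ℝ] E)) x :=
    (hasFDerivAt_const (ContinuousLinearMap.id ℝ E) x).congr_of_eventuallyEq h
  have e3 := congrArg (fun L : E →L[ℝ] (E →L[ℝ] E) => L u v) (e1.unique e2)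
  simp [h1, hTx] at e3
  exact eq_neg_of_add_eq_zero_right e3

theorem frameL_one : frameL I G x₁ = ContinuousLinearMap.id ℝ E := by
  rw [frameL_eq one_mem_target, symm_one, dM_chart_self]
  simp only [one_mul, dM_id, ContinuousLinearMap.comp_id]

theorem frameR_one : frameR I G x₁ = ContinuousLinearMap.id ℝ E := by
  rw [frameR_eq one_mem_target, symm_one, dM_chart_self]
  simp only [mul_one, dM_id, ContinuousLinearMap.comp_id]

theorem mcL_symm_spec : ContDiffAt ℝ ∞ (mcL 𝓘(ℝ, E) I (κ).symm) x₁ ∧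
    mcL 𝓘(ℝ, E) I (κ).symm x₁ = ContinuousLinearMap.id ℝ E ∧
    ∀ u v, fderiv ℝ (mcL 𝓘(ℝ, E) I (κ).symm) x₁ u v = - hess I G u v := by
  have := contDiffAt_of_comp_eq_id (T := mcL 𝓘(ℝ, E) I (κ).symm) (S := frameL I G) (x := x₁)
    (by filter_upwards [target_mem_nhds (one_mem_target (I := I) (G := G))] with y hy using
      mcL_symm_comp_frameL hy) contDiffAt_frameL frameL_one
  simpa only [fderiv_frameL] using this

theorem mcR_symm_spec : ContDiffAt ℝ ∞ (mcR 𝓘(ℝ, E) I (κ).symm) x₁ ∧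
    mcR 𝓘(ℝ, E) I (κ).symm x₁ = ContinuousLinearMap.id ℝ E ∧
    ∀ u v, fderiv ℝ (mcR 𝓘(ℝ, E) I (κ).symm) x₁ u v = - hess I G v u := by
  have := contDiffAt_of_comp_eq_id (T := mcR 𝓘(ℝ, E) I (κ).symm) (S := frameR I G) (x := x₁)
    (by filter_upwards [target_mem_nhds (one_mem_target (I := I) (G := G))] with y hy using
      mcR_symm_comp_frameR hy) contDiffAt_frameR frameR_one
  simpa only [fderiv_frameR] using this

end LocalLie

/-! ### The Maurer-Cartan equations -/

section MaurerCartanEquations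

variable {N : Type*} [NormedAddCommGroup N] [NormedSpace ℝ N]
  {E : Type*} [NormedAddCommGroup E] [NormedSpace ℝ E] [FiniteDimensional ℝ E]
  {H : Type*} [TopologicalSpace H]
  {I : ModelWithCorners ℝ E H} [I.Boundaryless]
  {G : Type*} [TopologicalSpace G] [ChartedSpace H G] [Group G] [LieGroup I ∞ G]

local notation "κ" => extChartAt I (1 : G)

local notation "x₁" => extChartAt I (1 : G) (1 : G)

variable (I G) in
/-- The left-invariant vector fields in the chart at the identity. -/
noncomputable def chartField (ξ : GroupLieAlgebra I G) (y : E) : E :=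
  VectorField.mpullbackWithin 𝓘(ℝ, E) I (κ).symm (mulInvariantVectorField ξ) (range I) y

/-- The Lie bracket is the antisymmetrized second derivative of the multiplication. -/
theorem br_eq_hess (ξ ζ : E) : br I G ξ ζ = hess I G ξ ζ - hess I G ζ ξ := by
  have hfield : ∀ ξ : E, chartField I G ξ =ᶠ[𝓝 x₁] fun y => frameL I G y ξ := by
    intro ξ
    filter_upwards [target_mem_nhds (one_mem_target (I := I) (G := G))] with y hy
    have h1 : (dM 𝓘(ℝ, E) I (κ).symm y).inverse = dM I 𝓘(ℝ, E) κ ((κ).symm y) :=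
      ContinuousLinearMap.inverse_eq (dM_symm_comp_chart hy) (dM_chart_comp_symm hy)
    have h0 : mfderivWithin 𝓘(ℝ, E) I (κ).symm (range I) y = dM 𝓘(ℝ, E) I (κ).symm y := by
      rw [I.range_eq_univ, mfderivWithin_univ]
      rfl
    refine (congrArg (fun L : E →L[ℝ] E =>
      L.inverse (dM I I (fun h : G => (κ).symm y * h) 1 ξ)) h0).trans ?_
    rw [frameL_eq hy, h1]
    rfl
  have hd : ∀ ξ : E, HasFDerivAt (fun y => frameL I G y ξ)
      ((fderiv ℝ (frameL I G) x₁).flip ξ) x₁ := fun ξ =>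
    (((contDiffAt_frameL (I := I) (G := G)).differentiableAt (by simp)).hasFDerivAt.clm_apply
      (hasFDerivAt_const ξ x₁)).congr_fderiv (by ext; simp)
  have h0 : VectorField.lieBracketWithin ℝ (chartField I G ξ) (chartField I G ζ)
      ((κ).symm ⁻¹' univ ∩ range I) x₁ = hess I G ξ ζ - hess I G ζ ξ := by
    rw [preimage_univ, I.range_eq_univ, univ_inter, VectorField.lieBracketWithin_univ,
      (hfield ξ).lieBracket_vectorField_eq (hfield ζ), VectorField.lieBracket,
      (hd ξ).fderiv, (hd ζ).fderiv, frameL_one]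
    simp only [ContinuousLinearMap.flip_apply, ContinuousLinearMap.id_apply, fderiv_frameL]
  have h2 : (dM I 𝓘(ℝ, E) κ (1 : G)).inverse = ContinuousLinearMap.id ℝ E := by
    rw [dM_chart_self, ContinuousLinearMap.inverse_id]
  rw [br]
  change VectorField.mlieBracketWithin I _ _ univ (1 : G) = _
  rw [VectorField.mlieBracketWithin_apply]
  have h3 := congrArg (fun L : E →L[ℝ] E => L (hess I G ξ ζ - hess I G ζ ξ)) h2
  refine Eq.trans ?_ h3
  exact congrArg (fun w : E => (dM I 𝓘(ℝ, E) κ (1 : G)).inverse w) h0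

theorem br_swap (ξ ζ : E) : br I G ξ ζ = - br I G ζ ξ := by
  rw [br_eq_hess, br_eq_hess]; abel

theorem br_add_left (ξ ξ' ζ : E) : br I G (ξ + ξ') ζ = br I G ξ ζ + br I G ξ' ζ := by
  simp only [br_eq_hess, hess_add_left, hess_add_right]; abel

theorem br_add_right (ξ ζ ζ' : E) : br I G ξ (ζ + ζ') = br I G ξ ζ + br I G ξ ζ' := by
  simp only [br_eq_hess, hess_add_left, hess_add_right]; abel

variable {ψ : N → G} {y₀ : N}

theorem mcL_local (h : ContMDiffAt 𝓘(ℝ, N) I ∞ ψ y₀) :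
    ∃ φ : N → E, ContDiffAt ℝ ∞ φ y₀ ∧ φ y₀ = x₁ ∧
      mcL 𝓘(ℝ, N) I ψ =ᶠ[𝓝 y₀]
        fun y => (mcL 𝓘(ℝ, E) I (κ).symm (φ y)).comp (fderiv ℝ φ y) := by
  have hψ' : ContMDiffAt 𝓘(ℝ, N) I ∞ (fun y => (ψ y₀)⁻¹ * ψ y) y₀ := contMDiffAt_const.mul h
  have h1 : (ψ y₀)⁻¹ * ψ y₀ = 1 := inv_mul_cancel _
  have hφ : ContDiffAt ℝ ∞ (fun y => κ ((ψ y₀)⁻¹ * ψ y)) y₀ := by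
    rw [← contMDiffAt_iff_contDiffAt]
    refine ContMDiffAt.comp y₀ (g := κ) ?_ hψ'
    rw [h1]
    exact contMDiffAt_chart (mem_extChartAt_source 1)
  refine ⟨_, hφ, by simp only [h1], ?_⟩
  have hs : ∀ᶠ y in 𝓝 y₀, (ψ y₀)⁻¹ * ψ y ∈ (κ).source :=
    hψ'.continuousAt.preimage_mem_nhds (by
      rw [h1]
      exact extChartAt_source_mem_nhds 1)
  filter_upwards [eventually_mdifferentiableAt h, hs, hs.eventually_nhds,
    (hφ.of_le (m := 1) (by simp)).eventually (by simp)] with y hy hys hys' hφy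
  have ht : κ ((ψ y₀)⁻¹ * ψ y) ∈ (κ).target := (κ).map_source hys
  rw [← mcL_mul_left hy (ψ y₀)⁻¹, ← dM_eq_fderiv,
    ← mcL_comp (φ := (κ).symm) (f := fun y => κ ((ψ y₀)⁻¹ * ψ y))
      ((contMDiffAt_symm ht).mdifferentiableAt (by simp))
      ((hφy.differentiableAt one_ne_zero).mdifferentiableAt)]
  refine mcL_congr ?_
  filter_upwards [hys'] with z hz using ((κ).left_inv hz).symm

theorem mcR_local (h : ContMDiffAt 𝓘(ℝ, N) I ∞ ψ y₀) :
    ∃ φ : N → E, ContDiffAt ℝ ∞ φ y₀ ∧ φ y₀ = x₁ ∧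
      mcR 𝓘(ℝ, N) I ψ =ᶠ[𝓝 y₀]
        fun y => (mcR 𝓘(ℝ, E) I (κ).symm (φ y)).comp (fderiv ℝ φ y) := by
  have hψ' : ContMDiffAt 𝓘(ℝ, N) I ∞ (fun y => ψ y * (ψ y₀)⁻¹) y₀ := h.mul contMDiffAt_const
  have h1 : ψ y₀ * (ψ y₀)⁻¹ = 1 := mul_inv_cancel _
  have hφ : ContDiffAt ℝ ∞ (fun y => κ (ψ y * (ψ y₀)⁻¹)) y₀ := by
    rw [← contMDiffAt_iff_contDiffAt]
    refine ContMDiffAt.comp y₀ (g := κ) ?_ hψ'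
    rw [h1]
    exact contMDiffAt_chart (mem_extChartAt_source 1)
  refine ⟨_, hφ, by simp only [h1], ?_⟩
  have hs : ∀ᶠ y in 𝓝 y₀, ψ y * (ψ y₀)⁻¹ ∈ (κ).source :=
    hψ'.continuousAt.preimage_mem_nhds (by
      rw [h1]
      exact extChartAt_source_mem_nhds 1)
  filter_upwards [eventually_mdifferentiableAt h, hs, hs.eventually_nhds,
    (hφ.of_le (m := 1) (by simp)).eventually (by simp)] with y hy hys hys' hφy
  have ht : κ (ψ y * (ψ y₀)⁻¹) ∈ (κ).target := (κ).map_source hys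
  rw [← mcR_mul_right hy (ψ y₀)⁻¹, ← dM_eq_fderiv,
    ← mcR_comp (φ := (κ).symm) (f := fun y => κ (ψ y * (ψ y₀)⁻¹))
      ((contMDiffAt_symm ht).mdifferentiableAt (by simp))
      ((hφy.differentiableAt one_ne_zero).mdifferentiableAt)]
  refine mcR_congr ?_
  filter_upwards [hys'] with z hz using ((κ).left_inv hz).symm

/-- The antisymmetrized derivative of `T(φ) ∘ dφ`. -/
theorem fderiv_comp_fderiv_antisymm {T : E → E →L[ℝ] E} {φ : N → E}
    (hT : ContDiffAt ℝ ∞ T (φ y₀)) (hφ : ContDiffAt ℝ ∞ φ y₀) (u v : N) :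
    fderiv ℝ (fun y => (T (φ y)).comp (fderiv ℝ φ y)) y₀ u v
      - fderiv ℝ (fun y => (T (φ y)).comp (fderiv ℝ φ y)) y₀ v u
      = fderiv ℝ T (φ y₀) (fderiv ℝ φ y₀ u) (fderiv ℝ φ y₀ v)
        - fderiv ℝ T (φ y₀) (fderiv ℝ φ y₀ v) (fderiv ℝ φ y₀ u) := by
  have h1 := (hT.differentiableAt (by simp)).hasFDerivAt
  have h2 := (hφ.differentiableAt (by simp)).hasFDerivAt
  have h3 := ((hφ.fderiv_right (m := ∞) (by simp)).differentiableAt (by simp)).hasFDerivAt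
  have hs := hφ.isSymmSndFDerivAt minSmoothness_two_le u v
  have h4 := (HasFDerivAt.comp y₀ (f := φ) h1 h2).clm_comp h3
  rw [show fderiv ℝ (fun y => (T (φ y)).comp (fderiv ℝ φ y)) y₀ = _ from h4.fderiv]
  simp [hs]

theorem contDiffAt_mcL (h : ContMDiffAt 𝓘(ℝ, N) I ∞ ψ y₀) :
    ContDiffAt ℝ ∞ (mcL 𝓘(ℝ, N) I ψ) y₀ := by
  obtain ⟨φ, hφ, h1, he⟩ := mcL_local h
  refine ContDiffAt.congr_of_eventuallyEq ?_ he
  exact (ContDiffAt.comp y₀ (by rw [h1]; exact mcL_symm_spec.1) hφ).clm_comp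
    (hφ.fderiv_right (by simp))

theorem contDiffAt_mcR (h : ContMDiffAt 𝓘(ℝ, N) I ∞ ψ y₀) :
    ContDiffAt ℝ ∞ (mcR 𝓘(ℝ, N) I ψ) y₀ := by
  obtain ⟨φ, hφ, h1, he⟩ := mcR_local h
  refine ContDiffAt.congr_of_eventuallyEq ?_ he
  exact (ContDiffAt.comp y₀ (by rw [h1]; exact mcR_symm_spec.1) hφ).clm_comp
    (hφ.fderiv_right (by simp))

/-- The Maurer-Cartan equation `dθˡ = -½ [θˡ, θˡ]`. -/
theorem fderiv_mcL_antisymm (h : ContMDiffAt 𝓘(ℝ, N) I ∞ ψ y₀) (u v : N) :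
    fderiv ℝ (mcL 𝓘(ℝ, N) I ψ) y₀ u v - fderiv ℝ (mcL 𝓘(ℝ, N) I ψ) y₀ v u
      = - br I G (mcL 𝓘(ℝ, N) I ψ y₀ u) (mcL 𝓘(ℝ, N) I ψ y₀ v) := by
  obtain ⟨φ, hφ, h1, he⟩ := mcL_local h
  obtain ⟨hT, hT1, hT2⟩ := mcL_symm_spec (I := I) (G := G)
  rw [← h1] at hT
  rw [he.fderiv_eq, fderiv_comp_fderiv_antisymm hT hφ, he.self_of_nhds, h1, hT2, hT2]
  simp only [h1, hT1, br_eq_hess, ContinuousLinearMap.id_comp]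
  abel

/-- The Maurer-Cartan equation `dθʳ = ½ [θʳ, θʳ]`. -/
theorem fderiv_mcR_antisymm (h : ContMDiffAt 𝓘(ℝ, N) I ∞ ψ y₀) (u v : N) :
    fderiv ℝ (mcR 𝓘(ℝ, N) I ψ) y₀ u v - fderiv ℝ (mcR 𝓘(ℝ, N) I ψ) y₀ v u
      = br I G (mcR 𝓘(ℝ, N) I ψ y₀ u) (mcR 𝓘(ℝ, N) I ψ y₀ v) := by
  obtain ⟨φ, hφ, h1, he⟩ := mcR_local h
  obtain ⟨hT, hT1, hT2⟩ := mcR_symm_spec (I := I) (G := G)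
  rw [← h1] at hT
  rw [he.fderiv_eq, fderiv_comp_fderiv_antisymm hT hφ, he.self_of_nhds, h1, hT2, hT2]
  simp only [h1, hT1, br_eq_hess, ContinuousLinearMap.id_comp]
  abel

/-! ### The adjoint representation -/

theorem contMDiffAt_symm_one : ContMDiffAt 𝓘(ℝ, E) I ∞ (κ).symm x₁ :=
  contMDiffAt_symm one_mem_target

theorem AdL_br (g : G) (ξ ζ : E) :
    br I G (AdL I g ξ) (AdL I g ζ) = AdL I g (br I G ξ ζ) := by
  have hψ : ContMDiffAt 𝓘(ℝ, E) I ∞ (fun x => g * (κ).symm x * g⁻¹) x₁ :=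
    (contMDiffAt_const.mul contMDiffAt_symm_one).mul contMDiffAt_const
  have he : mcL 𝓘(ℝ, E) I (fun x => g * (κ).symm x * g⁻¹) =ᶠ[𝓝 x₁]
      fun x => (AdL I g).comp (mcL 𝓘(ℝ, E) I (κ).symm x) := by
    filter_upwards [eventually_mdifferentiableAt
      (contMDiffAt_symm_one (I := I) (G := G))] with x hx using mcL_conj hx g
  have h := fderiv_mcL_antisymm hψ ξ ζ
  obtain ⟨hT, hT1, hT2⟩ := mcL_symm_spec (I := I) (G := G)
  have hc := ((hasFDerivAt_const (AdL I g) x₁).clm_comp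
    (hT.differentiableAt (by simp)).hasFDerivAt).fderiv
  rw [he.fderiv_eq, hc, he.self_of_nhds, hT1] at h
  simp [-extChartAt, hT1, hT2] at h
  rw [← neg_inj, ← h, br_eq_hess, map_sub]
  abel

theorem AdL_symm_eq {x : E} (hx : x ∈ (κ).target) :
    AdL I ((κ).symm x) = (mcR 𝓘(ℝ, E) I (κ).symm x).comp (frameL I G x) := by
  rw [mcR_eq_AdL_comp_mcL ((contMDiffAt_symm hx).mdifferentiableAt (by simp)),
    ContinuousLinearMap.comp_assoc, mcL_symm_comp_frameL hx, ContinuousLinearMap.comp_id]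

theorem contDiffAt_AdL_symm : ContDiffAt ℝ ∞ (fun x => AdL I ((κ).symm x)) x₁ := by
  refine ContDiffAt.congr_of_eventuallyEq
    ((mcR_symm_spec (I := I) (G := G)).1.clm_comp contDiffAt_frameL) ?_
  filter_upwards [target_mem_nhds (one_mem_target (I := I) (G := G))] with x hx using AdL_symm_eq hx

/-- The differential of `Ad` at the identity is the Lie bracket. -/
theorem fderiv_AdL_symm (u v : E) : fderiv ℝ (fun x => AdL I ((κ).symm x)) x₁ u v = br I G u v := by
  have he : (fun x => AdL I ((κ).symm x)) =ᶠ[𝓝 x₁]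
      fun x => (mcR 𝓘(ℝ, E) I (κ).symm x).comp (frameL I G x) := by
    filter_upwards [target_mem_nhds (one_mem_target (I := I) (G := G))] with x hx
      using AdL_symm_eq hx
  obtain ⟨hT, hT1, hT2⟩ := mcR_symm_spec (I := I) (G := G)
  have hc := ((hT.differentiableAt (by simp)).hasFDerivAt.clm_comp
    ((contDiffAt_frameL (I := I) (G := G)).differentiableAt (by simp)).hasFDerivAt).fderiv
  rw [he.fderiv_eq, hc, hT1, frameL_one, br_eq_hess]
  simp [-extChartAt, hT2, fderiv_frameL, sub_eq_add_neg]

theorem contMDiff_AdL : ContMDiff I 𝓘(ℝ, E →L[ℝ] E) ∞ (fun g : G => AdL I g) := by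
  intro g
  have h0 : ContMDiffAt I I ∞ (fun h : G => g⁻¹ * h) g := contMDiff_mul_left.contMDiffAt
  have h1 : ContMDiffAt I 𝓘(ℝ, E) ∞ (fun h : G => κ (g⁻¹ * h)) g := by
    refine ContMDiffAt.comp g (g := κ) ?_ h0
    rw [inv_mul_cancel]
    exact contMDiffAt_chart (mem_extChartAt_source 1)
  have h2 : ContMDiffAt I 𝓘(ℝ, E →L[ℝ] E) ∞
      (fun h : G => (AdL I g).comp (AdL I ((κ).symm (κ (g⁻¹ * h))))) g := by
    have h3 : ContDiffAt ℝ ∞ (fun x => (AdL I g).comp (AdL I ((κ).symm x))) (κ (g⁻¹ * g)) := by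
      rw [inv_mul_cancel]
      exact contDiffAt_const.clm_comp contDiffAt_AdL_symm
    exact h3.contMDiffAt.comp g (f := fun h : G => κ (g⁻¹ * h)) h1
  refine h2.congr_of_eventuallyEq ?_
  have hs : ∀ᶠ h in 𝓝 g, g⁻¹ * h ∈ (κ).source :=
    h0.continuousAt.preimage_mem_nhds (by
      rw [inv_mul_cancel]
      exact extChartAt_source_mem_nhds 1)
  filter_upwards [hs] with h hh
  rw [(κ).left_inv hh, ← AdL_mul, mul_inv_cancel_left]

/-- The inner product as a bilinear form on the model space. -/
def InvariantInner.bil (B : InvariantInner I G) : E →L[ℝ] E →L[ℝ] ℝ := B.form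

theorem InvariantInner.bil_AdL (B : InvariantInner I G) (g : G) (ξ ζ : E) :
    B.bil (AdL I g ξ) (AdL I g ζ) = B.bil ξ ζ :=
  B.invariant g ξ ζ

theorem InvariantInner.bil_AdL_left (B : InvariantInner I G) (g : G) (ξ ζ : E) :
    B.bil (AdL I g ξ) ζ = B.bil ξ (AdL I g⁻¹ ζ) := by
  rw [← B.bil_AdL g ξ, AdL_apply_inv]

theorem InvariantInner.bil_symm (B : InvariantInner I G) (ξ ζ : E) :
    B.bil ξ ζ = B.bil ζ ξ :=
  B.symm ξ ζ

theorem InvariantInner.eq_zero_of_bil (B : InvariantInner I G) {ξ : E} (h : B.bil ξ ξ = 0) :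
    ξ = 0 := by
  by_contra h0
  exact (B.pos ξ h0).ne' h

/-- Infinitesimal invariance of the inner product. -/
theorem InvariantInner.bil_br (B : InvariantInner I G) (ξ ζ η : E) :
    B.bil (br I G ξ ζ) η + B.bil ζ (br I G ξ η) = 0 := by
  have hA := ((contDiffAt_AdL_symm (I := I) (G := G)).differentiableAt (by simp)).hasFDerivAt
  have h1 := (B.bil).hasFDerivAt_of_bilinear (hA.clm_apply (hasFDerivAt_const ζ x₁))
    (hA.clm_apply (hasFDerivAt_const η x₁))
  simp only [B.bil_AdL] at h1
  have h2 := congrArg (fun L : E →L[ℝ] ℝ => L ξ) (h1.unique (hasFDerivAt_const _ x₁))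
  simp [-extChartAt, fderiv_AdL_symm, symm_one, AdL_one] at h2
  linarith

end MaurerCartanEquations

/-! ### Products of Lie algebras and the canonical three-form -/

section Canonical

variable {N : Type*} [NormedAddCommGroup N] [NormedSpace ℝ N]
  {EM : Type*} [NormedAddCommGroup EM] [NormedSpace ℝ EM] {HM : Type*} [TopologicalSpace HM]
  {IM : ModelWithCorners ℝ EM HM} {M : Type*} [TopologicalSpace M] [ChartedSpace HM M]
  {E : Type*} [NormedAddCommGroup E] [NormedSpace ℝ E] [FiniteDimensional ℝ E]
  {H : Type*} [TopologicalSpace H]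
  {I : ModelWithCorners ℝ E H} [I.Boundaryless]
  {G : Type*} [TopologicalSpace G] [ChartedSpace H G] [Group G] [LieGroup I ∞ G]
  {E' : Type*} [NormedAddCommGroup E'] [NormedSpace ℝ E'] [FiniteDimensional ℝ E']
  {H' : Type*} [TopologicalSpace H']
  {I' : ModelWithCorners ℝ E' H'} [I'.Boundaryless]
  {G' : Type*} [TopologicalSpace G'] [ChartedSpace H' G'] [Group G'] [LieGroup I' ∞ G']

theorem mcL_prod {Φ : M → G × G'} {p : M} (h : MDifferentiableAt IM (I.prod I') Φ p) :
    mcL IM (I.prod I') Φ p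
      = (mcL IM I (fun q => (Φ q).1) p).prod (mcL IM I' (fun q => (Φ q).2) p) :=
  mcL_prodMk (φ := fun q => (Φ q).1) (ψ := fun q => (Φ q).2) h.fst h.snd

theorem mcR_prod {Φ : M → G × G'} {p : M} (h : MDifferentiableAt IM (I.prod I') Φ p) :
    mcR IM (I.prod I') Φ p
      = (mcR IM I (fun q => (Φ q).1) p).prod (mcR IM I' (fun q => (Φ q).2) p) :=
  mcR_prodMk (φ := fun q => (Φ q).1) (ψ := fun q => (Φ q).2) h.fst h.snd

/-- The Lie bracket of a product of Lie groups is computed componentwise. -/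
theorem br_prod (ξ ζ : E × E') :
    br (I.prod I') (G × G') ξ ζ = (br I G ξ.1 ζ.1, br I' G' ξ.2 ζ.2) := by
  obtain ⟨hT, hT1, -⟩ := mcL_symm_spec (I := I.prod I') (G := G × G')
  have hψ : ContMDiffAt 𝓘(ℝ, E × E') (I.prod I') ∞ (extChartAt (I.prod I') (1 : G × G')).symm
    (extChartAt (I.prod I') (1 : G × G') 1) := contMDiffAt_symm_one
  generalize (extChartAt (I.prod I') (1 : G × G') 1) = x at hT hT1 hψ
  generalize ((extChartAt (I.prod I') (1 : G × G')).symm : E × E' → G × G') = s at hT hT1 hψ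
  have he := (eventually_mdifferentiableAt hψ).mono fun y hy => mcL_prod (p := y) hy
  have h0 := fderiv_mcL_antisymm hψ ξ ζ
  rw [hT1] at h0
  have e1 : mcL 𝓘(ℝ, E × E') I (fun q => (s q).1) =ᶠ[𝓝 x]
      fun y => (ContinuousLinearMap.fst ℝ E E').comp (mcL 𝓘(ℝ, E × E') (I.prod I') s y) := by
    filter_upwards [he] with y hy
    rw [hy]
    rfl
  have e2 : mcL 𝓘(ℝ, E × E') I' (fun q => (s q).2) =ᶠ[𝓝 x]
      fun y => (ContinuousLinearMap.snd ℝ E E').comp (mcL 𝓘(ℝ, E × E') (I.prod I') s y) := by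
    filter_upwards [he] with y hy
    rw [hy]
    rfl
  have h1 := fderiv_mcL_antisymm (ψ := fun q => (s q).1) hψ.fst ξ ζ
  have h2 := fderiv_mcL_antisymm (ψ := fun q => (s q).2) hψ.snd ξ ζ
  have hd := (hT.differentiableAt (by simp)).hasFDerivAt
  have f1 := ((hasFDerivAt_const (ContinuousLinearMap.fst ℝ E E') x).clm_comp hd).fderiv
  have f2 := ((hasFDerivAt_const (ContinuousLinearMap.snd ℝ E E') x).clm_comp hd).fderiv
  rw [e1.fderiv_eq, f1, e1.self_of_nhds] at h1
  rw [e2.fderiv_eq, f2, e2.self_of_nhds] at h2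
  simp [hT1] at h0 h1 h2
  rw [← neg_inj, ← h0]
  exact Prod.ext h1 h2

theorem InvariantInner.bil_prod (B : InvariantInner I G) (B' : InvariantInner I' G')
    (ξ ζ : E × E') : (B.prod B').bil ξ ζ = B.bil ξ.1 ζ.1 + B'.bil ξ.2 ζ.2 := rfl

/-- The invariant three-form `½ (x, [y, z])` on the Lie algebra. -/
noncomputable def cartan (B : InvariantInner I G) (x y z : E) : ℝ :=
  (1 / 2) * B.bil x (br I G y z)

theorem InvariantInner.bil_br_cyclic (B : InvariantInner I G) (x y z : E) :
    B.bil y (br I G z x) = B.bil x (br I G y z) := by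
  have h := B.bil_br z x y
  rw [B.bil_symm, br_swap y z, map_neg]
  linarith

theorem chi_eq_cartan (B : InvariantInner I G) (a : G) (u v w : E) :
    chi I B a u v w
      = cartan B (dM I I (fun h : G => a⁻¹ * h) a u) (dM I I (fun h : G => a⁻¹ * h) a v)
        (dM I I (fun h : G => a⁻¹ * h) a w) := by
  set x := dM I I (fun h : G => a⁻¹ * h) a u with hx
  set y := dM I I (fun h : G => a⁻¹ * h) a v with hy
  set z := dM I I (fun h : G => a⁻¹ * h) a w with hz
  change (1 / 12) * (B.bil x (br I G y z - br I G z y) + B.bil y (br I G z x - br I G x z)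
    + B.bil z (br I G x y - br I G y x)) = _
  rw [br_swap z y, br_swap x z, br_swap y x, sub_neg_eq_add, sub_neg_eq_add, sub_neg_eq_add,
    map_add, map_add, map_add, B.bil_br_cyclic y z x, B.bil_br_cyclic x y z, cartan]
  ring

theorem cartan_prod (B : InvariantInner I G) (B' : InvariantInner I' G') (x y z : E × E') :
    cartan (B.prod B') x y z = cartan B x.1 y.1 z.1 + cartan B' x.2 y.2 z.2 := by
  rw [cartan, B.bil_prod, br_prod, cartan, cartan]
  ring

theorem cartan_AdL (B : InvariantInner I G) (g : G) (x y z : E) :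
    cartan B (AdL I g x) (AdL I g y) (AdL I g z) = cartan B x y z := by
  rw [cartan, AdL_br, B.bil_AdL, cartan]

/-- The invariant three-form on sums. -/
theorem cartan_add (B : InvariantInner I G) (x y z x' y' z' : E) :
    cartan B (x + x') (y + y') (z + z') = cartan B x y z + cartan B x' y' z'
      + (1 / 2) * (B.bil x (br I G y' z') + B.bil y (br I G z' x') + B.bil z (br I G x' y')
      + B.bil (br I G x y) z' + B.bil (br I G y z) x' + B.bil (br I G z x) y') := by
  simp only [cartan, br_add_left, br_add_right, map_add, add_apply]
  rw [B.bil_symm (br I G x y) z', B.bil_symm (br I G y z) x', B.bil_symm (br I G z x) y',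
    B.bil_br_cyclic z x' y', ← B.bil_br_cyclic x' y z', B.bil_br_cyclic z' x y,
    ← B.bil_br_cyclic x y' z]
  ring

end Canonical

/-! ### Smooth forms -/

section SmoothForms

variable {E : Type*} [NormedAddCommGroup E] [NormedSpace ℝ E] [FiniteDimensional ℝ E]
  {H : Type*} [TopologicalSpace H]
  {I : ModelWithCorners ℝ E H} [I.Boundaryless] {M : Type*} [TopologicalSpace M] [ChartedSpace H M]
  [IsManifold I ∞ M]
  {F : Type*} [NormedAddCommGroup F] [NormedSpace ℝ F] {k : ℕ}

theorem chartRep_apply (η : ∀ x : M, TangentSpace I x [⋀^Fin k]→L[ℝ] F) (x₀ : M) (y : E)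
    (v : Fin k → E) : chartRep I η x₀ y v
      = η ((extChartAt I x₀).symm y) (fun i => dM 𝓘(ℝ, E) I (extChartAt I x₀).symm y (v i)) :=
  rfl

theorem chartRep_one (η : ∀ x : M, TangentSpace I x [⋀^Fin 1]→L[ℝ] F) (x₀ : M) (y : E) (v : E) :
    chartRep I η x₀ y ![v]
      = η ((extChartAt I x₀).symm y) ![dM 𝓘(ℝ, E) I (extChartAt I x₀).symm y v] := by
  rw [chartRep_apply]
  congr 1
  funext i
  fin_cases i
  rfl

theorem chartRep_two (η : ∀ x : M, TangentSpace I x [⋀^Fin 2]→L[ℝ] F) (x₀ : M) (y : E) (u v : E) :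
    chartRep I η x₀ y ![u, v]
      = η ((extChartAt I x₀).symm y) ![dM 𝓘(ℝ, E) I (extChartAt I x₀).symm y u,
        dM 𝓘(ℝ, E) I (extChartAt I x₀).symm y v] := by
  rw [chartRep_apply]
  congr 1
  funext i
  fin_cases i <;> rfl

theorem preimage_mem_nhds_chart {V : Set M} (hV : IsOpen V) {x₀ : M} {y : E}
    (hy : y ∈ (extChartAt I x₀).target) (hyV : (extChartAt I x₀).symm y ∈ V) :
    ∀ᶠ z in 𝓝 y, z ∈ (extChartAt I x₀).target ∧ (extChartAt I x₀).symm z ∈ V :=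
  Filter.Eventually.and (target_mem_nhds hy)
    ((contMDiffAt_symm hy).continuousAt.preimage_mem_nhds (hV.mem_nhds hyV))

theorem SmoothFormOn.contDiffAt {η : ∀ x : M, TangentSpace I x [⋀^Fin k]→L[ℝ] F} {V : Set M}
    (h : SmoothFormOn I η V) (hV : IsOpen V) {x₀ : M} {y : E} (hy : y ∈ (extChartAt I x₀).target)
    (hyV : (extChartAt I x₀).symm y ∈ V) : ContDiffAt ℝ ∞ (chartRep I η x₀) y :=
  (h x₀).contDiffAt (preimage_mem_nhds_chart hV hy hyV)

theorem SmoothFormOn.mono {η : ∀ x : M, TangentSpace I x [⋀^Fin k]→L[ℝ] F} {V W : Set M}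
    (h : SmoothFormOn I η V) (hW : W ⊆ V) : SmoothFormOn I η W :=
  fun x₀ => (h x₀).mono fun _ hy => ⟨hy.1, hW hy.2⟩

theorem smoothFormOn_of_contDiffAt [FiniteDimensional ℝ F]
    {η : ∀ x : M, TangentSpace I x [⋀^Fin k]→L[ℝ] F} {V : Set M}
    (h : ∀ (x₀ : M) (y : E), y ∈ (extChartAt I x₀).target → (extChartAt I x₀).symm y ∈ V →
      ∀ v : Fin k → E, ContDiffAt ℝ ∞ (fun y => chartRep I η x₀ y v) y) : SmoothFormOn I η V :=
  fun x₀ y hy => (contDiffAt_alternating (h x₀ y hy.1 hy.2)).contDiffWithinAt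

theorem contDiffAt_comp_symm {a : M → F} {V : Set M} (ha : ContMDiffOn I 𝓘(ℝ, F) ∞ a V)
    (hV : IsOpen V) {x₀ : M} {y : E} (hy : y ∈ (extChartAt I x₀).target)
    (hyV : (extChartAt I x₀).symm y ∈ V) :
    ContDiffAt ℝ ∞ (fun y => a ((extChartAt I x₀).symm y)) y := by
  rw [← contMDiffAt_iff_contDiffAt]
  exact (ha.contMDiffAt (hV.mem_nhds hyV)).comp y (contMDiffAt_symm hy)

variable {EK : Type*} [NormedAddCommGroup EK] [NormedSpace ℝ EK] [FiniteDimensional ℝ EK]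
  {HK : Type*} [TopologicalSpace HK] {J : ModelWithCorners ℝ EK HK} [J.Boundaryless]
  {K : Type*} [TopologicalSpace K] [ChartedSpace HK K] [Group K] [LieGroup J ∞ K]

theorem mcL_comp_symm {φ : M → K} {x₀ : M} {y : E} (hy : y ∈ (extChartAt I x₀).target)
    (hφ : MDifferentiableAt I J φ ((extChartAt I x₀).symm y)) :
    mcL 𝓘(ℝ, E) J (fun z => φ ((extChartAt I x₀).symm z)) y
      = (mcL I J φ ((extChartAt I x₀).symm y)).comp (dM 𝓘(ℝ, E) I (extChartAt I x₀).symm y) :=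
  mcL_comp hφ ((contMDiffAt_symm hy).mdifferentiableAt (by simp))

theorem mcR_comp_symm {φ : M → K} {x₀ : M} {y : E} (hy : y ∈ (extChartAt I x₀).target)
    (hφ : MDifferentiableAt I J φ ((extChartAt I x₀).symm y)) :
    mcR 𝓘(ℝ, E) J (fun z => φ ((extChartAt I x₀).symm z)) y
      = (mcR I J φ ((extChartAt I x₀).symm y)).comp (dM 𝓘(ℝ, E) I (extChartAt I x₀).symm y) :=
  mcR_comp hφ ((contMDiffAt_symm hy).mdifferentiableAt (by simp))

theorem contDiffAt_mcL_comp_symm {φ : M → K} {V : Set M} (hφ : ContMDiffOn I J ∞ φ V)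
    (hV : IsOpen V) {x₀ : M} {y : E} (hy : y ∈ (extChartAt I x₀).target)
    (hyV : (extChartAt I x₀).symm y ∈ V) :
    ContDiffAt ℝ ∞ (fun y => (mcL I J φ ((extChartAt I x₀).symm y)).comp
      (dM 𝓘(ℝ, E) I (extChartAt I x₀).symm y)) y := by
  have h : ContMDiffAt 𝓘(ℝ, E) J ∞ (fun z => φ ((extChartAt I x₀).symm z)) y :=
    (hφ.contMDiffAt (hV.mem_nhds hyV)).comp y (contMDiffAt_symm hy)
  refine (contDiffAt_mcL h).congr_of_eventuallyEq ?_
  filter_upwards [preimage_mem_nhds_chart hV hy hyV] with z hz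
  exact (mcL_comp_symm hz.1
    ((hφ.contMDiffAt (hV.mem_nhds hz.2)).mdifferentiableAt (by simp))).symm

theorem contDiffAt_mcR_comp_symm {φ : M → K} {V : Set M} (hφ : ContMDiffOn I J ∞ φ V)
    (hV : IsOpen V) {x₀ : M} {y : E} (hy : y ∈ (extChartAt I x₀).target)
    (hyV : (extChartAt I x₀).symm y ∈ V) :
    ContDiffAt ℝ ∞ (fun y => (mcR I J φ ((extChartAt I x₀).symm y)).comp
      (dM 𝓘(ℝ, E) I (extChartAt I x₀).symm y)) y := by
  have h : ContMDiffAt 𝓘(ℝ, E) J ∞ (fun z => φ ((extChartAt I x₀).symm z)) y :=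
    (hφ.contMDiffAt (hV.mem_nhds hyV)).comp y (contMDiffAt_symm hy)
  refine (contDiffAt_mcR h).congr_of_eventuallyEq ?_
  filter_upwards [preimage_mem_nhds_chart hV hy hyV] with z hz
  exact (mcR_comp_symm hz.1
    ((hφ.contMDiffAt (hV.mem_nhds hz.2)).mdifferentiableAt (by simp))).symm

/-- A family of linear forms as a differential form of degree one. -/
noncomputable def oneForm (α : M → E →L[ℝ] F) (q : M) : TangentSpace I q [⋀^Fin 1]→L[ℝ] F :=
  ContinuousAlternatingMap.ofSubsingleton ℝ E F (0 : Fin 1) (α q)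

end SmoothForms

/-! ### Singular quasi-Hamiltonian spaces -/

section BmSpaces

variable {E : Type*} [NormedAddCommGroup E] [NormedSpace ℝ E] [FiniteDimensional ℝ E]
  {H : Type*} [TopologicalSpace H]
  {I : ModelWithCorners ℝ E H} [I.Boundaryless] {M : Type*} [TopologicalSpace M] [ChartedSpace H M]
  [IsManifold I ∞ M]
  {EK : Type*} [NormedAddCommGroup EK] [NormedSpace ℝ EK] [FiniteDimensional ℝ EK]
  {HK : Type*} [TopologicalSpace HK] {J : ModelWithCorners ℝ EK HK} [J.Boundaryless]
  {K : Type*} [TopologicalSpace K] [ChartedSpace HK K] [Group K] [LieGroup J ∞ K]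
  {m : ℕ} {S : BManifold I M}

theorem BManifold.isOpen_compl_Z (S : BManifold I M) : IsOpen S.Zᶜ := S.isClosed_zero.isOpen_compl

theorem toBm_val {p : M} (hp : p ∉ S.Z) (v : E) :
    (toBm m S p v).1.1 = v := by
  have hp' : S.f p ≠ 0 := hp
  rw [toBm, dif_neg hp']
  rfl

theorem toBm_self {p : M} (hp : p ∉ S.Z) (X : BmTangent m S p) : toBm m S p X.1.1 = X := by
  have hp' : S.f p ≠ 0 := hp
  have hX := mem_BmTangent.1 X.2
  have h : toBm m S p X.1.1
      = ⟨(X.1.1, (S.f p ^ m)⁻¹ * S.df p X.1.1), by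
        rw [mem_BmTangent, mul_inv_cancel_left₀ (pow_ne_zero m hp')]⟩ := by
    rw [toBm, dif_neg hp']
    rfl
  rw [h]
  refine Subtype.ext (Prod.ext rfl ?_)
  change (S.f p ^ m)⁻¹ * S.df p X.1.1 = X.1.2
  rw [hX, inv_mul_cancel_left₀ (pow_ne_zero m hp')]

theorem offZ_apply (σ : ∀ p : M, BmTangent m S p [⋀^Fin 2]→L[ℝ] ℝ) (p : M) (u v : E) :
    offZ σ p ![u, v] = σ p ![toBm m S p u, toBm m S p v] := by
  change σ p (fun i => toBm m S p ((![u, v] : Fin 2 → E) i)) = _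
  congr 1
  funext i
  fin_cases i <;> rfl

theorem offZ_self (σ : ∀ p : M, BmTangent m S p [⋀^Fin 2]→L[ℝ] ℝ) {p : M} (hp : p ∉ S.Z)
    (X Y : BmTangent m S p) : offZ σ p ![X.1.1, Y.1.1] = σ p ![X, Y] := by
  refine (offZ_apply σ p X.1.1 Y.1.1).trans ?_
  rw [toBm_self hp, toBm_self hp]

theorem act_one (ρ : MulAction K M) (p : M) : act ρ 1 p = p := ρ.one_smul p

variable {ρ : MulAction K M}

theorem IsSmoothAction.contMDiff_orbit (h : IsSmoothAction I J ρ) (p : M) :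
    ContMDiff J I ∞ (fun g : K => act ρ g p) :=
  h.comp (contMDiff_id.prodMk contMDiff_const)

theorem IsSmoothAction.contMDiff_act (h : IsSmoothAction I J ρ) (g : K) :
    ContMDiff I I ∞ (act ρ g) :=
  h.comp (contMDiff_const.prodMk contMDiff_id)

/-- The fundamental vector fields in a chart. -/
theorem contDiffAt_fundField (h : IsSmoothAction I J ρ) (ξ : EK) {x₀ : M} {y : E}
    (hy : y ∈ (extChartAt I x₀).target) :
    ContDiffAt ℝ ∞ (fun y => dM I 𝓘(ℝ, E) (extChartAt I x₀) ((extChartAt I x₀).symm y)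
      (dM J I (fun g : K => act ρ g ((extChartAt I x₀).symm y)) 1 ξ)) y := by
  set s := (extChartAt I x₀).symm with hs
  set k := extChartAt J (1 : K) with hk
  let Q : EK × E → E := fun z => extChartAt I x₀ (act ρ (k.symm z.1) (s z.2))
  have hQ : ∀ y ∈ (extChartAt I x₀).target, ContDiffAt ℝ ∞ Q (k 1, y) := by
    intro y hy
    rw [← contMDiffAt_iff_contDiffAt]
    have a1 : ContMDiffAt 𝓘(ℝ, EK × E) J ∞ (fun z : EK × E => k.symm z.1) (k 1, y) :=
      ContMDiffAt.comp (k 1, y) (g := k.symm) (f := Prod.fst) contMDiffAt_symm_one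
        contDiff_fst.contMDiff.contMDiffAt
    have a2 : ContMDiffAt 𝓘(ℝ, EK × E) I ∞ (fun z : EK × E => s z.2) (k 1, y) :=
      ContMDiffAt.comp (k 1, y) (g := s) (f := Prod.snd) (contMDiffAt_symm hy)
        contDiff_snd.contMDiff.contMDiffAt
    have a3 : ContMDiffAt 𝓘(ℝ, EK × E) I ∞ (fun z : EK × E => act ρ (k.symm z.1) (s z.2))
        (k 1, y) := ContMDiffAt.comp (k 1, y) h.contMDiffAt (a1.prodMk a2)
    refine ContMDiffAt.comp (k 1, y) (g := extChartAt I x₀) ?_ a3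
    refine contMDiffAt_chart ?_
    simp only [hk, symm_one, act_one]
    exact (extChartAt I x₀).map_target hy
  have heq : ∀ y ∈ (extChartAt I x₀).target, dM I 𝓘(ℝ, E) (extChartAt I x₀) (s y)
      (dM J I (fun g : K => act ρ g (s y)) 1 ξ) = fderiv ℝ Q (k 1, y) (ξ, 0) := by
    intro y hy
    have h1 : HasFDerivAt (fun x : EK => (x, y)) (ContinuousLinearMap.inl ℝ EK E) (k 1) :=
      (hasFDerivAt_id (k 1)).prodMk (hasFDerivAt_const _ _)
    have h2 : fderiv ℝ (fun x => Q (x, y)) (k 1) = _ :=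
      (HasFDerivAt.comp (k 1) (f := fun x : EK => (x, y))
        ((hQ y hy).differentiableAt (by simp)).hasFDerivAt h1).fderiv
    have e1 : MDifferentiableAt 𝓘(ℝ, EK) J k.symm (k 1) :=
      contMDiffAt_symm_one.mdifferentiableAt (by simp)
    have e2 : MDifferentiableAt J I (fun g : K => act ρ g (s y)) (k.symm (k 1)) :=
      (h.contMDiff_orbit _).mdifferentiableAt (by simp)
    have e3 : MDifferentiableAt I 𝓘(ℝ, E) (extChartAt I x₀) (act ρ (k.symm (k 1)) (s y)) := by
      simp only [hk, symm_one, act_one]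
      exact (contMDiffAt_chart ((extChartAt I x₀).map_target hy)).mdifferentiableAt (n := ∞)
        (by simp)
    have h3 : fderiv ℝ (fun x => Q (x, y)) (k 1)
        = (dM I 𝓘(ℝ, E) (extChartAt I x₀) (act ρ (k.symm (k 1)) (s y))).comp
          ((dM J I (fun g : K => act ρ g (s y)) (k.symm (k 1))).comp
            (dM 𝓘(ℝ, EK) J k.symm (k 1))) := by
      rw [← dM_eq_fderiv, ← dM_comp (g := fun g : K => act ρ g (s y)) e2 e1,
        ← dM_comp (g := extChartAt I x₀) (f := fun x => act ρ (k.symm x) (s y)) e3 (e2.comp _ e1)]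
    rw [dM_symm_self, hk, symm_one, act_one] at h3
    have h4 := congrArg (fun L : EK →L[ℝ] E => L ξ) (h3.symm.trans h2)
    simpa [-extChartAt] using h4
  have hfin : ContDiffAt ℝ ∞ (fun y => fderiv ℝ Q (k 1, y) (ξ, 0)) y :=
    (ContDiffAt.comp y (f := fun y : E => (k 1, y)) ((hQ y hy).fderiv_right (by simp))
      (contDiffAt_const.prodMk contDiffAt_id)).clm_apply contDiffAt_const
  refine hfin.congr_of_eventuallyEq ?_
  filter_upwards [target_mem_nhds hy] with z hz using heq z hz

variable {B : InvariantInner J K} {σ : ∀ p : M, BmTangent m S p [⋀^Fin 2]→L[ℝ] ℝ} {Φ : M → K}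
  {A : ∀ p : M, BmTangent m S p →L[ℝ] GroupLieAlgebra J K}

/-- A continuous relation between the values of the form and of `Φ^* θˡ` on a fundamental vector
field and on arbitrary vectors extends from `M ∖ Z` to `Z`. -/
theorem IsBmQuasiHamiltonian.extend_relation (h : IsBmQuasiHamiltonian I J m S B ρ σ Φ A)
    (hm : 1 ≤ m) (ξ : EK) {c : M → ℝ} (hc : ContMDiffOn I 𝓘(ℝ) ∞ c S.nhd)
    (hcv : ∀ q ∈ S.nhd, S.df q (fundField I J ρ ξ q) = S.f q ^ m * c q)
    {T : EK × EK × ℝ → ℝ} (hT : Continuous T)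
    (h0 : ∀ q ∉ S.Z, ∀ X Y : BmTangent m S q, Y.1.1 = fundField I J ρ ξ q →
      T (A q X, A q Y, σ q ![Y, X]) = 0)
    {p : M} (hp : p ∈ S.Z) (X Y : BmTangent m S p) (hY1 : Y.1.1 = fundField I J ρ ξ p)
    (hY2 : Y.1.2 = c p) : T (A p X, A p Y, σ p ![Y, X]) = 0 := by
  suffices key : ∀ X Y : BmTangent m S ((extChartAt I p).symm (extChartAt I p p)),
      Y.1.1 = fundField I J ρ ξ ((extChartAt I p).symm (extChartAt I p p)) →
      Y.1.2 = c ((extChartAt I p).symm (extChartAt I p p)) →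
      T (A _ X, A _ Y, σ _ ![Y, X]) = 0 by
    rw [extChartAt_to_inv] at key
    exact key X Y hY1 hY2
  clear X Y hY1 hY2
  obtain ⟨W₁, hW₁, hpW₁, α, β, hα, hβ, hσ⟩ := h.smooth_form.2 p hp
  obtain ⟨W₂, hW₂, hpW₂, a, γ, ha, hγ, hA⟩ := h.dlog_smooth p hp
  have hpn : p ∈ S.nhd := S.mem_nhd p hp
  set y₀ := extChartAt I p p with hy₀
  set s := (extChartAt I p).symm with hs
  intro X Y hY1 hY2
  have hsy : s y₀ = p := extChartAt_to_inv p
  have hyt : y₀ ∈ (extChartAt I p).target := mem_extChartAt_target p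
  let F : E → ℝ := fun y => S.f (s y)
  have hF : ContDiffAt ℝ ∞ F y₀ :=
    contDiffAt_comp_symm S.smooth S.isOpen_nhd hyt (by rwa [← hs, hsy])
  have hmem := (preimage_mem_nhds_chart (S.isOpen_nhd.inter (hW₁.inter hW₂)) hyt
    (by rw [← hs, hsy]; exact ⟨hpn, hpW₁, hpW₂⟩))
  have hdF : ∀ y ∈ (extChartAt I p).target, s y ∈ S.nhd →
      fderiv ℝ F y = (dM I 𝓘(ℝ) S.f (s y)).comp (dM 𝓘(ℝ, E) I s y) := by
    intro y hy hyn
    rw [← dM_eq_fderiv, ← dM_comp (g := S.f)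
      ((S.smooth.contMDiffAt (S.isOpen_nhd.mem_nhds hyn)).mdifferentiableAt (by simp))
      ((contMDiffAt_symm hy).mdifferentiableAt (by simp))]
  have hD0 : dM 𝓘(ℝ, E) I s y₀ = ContinuousLinearMap.id ℝ E := dM_symm_self p
  have hdF0 : fderiv ℝ F y₀ = dM I 𝓘(ℝ) S.f (s y₀) := by
    rw [hdF y₀ hyt (by rwa [hsy]), hD0, ContinuousLinearMap.comp_id]
  have hF0 : F y₀ = 0 := by
    change S.f (s y₀) = 0
    rw [hsy]
    exact hp
  have hne : fderiv ℝ F y₀ ≠ 0 := by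
    rw [hdF0, hsy]
    exact S.regular p hp
  obtain ⟨w, hw⟩ : ∃ w, fderiv ℝ F y₀ w ≠ 0 := by
    by_contra! hcon
    exact hne (ContinuousLinearMap.ext hcon)
  have hdFc : ContinuousAt (fderiv ℝ F) y₀ :=
    (hF.fderiv_right (m := ∞) (by simp)).continuousAt
  -- extensions of the two vectors
  let x : E := X.1.1
  let r : ℝ := X.1.2
  let e : E → E := fun y => x + ((F y ^ m * r - fderiv ℝ F y x) / fderiv ℝ F y w) • w
  let e' : E → E := fun y => dM I 𝓘(ℝ, E) (extChartAt I p) (s y)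
    (dM J I (fun g : K => act ρ g (s y)) 1 ξ)
  have he : ContinuousAt e y₀ := by
    refine continuousAt_const.add (ContinuousAt.smul (ContinuousAt.div ?_ ?_ hw) continuousAt_const)
    · exact ((hF.continuousAt.pow m).mul continuousAt_const).sub
        (hdFc.clm_apply continuousAt_const)
    · exact hdFc.clm_apply continuousAt_const
  have he0 : e y₀ = x := by
    have hx : fderiv ℝ F y₀ x = 0 := by
      rw [hdF0]
      have := mem_BmTangent.1 X.2
      rw [show S.f (s y₀) = 0 from hF0, zero_pow (by omega), zero_mul] at this
      exact this
    simp [e, hx, hF0, zero_pow (show m ≠ 0 by omega)]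
  have he' : ContinuousAt e' y₀ :=
    (contDiffAt_fundField h.action.smooth ξ hyt).continuousAt
  have hDe' : ∀ y ∈ (extChartAt I p).target, dM 𝓘(ℝ, E) I s y (e' y)
      = dM J I (fun g : K => act ρ g (s y)) 1 ξ := fun y hy =>
    congrArg (fun L : E →L[ℝ] E => L _) (dM_symm_comp_chart hy)
  let cc : E → ℝ := fun y => c (s y)
  have hcc : ContinuousAt cc y₀ :=
    (contDiffAt_comp_symm hc S.isOpen_nhd hyt (by rwa [← hs, hsy])).continuousAt
  have hac : ContinuousAt (fun y => a (s y)) y₀ :=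
    (contDiffAt_comp_symm ha hW₂ hyt (by rwa [← hs, hsy])).continuousAt
  let gA : (E → E) → (E → ℝ) → E → EK := fun e r y => r y • a (s y) + chartRep I γ p y ![e y]
  let gσ : E → ℝ := fun y => cc y * chartRep I α p y ![e y] - r * chartRep I α p y ![e' y]
    + chartRep I β p y ![e' y, e y]
  have hvec1 : ∀ {e : E → E}, ContinuousAt e y₀ → ContinuousAt (fun y => ![e y]) y₀ := fun he =>
    continuousAt_pi.2 fun i => by fin_cases i; exact he
  have hvec2 : ContinuousAt (fun y => ![e' y, e y]) y₀ :=
    continuousAt_pi.2 fun i => by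
      fin_cases i
      · exact he'
      · exact he
  have hαc := (hα.contDiffAt hW₁ hyt (by rwa [← hs, hsy])).continuousAt
  have hβc := (hβ.contDiffAt hW₁ hyt (by rwa [← hs, hsy])).continuousAt
  have hγc := (hγ.contDiffAt hW₂ hyt (by rwa [← hs, hsy])).continuousAt
  have hgA : ∀ {e : E → E} {r : E → ℝ}, ContinuousAt e y₀ → ContinuousAt r y₀ →
      ContinuousAt (gA e r) y₀ := fun he hr => (hr.smul hac).add (hγc.eval (hvec1 he))
  have hgσ : ContinuousAt gσ y₀ :=
    ((hcc.mul (hαc.eval (hvec1 he))).sub (continuousAt_const.mul (hαc.eval (hvec1 he')))).add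
      (hβc.eval hvec2)
  have hAe : ∀ y, s y ∈ W₂ → ∀ Z : BmTangent m S (s y), ∀ (e : E → E) (r : E → ℝ),
      dM 𝓘(ℝ, E) I s y (e y) = Z.1.1 → r y = Z.1.2 → A (s y) Z = gA e r y := by
    intro y hy Z e r h1 h2
    refine (hA (s y) hy Z).trans ?_
    simp only [gA]
    rw [chartRep_one, ← hs, h1, h2]
  have hσe : ∀ y, s y ∈ W₁ → ∀ Z Z' : BmTangent m S (s y),
      dM 𝓘(ℝ, E) I s y (e y) = Z.1.1 → r = Z.1.2 →
      dM 𝓘(ℝ, E) I s y (e' y) = Z'.1.1 → cc y = Z'.1.2 → σ (s y) ![Z', Z] = gσ y := by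
    intro y hy Z Z' h1 h2 h3 h4
    rw [hσ (s y) hy]
    simp only [gσ]
    rw [chartRep_one, chartRep_one, chartRep_two, ← hs, h1, h2, h3, h4]
  let G : E → ℝ := fun y => T (gA e (fun _ => r) y, gA e' cc y, gσ y)
  have hG : ContinuousAt G y₀ :=
    ContinuousAt.comp (g := T) hT.continuousAt
      ((hgA he continuousAt_const).prodMk ((hgA he' hcc).prodMk hgσ))
  have hGz : ∀ᶠ y in 𝓝 y₀, F y ≠ 0 → G y = 0 := by
    filter_upwards [hmem, (hdFc.clm_apply continuousAt_const).eventually_ne hw] with y hy hyw hFy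
    obtain ⟨hyt, hyn, hyW₁, hyW₂⟩ := hy
    have hX' : ((dM 𝓘(ℝ, E) I s y (e y), r) : E × ℝ) ∈ BmTangent m S (s y) := by
      refine mem_BmTangent.2 ?_
      have h1 : dM I 𝓘(ℝ) S.f (s y) (dM 𝓘(ℝ, E) I s y (e y)) = fderiv ℝ F y (e y) := by
        rw [hdF y hyt hyn]; rfl
      refine h1.trans ?_
      simp only [e, map_add, map_smul, smul_eq_mul]
      rw [div_mul_cancel₀ _ hyw]
      simp only [F]
      ring
    have hY' : ((dM J I (fun g : K => act ρ g (s y)) 1 ξ, cc y) : E × ℝ)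
        ∈ BmTangent m S (s y) := mem_BmTangent.2 (hcv (s y) hyn)
    have := h0 (s y) hFy ⟨_, hX'⟩ ⟨_, hY'⟩ rfl
    rw [hAe y hyW₂ ⟨_, hX'⟩ e (fun _ => r) rfl rfl,
      hAe y hyW₂ ⟨_, hY'⟩ e' cc (hDe' y hyt) rfl,
      hσe y hyW₁ ⟨_, hX'⟩ ⟨_, hY'⟩ rfl rfl (hDe' y hyt) rfl] at this
    exact this
  have hfreq : ∃ᶠ y in 𝓝 y₀, F y ≠ 0 := by
    intro hcon
    have : F =ᶠ[𝓝 y₀] fun _ => (0 : ℝ) := hcon.mono fun y hy => not_not.1 hy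
    exact hne (by rw [this.fderiv_eq]; simp)
  have hG0 : G y₀ = 0 := by
    by_contra hcon
    obtain ⟨y, hy1, hy2, hy3⟩ := (hfreq.and_eventually (hGz.and (hG.eventually_ne hcon))).exists
    exact hy3 (hy2 hy1)
  have hX1 : dM 𝓘(ℝ, E) I s y₀ (e y₀) = X.1.1 := by
    rw [hD0, he0]; rfl
  have hY1' : dM 𝓘(ℝ, E) I s y₀ (e' y₀) = Y.1.1 := (hDe' y₀ hyt).trans hY1.symm
  rw [hAe y₀ (by rwa [hsy]) X e (fun _ => r) hX1 rfl, hAe y₀ (by rwa [hsy]) Y e' cc hY1' hY2.symm,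
    hσe y₀ (by rwa [hsy]) X Y hX1 rfl hY1' hY2.symm]
  exact hG0

end BmSpaces

theorem two_form_swap {V : Type*} [AddCommGroup V] [Module ℝ V] [TopologicalSpace V]
    (σ : V [⋀^Fin 2]→L[ℝ] ℝ) (u v : V) : σ ![u, v] = - σ ![v, u] := by
  have h : σ (![v, u] ∘ Equiv.swap 0 1) = - σ ![v, u] :=
    σ.toAlternatingMap.map_swap ![v, u] (i := 0) (j := 1) (by simp)
  rw [← h]
  congr 1
  funext i
  fin_cases i <;> rfl

section BmSpaces

variable {E : Type*} [NormedAddCommGroup E] [NormedSpace ℝ E] [FiniteDimensional ℝ E]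
  {H : Type*} [TopologicalSpace H]
  {I : ModelWithCorners ℝ E H} [I.Boundaryless] {M : Type*} [TopologicalSpace M] [ChartedSpace H M]
  [IsManifold I ∞ M]
  {EK : Type*} [NormedAddCommGroup EK] [NormedSpace ℝ EK] [FiniteDimensional ℝ EK]
  {HK : Type*} [TopologicalSpace HK] {J : ModelWithCorners ℝ EK HK} [J.Boundaryless]
  {K : Type*} [TopologicalSpace K] [ChartedSpace HK K] [Group K] [LieGroup J ∞ K]
  {EK' : Type*} [NormedAddCommGroup EK'] [NormedSpace ℝ EK'] [FiniteDimensional ℝ EK']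
  {HK' : Type*} [TopologicalSpace HK'] {J' : ModelWithCorners ℝ EK' HK'} [J'.Boundaryless]
  {K' : Type*} [TopologicalSpace K'] [ChartedSpace HK' K'] [Group K'] [LieGroup J' ∞ K']
  {m : ℕ} {S : BManifold I M} {ρ : MulAction K M}

theorem AdL_prod (g : K × K') (ξ : EK × EK') :
    AdL (J.prod J') g ξ = (AdL J g.1 ξ.1, AdL J' g.2 ξ.2) :=
  Ad_prod g ξ

/-- The differential of an equivariant map on the fundamental vector fields. -/
theorem mcL_fundField (hρ : IsSmoothAction I J ρ) {Φ : M → K} {p : M}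
    (hΦ : MDifferentiableAt I J Φ p) (h : ∀ g : K, Φ (act ρ g p) = g * Φ p * g⁻¹) (ξ : EK) :
    mcL I J Φ p (fundField I J ρ ξ p) = AdL J (Φ p)⁻¹ ξ - ξ := by
  have h1 := mcL_comp (I := J) (φ := Φ) (f := fun g : K => act ρ g p) (p := 1)
    (by rwa [act_one]) ((hρ.contMDiff_orbit p).mdifferentiableAt (by simp))
  simp only [h, act_one] at h1
  rw [mcL_orbit] at h1
  exact congrArg (fun L : EK →L[ℝ] EK => L ξ) h1.symm

theorem mcR_fundField (hρ : IsSmoothAction I J ρ) {Φ : M → K} {p : M}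
    (hΦ : MDifferentiableAt I J Φ p) (h : ∀ g : K, Φ (act ρ g p) = g * Φ p * g⁻¹) (ξ : EK) :
    mcR I J Φ p (fundField I J ρ ξ p) = ξ - AdL J (Φ p) ξ := by
  rw [mcR_eq_AdL_comp_mcL hΦ]
  refine (congrArg (AdL J (Φ p)) (mcL_fundField hρ hΦ h ξ)).trans ?_
  rw [map_sub, AdL_apply_inv]

variable {B : InvariantInner J K} {σ : ∀ p : M, BmTangent m S p [⋀^Fin 2]→L[ℝ] ℝ} {Φ : M → K}
  {A : ∀ p : M, BmTangent m S p →L[ℝ] EK}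

theorem IsBmQuasiHamiltonian.mdifferentiableAt (h : IsBmQuasiHamiltonian I J m S B ρ σ Φ A)
    {p : M} (hp : p ∉ S.Z) : MDifferentiableAt I J Φ p :=
  (h.smooth_map.contMDiffAt (S.isOpen_compl_Z.mem_nhds hp)).mdifferentiableAt (by simp)

theorem IsBmQuasiHamiltonian.dlog_apply (h : IsBmQuasiHamiltonian I J m S B ρ σ Φ A)
    {p : M} (hp : p ∉ S.Z) (X : BmTangent m S p) : A p X = mcL I J Φ p X.1.1 :=
  h.dlog_eq p hp X

theorem IsBmQuasiHamiltonian.moment_apply (h : IsBmQuasiHamiltonian I J m S B ρ σ Φ A)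
    {p : M} (hp : p ∉ S.Z) (ξ : EK) (w : E) :
    offZ σ p ![fundField I J ρ ξ p, w]
      = (1 / 2) * B.bil (mcL I J Φ p w + mcR I J Φ p w) ξ :=
  h.moment ξ p hp w

/-- The moment map condition in terms of the left Maurer-Cartan form only. -/
theorem IsBmQuasiHamiltonian.moment_left (h : IsBmQuasiHamiltonian I J m S B ρ σ Φ A)
    {p : M} (hp : p ∉ S.Z) (ξ : EK) (X Y : BmTangent m S p) (hY : Y.1.1 = fundField I J ρ ξ p) :
    σ p ![Y, X] = B.bil (A p X) ξ + (1 / 2) * B.bil (A p X) (A p Y) := by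
  have h2 : A p Y = AdL J (Φ p)⁻¹ ξ - ξ := by
    rw [h.dlog_apply hp, hY]
    exact mcL_fundField h.action.smooth (h.mdifferentiableAt hp) (fun g => h.equivariant g p hp) ξ
  rw [← offZ_self σ hp, hY, h2, h.dlog_apply hp]
  have key : ∀ w : E, (1 / 2) * B.bil (mcL I J Φ p w + mcR I J Φ p w) ξ
      = B.bil (mcL I J Φ p w) ξ + (1 / 2) * B.bil (mcL I J Φ p w) (AdL J (Φ p)⁻¹ ξ - ξ) := by
    intro w
    rw [mcR_eq_AdL_comp_mcL (h.mdifferentiableAt hp), ContinuousLinearMap.comp_apply, map_add,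
      add_apply, B.bil_AdL_left, map_sub]
    ring
  exact (h.moment_apply hp ξ X.1.1).trans (key X.1.1)

/-- The values of the fundamental vector fields in the `b^m`-tangent spaces. -/
theorem IsBmQuasiHamiltonian.exists_fundamental (h : IsBmQuasiHamiltonian I J m S B ρ σ Φ A)
    (hm : 1 ≤ m) (ξ : EK) (p : M) : ∃ Y : BmTangent m S p,
      (∀ X : BmTangent m S p, σ p ![Y, X] = B.bil (A p X) ξ + (1 / 2) * B.bil (A p X) (A p Y)) ∧
      ∀ {V : Type*} [NormedAddCommGroup V] [NormedSpace ℝ V] (L : EK →L[ℝ] V),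
        (∀ q ∉ S.Z, L (AdL J (Φ q)⁻¹ ξ - ξ) = 0) → L (A p Y) = 0 := by
  have hL : ∀ q ∉ S.Z, ∀ Y : BmTangent m S q, Y.1.1 = fundField I J ρ ξ q →
      A q Y = AdL J (Φ q)⁻¹ ξ - ξ := by
    intro q hq Y hY
    rw [h.dlog_apply hq, hY]
    exact mcL_fundField h.action.smooth (h.mdifferentiableAt hq) (fun g => h.equivariant g q hq) ξ
  by_cases hp : p ∈ S.Z
  · obtain ⟨c, hc, hcv⟩ := h.action.fund_bm ξ
    have hpn : p ∈ S.nhd := S.mem_nhd p hp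
    let Y : BmTangent m S p := ⟨(fundField I J ρ ξ p, c p), mem_BmTangent.2 (hcv p hpn)⟩
    refine ⟨Y, fun X => ?_, fun L h0 => ?_⟩
    · have := h.extend_relation hm ξ hc hcv
        (T := fun z => z.2.2 - (B.bil z.1 ξ + (1 / 2) * B.bil z.1 z.2.1)) (by fun_prop)
        (fun q hq X Y hY => sub_eq_zero.2 (h.moment_left hq ξ X Y hY)) hp X Y rfl rfl
      exact sub_eq_zero.1 this
    · have := h.extend_relation hm ξ hc hcv
        (T := fun z => ‖L z.2.1‖) (by fun_prop)
        (fun q hq X Y hY => by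
          rw [norm_eq_zero]
          exact (congrArg L (hL q hq Y hY)).trans (h0 q hq)) hp Y Y rfl rfl
      exact norm_eq_zero.1 this
  · have hY := toBm_val (m := m) hp (fundField I J ρ ξ p)
    exact ⟨toBm m S p (fundField I J ρ ξ p), fun X => h.moment_left hp ξ X _ hY,
      fun L h0 => by rw [hL p hp _ hY]; exact h0 p hp⟩

end BmSpaces

/-! ### Internal fusion -/

section InternalFusion

variable {E : Type*} [NormedAddCommGroup E] [NormedSpace ℝ E] [FiniteDimensional ℝ E]
  {H : Type*} [TopologicalSpace H]
  {I : ModelWithCorners ℝ E H} [I.Boundaryless] {M : Type*} [TopologicalSpace M] [ChartedSpace H M]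
  [IsManifold I ∞ M]
  {EG : Type*} [NormedAddCommGroup EG] [NormedSpace ℝ EG] [FiniteDimensional ℝ EG]
  {HG : Type*} [TopologicalSpace HG] {JG : ModelWithCorners ℝ EG HG} [JG.Boundaryless]
  {G : Type*} [TopologicalSpace G] [ChartedSpace HG G] [Group G] [LieGroup JG ∞ G]
  {EH₁ : Type*} [NormedAddCommGroup EH₁] [NormedSpace ℝ EH₁] [FiniteDimensional ℝ EH₁]
  {HH₁ : Type*} [TopologicalSpace HH₁] {J₁ : ModelWithCorners ℝ EH₁ HH₁} [J₁.Boundaryless]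
  {H₁ : Type*} [TopologicalSpace H₁] [ChartedSpace HH₁ H₁] [Group H₁] [LieGroup J₁ ∞ H₁]
  {EH₂ : Type*} [NormedAddCommGroup EH₂] [NormedSpace ℝ EH₂] [FiniteDimensional ℝ EH₂]
  {HH₂ : Type*} [TopologicalSpace HH₂] {J₂ : ModelWithCorners ℝ EH₂ HH₂} [J₂.Boundaryless]
  {H₂ : Type*} [TopologicalSpace H₂] [ChartedSpace HH₂ H₂] [Group H₂] [LieGroup J₂ ∞ H₂]

/-- A singular quasi-Hamiltonian `(G × H₁) × (G × H₂)`-space `(M, ρ, σ, Φ)` whose second `G`-valued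
moment map `b` is smooth everywhere, together with the data of its internal fusion. -/
structure IsInternalFusion (m : ℕ) (S : BManifold I M) (BG : InvariantInner JG G)
    (BH₁ : InvariantInner J₁ H₁) (BH₂ : InvariantInner J₂ H₂)
    (ρ : MulAction ((G × H₁) × (G × H₂)) M) (σ : ∀ p : M, BmTangent m S p [⋀^Fin 2]→L[ℝ] ℝ)
    (Φ : M → (G × H₁) × (G × H₂))
    (A : ∀ p : M, BmTangent m S p →L[ℝ] (EG × EH₁) × (EG × EH₂)) (b : M → G)
    (ρ' : MulAction (G × H₁ × H₂) M) (σ' : ∀ p : M, BmTangent m S p [⋀^Fin 2]→L[ℝ] ℝ)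
    (Φ' : M → G × H₁ × H₂) : Prop where
  qh : IsBmQuasiHamiltonian I ((JG.prod J₁).prod (JG.prod J₂)) m S
    ((BG.prod BH₁).prod (BG.prod BH₂)) ρ σ Φ A
  smooth_b : ContMDiff I JG ∞ b
  b_eq : ∀ p, (Φ p).2.1 = b p
  dlog_b : ∀ (p : M) (X : BmTangent m S p), (A p X).2.1 = mcL I JG b p X.1.1
  act_eq : ∀ g p, act ρ' g p = act ρ (diagHom G H₁ H₂ g) p
  form_eq : ∀ (p : M) (X Y : BmTangent m S p), σ' p ![X, Y] = σ p ![X, Y]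
    + (1 / 2) * (BG.bil (A p X).1.1 (mcR I JG b p Y.1.1) - BG.bil (A p Y).1.1 (mcR I JG b p X.1.1))
  map_eq : ∀ p, Φ' p = ((Φ p).1.1 * b p, (Φ p).1.2, (Φ p).2.2)

variable (EG EH₁ EH₂) in
/-- The differential of the diagonal embedding. -/
def diagLie (ξ : EG × EH₁ × EH₂) : (EG × EH₁) × (EG × EH₂) := ((ξ.1, ξ.2.1), (ξ.1, ξ.2.2))

variable (JG EH₁ EH₂) in
/-- The linear map `((x, y₁), (x', y₂)) ↦ (Ad_g⁻¹ x + x', y₁, y₂)`. -/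
noncomputable def fuseLie (g : G) : (EG × EH₁) × (EG × EH₂) →L[ℝ] EG × EH₁ × EH₂ :=
  ((AdL JG g⁻¹).comp ((ContinuousLinearMap.fst ℝ EG EH₁).comp
      (ContinuousLinearMap.fst ℝ (EG × EH₁) (EG × EH₂)))
    + (ContinuousLinearMap.fst ℝ EG EH₂).comp
      (ContinuousLinearMap.snd ℝ (EG × EH₁) (EG × EH₂))).prod
  (((ContinuousLinearMap.snd ℝ EG EH₁).comp
      (ContinuousLinearMap.fst ℝ (EG × EH₁) (EG × EH₂))).prod
    ((ContinuousLinearMap.snd ℝ EG EH₂).comp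
      (ContinuousLinearMap.snd ℝ (EG × EH₁) (EG × EH₂))))

theorem fuseLie_apply (g : G) (x : (EG × EH₁) × (EG × EH₂)) :
    fuseLie JG EH₁ EH₂ g x = (AdL JG g⁻¹ x.1.1 + x.2.1, x.1.2, x.2.2) := rfl

variable {m : ℕ} {S : BManifold I M} {BG : InvariantInner JG G}
  {BH₁ : InvariantInner J₁ H₁} {BH₂ : InvariantInner J₂ H₂}
  {ρ : MulAction ((G × H₁) × (G × H₂)) M} {σ : ∀ p : M, BmTangent m S p [⋀^Fin 2]→L[ℝ] ℝ}
  {Φ : M → (G × H₁) × (G × H₂)}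
  {A : ∀ p : M, BmTangent m S p →L[ℝ] (EG × EH₁) × (EG × EH₂)} {b : M → G}
  {ρ' : MulAction (G × H₁ × H₂) M} {σ' : ∀ p : M, BmTangent m S p [⋀^Fin 2]→L[ℝ] ℝ}
  {Φ' : M → G × H₁ × H₂}

theorem contMDiff_diagHom : ContMDiff (JG.prod (J₁.prod J₂)) ((JG.prod J₁).prod (JG.prod J₂)) ∞
    (diagHom G H₁ H₂) :=
  (contMDiff_fst.prodMk contMDiff_snd.fst).prodMk (contMDiff_fst.prodMk contMDiff_snd.snd)

theorem dM_diagHom (k : G × H₁ × H₂) (ξ : EG × EH₁ × EH₂) :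
    dM (JG.prod (J₁.prod J₂)) ((JG.prod J₁).prod (JG.prod J₂)) (diagHom G H₁ H₂) k ξ
      = diagLie EG EH₁ EH₂ ξ := by
  have h0 : MDifferentiableAt (JG.prod (J₁.prod J₂)) JG (Prod.fst : G × H₁ × H₂ → G) k :=
    mdifferentiableAt_fst
  have h1 : MDifferentiableAt (JG.prod (J₁.prod J₂)) (J₁.prod J₂)
    (Prod.snd : G × H₁ × H₂ → H₁ × H₂) k := mdifferentiableAt_snd
  change dM _ _ (fun k : G × H₁ × H₂ => ((k.1, k.2.1), (k.1, k.2.2))) k ξ = _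
  rw [dM_prodMk (f := fun k : G × H₁ × H₂ => (k.1, k.2.1)) (g := fun k => (k.1, k.2.2))
    (h0.prodMk h1.fst) (h0.prodMk h1.snd),
    dM_prodMk (f := fun k : G × H₁ × H₂ => k.1) (g := fun k => k.2.1) h0 h1.fst,
    dM_prodMk (f := fun k : G × H₁ × H₂ => k.1) (g := fun k => k.2.2) h0 h1.snd,
    dM_comp (I' := J₁.prod J₂) (g := (Prod.fst : H₁ × H₂ → H₁)) (f := fun k : G × H₁ × H₂ => k.2)
      mdifferentiableAt_fst h1,
    dM_comp (I' := J₁.prod J₂) (g := (Prod.snd : H₁ × H₂ → H₂)) (f := fun k : G × H₁ × H₂ => k.2)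
      mdifferentiableAt_snd h1,
    dM_fst, dM_snd]
  erw [dM_fst, dM_snd]
  rfl

namespace IsInternalFusion

theorem act_eq' (D : IsInternalFusion m S BG BH₁ BH₂ ρ σ Φ A b ρ' σ' Φ') (g : G × H₁ × H₂) :
    act ρ' g = act ρ (diagHom G H₁ H₂ g) := funext (D.act_eq g)

theorem fundField (D : IsInternalFusion m S BG BH₁ BH₂ ρ σ Φ A b ρ' σ' Φ') (ξ : EG × EH₁ × EH₂)
    (p : M) : fundField I (JG.prod (J₁.prod J₂)) ρ' ξ p
      = fundField I ((JG.prod J₁).prod (JG.prod J₂)) ρ (diagLie EG EH₁ EH₂ ξ) p := by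
  change dM (JG.prod (J₁.prod J₂)) I (fun g : G × H₁ × H₂ => act ρ' g p) 1 ξ
    = dM ((JG.prod J₁).prod (JG.prod J₂)) I (fun g => act ρ g p) 1 (diagLie EG EH₁ EH₂ ξ)
  simp only [D.act_eq]
  rw [dM_comp (I' := (JG.prod J₁).prod (JG.prod J₂)) (g := fun g => act ρ g p)
    (f := diagHom G H₁ H₂) ((D.qh.action.smooth.contMDiff_orbit p).mdifferentiableAt (by simp))
    (contMDiff_diagHom.mdifferentiableAt (by simp)), ContinuousLinearMap.comp_apply, dM_diagHom]
  rfl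

theorem action (D : IsInternalFusion m S BG BH₁ BH₂ ρ σ Φ A b ρ' σ' Φ') :
    IsBmAction I (JG.prod (J₁.prod J₂)) m S ρ' where
  smooth := by
    simp only [IsSmoothAction, D.act_eq]
    exact D.qh.action.smooth.comp ((contMDiff_diagHom.comp contMDiff_fst).prodMk contMDiff_snd)
  map_Z g p := by
    rw [D.act_eq]
    exact D.qh.action.map_Z _ p
  map_bm g p hp := by
    rw [D.act_eq']
    exact D.qh.action.map_bm _ p hp
  fund_bm ξ := by
    obtain ⟨c, hc, h⟩ := D.qh.action.fund_bm (diagLie EG EH₁ EH₂ ξ)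
    refine ⟨c, hc, fun q hq => ?_⟩
    exact (congrArg (S.df q) (D.fundField ξ q)).trans (h q hq)

end IsInternalFusion

end InternalFusion

section SmoothForms

variable {E : Type*} [NormedAddCommGroup E] [NormedSpace ℝ E] [FiniteDimensional ℝ E]
  {H : Type*} [TopologicalSpace H]
  {I : ModelWithCorners ℝ E H} [I.Boundaryless] {M : Type*} [TopologicalSpace M] [ChartedSpace H M]
  [IsManifold I ∞ M]
  {F : Type*} [NormedAddCommGroup F] [NormedSpace ℝ F] {k : ℕ}
  {D : Type*} [NormedAddCommGroup D] [NormedSpace ℝ D]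

theorem contDiffAt_clm [FiniteDimensional ℝ D] {E' : Type*} [NormedAddCommGroup E']
    [NormedSpace ℝ E'] {f : E' → D →L[ℝ] F} {x : E'} {n : WithTop ℕ∞}
    (h : ∀ v : D, ContDiffAt ℝ n (fun y => f y v) x) : ContDiffAt ℝ n f x := by
  let b := Module.finBasis ℝ D
  have hf : f = fun y => ∑ i, (ContinuousLinearMap.smulRightL ℝ D F
      (LinearMap.toContinuousLinearMap (b.coord i))) (f y (b i)) := by
    funext y
    ext v
    conv_lhs => rw [← b.sum_repr v, map_sum]
    simp
  rw [hf]
  exact ContDiffAt.sum fun i _ =>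
    (ContinuousLinearMap.contDiff _).contDiffAt.comp x (h (b i))

/-- Smoothness on `V` of a family of linear maps on the tangent spaces. -/
def SmoothOneForm (I : ModelWithCorners ℝ E H) (α : M → E →L[ℝ] F) (V : Set M) : Prop :=
  ∀ (x₀ : M) (y : E), y ∈ (extChartAt I x₀).target → (extChartAt I x₀).symm y ∈ V →
    ContDiffAt ℝ ∞ (fun y => (α ((extChartAt I x₀).symm y)).comp
      (dM 𝓘(ℝ, E) I (extChartAt I x₀).symm y)) y

theorem smoothOneForm_mcL
    {EK : Type*} [NormedAddCommGroup EK] [NormedSpace ℝ EK] [FiniteDimensional ℝ EK]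
    {HK : Type*} [TopologicalSpace HK] {J : ModelWithCorners ℝ EK HK} [J.Boundaryless]
    {K : Type*} [TopologicalSpace K] [ChartedSpace HK K] [Group K] [LieGroup J ∞ K]
    {φ : M → K} {V : Set M} (hφ : ContMDiffOn I J ∞ φ V) (hV : IsOpen V) :
    SmoothOneForm I (mcL I J φ) V := fun _ _ hy hyV => contDiffAt_mcL_comp_symm hφ hV hy hyV

theorem smoothOneForm_mcR
    {EK : Type*} [NormedAddCommGroup EK] [NormedSpace ℝ EK] [FiniteDimensional ℝ EK]
    {HK : Type*} [TopologicalSpace HK] {J : ModelWithCorners ℝ EK HK} [J.Boundaryless]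
    {K : Type*} [TopologicalSpace K] [ChartedSpace HK K] [Group K] [LieGroup J ∞ K]
    {φ : M → K} {V : Set M} (hφ : ContMDiffOn I J ∞ φ V) (hV : IsOpen V) :
    SmoothOneForm I (mcR I J φ) V := fun _ _ hy hyV => contDiffAt_mcR_comp_symm hφ hV hy hyV

theorem SmoothOneForm.smoothFormOn [FiniteDimensional ℝ F] {α : M → E →L[ℝ] F} {V : Set M}
    (h : SmoothOneForm I α V) : SmoothFormOn I (oneForm (I := I) α) V := by
  refine smoothFormOn_of_contDiffAt fun x₀ y hy hyV v => ?_
  exact (h x₀ y hy hyV).clm_apply contDiffAt_const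

theorem SmoothFormOn.smoothOneForm {γ : ∀ q : M, TangentSpace I q [⋀^Fin 1]→L[ℝ] F} {V : Set M}
    (h : SmoothFormOn I γ V) (hV : IsOpen V) {α : M → E →L[ℝ] F}
    (hα : ∀ q ∈ V, ∀ v : E, α q v = γ q ![v]) : SmoothOneForm I α V := by
  intro x₀ y hy hyV
  refine contDiffAt_clm fun v => ?_
  have h1 := h.contDiffAt hV hy hyV
  have h2 : ContDiffAt ℝ ∞ (fun z => chartRep I γ x₀ z ![v]) y :=
    (ContinuousAlternatingMap.apply ℝ E F ![v]).contDiff.contDiffAt.comp y h1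
  refine h2.congr_of_eventuallyEq ?_
  filter_upwards [preimage_mem_nhds_chart hV hy hyV] with z hz
  rw [chartRep_one]
  exact hα _ hz.2 _

theorem SmoothOneForm.clm_comp {α : M → E →L[ℝ] F} {V : Set M} (h : SmoothOneForm I α V)
    (L : F →L[ℝ] D) : SmoothOneForm I (fun q => L.comp (α q)) V := fun x₀ y hy hyV =>
  contDiffAt_const.clm_comp (h x₀ y hy hyV)

theorem SmoothOneForm.comp_clm {α : M → E →L[ℝ] F} {V : Set M} (h : SmoothOneForm I α V)
    (hV : IsOpen V) {T : M → F →L[ℝ] D} (hT : ContMDiffOn I 𝓘(ℝ, F →L[ℝ] D) ∞ T V) :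
    SmoothOneForm I (fun q => (T q).comp (α q)) V := fun x₀ y hy hyV =>
  (contDiffAt_comp_symm hT hV hy hyV).clm_comp (h x₀ y hy hyV)

theorem SmoothOneForm.mono {α : M → E →L[ℝ] F} {V W : Set M} (h : SmoothOneForm I α V)
    (hW : W ⊆ V) : SmoothOneForm I α W := fun x₀ y hy hyV => h x₀ y hy (hW hyV)

theorem SmoothOneForm.wedgePair {α β : M → E →L[ℝ] F} {V : Set M} (hα : SmoothOneForm I α V)
    (hβ : SmoothOneForm I β V) (B : F →L[ℝ] F →L[ℝ] ℝ) :
    SmoothFormOn I (fun q => (BmFusion.wedgePair B (α q) (β q) :)) V := by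
  refine smoothFormOn_of_contDiffAt fun x₀ y hy hyV v => ?_
  have h1 := fun v : E => (hα x₀ y hy hyV).clm_apply (contDiffAt_const (c := v))
  have h2 := fun v : E => (hβ x₀ y hy hyV).clm_apply (contDiffAt_const (c := v))
  exact ((contDiffAt_const.clm_apply (h1 (v 0))).clm_apply (h2 (v 1))).sub
    ((contDiffAt_const.clm_apply (h1 (v 1))).clm_apply (h2 (v 0)))

theorem SmoothFormOn.add_const_smul {α β : ∀ x : M, TangentSpace I x [⋀^Fin k]→L[ℝ] F} {V : Set M}
    (hα : SmoothFormOn I α V) (hβ : SmoothFormOn I β V) (c : ℝ) :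
    SmoothFormOn I (fun q => α q + c • β q) V := fun x₀ =>
  (hα x₀).add ((hβ x₀).const_smul c)

end SmoothForms

section InternalFusion

variable {E : Type*} [NormedAddCommGroup E] [NormedSpace ℝ E] [FiniteDimensional ℝ E]
  {H : Type*} [TopologicalSpace H]
  {I : ModelWithCorners ℝ E H} [I.Boundaryless] {M : Type*} [TopologicalSpace M] [ChartedSpace H M]
  [IsManifold I ∞ M]
  {EG : Type*} [NormedAddCommGroup EG] [NormedSpace ℝ EG] [FiniteDimensional ℝ EG]
  {HG : Type*} [TopologicalSpace HG] {JG : ModelWithCorners ℝ EG HG} [JG.Boundaryless]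
  {G : Type*} [TopologicalSpace G] [ChartedSpace HG G] [Group G] [LieGroup JG ∞ G]
  {EH₁ : Type*} [NormedAddCommGroup EH₁] [NormedSpace ℝ EH₁] [FiniteDimensional ℝ EH₁]
  {HH₁ : Type*} [TopologicalSpace HH₁] {J₁ : ModelWithCorners ℝ EH₁ HH₁} [J₁.Boundaryless]
  {H₁ : Type*} [TopologicalSpace H₁] [ChartedSpace HH₁ H₁] [Group H₁] [LieGroup J₁ ∞ H₁]
  {EH₂ : Type*} [NormedAddCommGroup EH₂] [NormedSpace ℝ EH₂] [FiniteDimensional ℝ EH₂]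
  {HH₂ : Type*} [TopologicalSpace HH₂] {J₂ : ModelWithCorners ℝ EH₂ HH₂} [J₂.Boundaryless]
  {H₂ : Type*} [TopologicalSpace H₂] [ChartedSpace HH₂ H₂] [Group H₂] [LieGroup J₂ ∞ H₂]
  {m : ℕ} {S : BManifold I M} {BG : InvariantInner JG G}
  {BH₁ : InvariantInner J₁ H₁} {BH₂ : InvariantInner J₂ H₂}
  {ρ : MulAction ((G × H₁) × (G × H₂)) M} {σ : ∀ p : M, BmTangent m S p [⋀^Fin 2]→L[ℝ] ℝ}
  {Φ : M → (G × H₁) × (G × H₂)}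
  {A : ∀ p : M, BmTangent m S p →L[ℝ] (EG × EH₁) × (EG × EH₂)} {b : M → G}
  {ρ' : MulAction (G × H₁ × H₂) M} {σ' : ∀ p : M, BmTangent m S p [⋀^Fin 2]→L[ℝ] ℝ}
  {Φ' : M → G × H₁ × H₂}

theorem contMDiffOn_fuseLie {f : M → G} {V : Set M} (hf : ContMDiffOn I JG ∞ f V) :
    ContMDiffOn I 𝓘(ℝ, (EG × EH₁) × (EG × EH₂) →L[ℝ] EG × EH₁ × EH₂) ∞
      (fun q => fuseLie JG EH₁ EH₂ (f q)) V := by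
  let T : (EG →L[ℝ] EG) →L[ℝ] ((EG × EH₁) × (EG × EH₂) →L[ℝ] EG × EH₁ × EH₂) :=
    (ContinuousLinearMap.compL ℝ ((EG × EH₁) × (EG × EH₂)) EG (EG × EH₁ × EH₂)
      (ContinuousLinearMap.inl ℝ EG (EH₁ × EH₂))).comp
    ((ContinuousLinearMap.compL ℝ ((EG × EH₁) × (EG × EH₂)) EG EG).flip
      ((ContinuousLinearMap.fst ℝ EG EH₁).comp (ContinuousLinearMap.fst ℝ (EG × EH₁) (EG × EH₂))))
  have h : (fun q => fuseLie JG EH₁ EH₂ (f q))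
      = fun q => T (AdL JG (f q)⁻¹) + (fuseLie JG EH₁ EH₂ (1 : G) - T (AdL JG (1 : G)⁻¹)) := by
    funext q
    refine ContinuousLinearMap.ext fun x => ?_
    simp [T, fuseLie_apply]
  have hA : ContMDiffOn I 𝓘(ℝ, EG →L[ℝ] EG) ∞ (fun q => AdL JG (f q)⁻¹) V :=
    (contMDiff_AdL.comp (contMDiff_inv JG ∞)).comp_contMDiffOn hf
  rw [h]
  exact (T.contDiff.contMDiff.comp_contMDiffOn hA).add contMDiffOn_const

namespace IsInternalFusion

theorem smooth_Φ (D : IsInternalFusion m S BG BH₁ BH₂ ρ σ Φ A b ρ' σ' Φ') :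
    ContMDiffOn I ((JG.prod J₁).prod (JG.prod J₂)) ∞ Φ S.Zᶜ := D.qh.smooth_map

theorem smooth_a (D : IsInternalFusion m S BG BH₁ BH₂ ρ σ Φ A b ρ' σ' Φ') :
    ContMDiffOn I JG ∞ (fun q => (Φ q).1.1) S.Zᶜ :=
  (contMDiff_fst.comp contMDiff_fst).comp_contMDiffOn D.qh.smooth_map

theorem mdifferentiableAt_a (D : IsInternalFusion m S BG BH₁ BH₂ ρ σ Φ A b ρ' σ' Φ') {p : M}
    (hp : p ∉ S.Z) : MDifferentiableAt I JG (fun q => (Φ q).1.1) p :=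
  (D.smooth_a.contMDiffAt (S.isOpen_compl_Z.mem_nhds hp)).mdifferentiableAt (by simp)

theorem mdifferentiableAt_b (D : IsInternalFusion m S BG BH₁ BH₂ ρ σ Φ A b ρ' σ' Φ') (p : M) :
    MDifferentiableAt I JG b p := D.smooth_b.mdifferentiableAt (by simp)

theorem mcL_Φ (D : IsInternalFusion m S BG BH₁ BH₂ ρ σ Φ A b ρ' σ' Φ') {p : M}
    (hp : p ∉ S.Z) (w : E) : mcL I ((JG.prod J₁).prod (JG.prod J₂)) Φ p w
      = ((mcL I JG (fun q => (Φ q).1.1) p w, mcL I J₁ (fun q => (Φ q).1.2) p w),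
        (mcL I JG b p w, mcL I J₂ (fun q => (Φ q).2.2) p w)) := by
  have h := D.qh.mdifferentiableAt hp
  rw [mcL_prod h, mcL_prod h.fst, mcL_prod h.snd]
  simp only [D.b_eq]
  rfl

theorem mcR_Φ (D : IsInternalFusion m S BG BH₁ BH₂ ρ σ Φ A b ρ' σ' Φ') {p : M}
    (hp : p ∉ S.Z) (w : E) : mcR I ((JG.prod J₁).prod (JG.prod J₂)) Φ p w
      = ((mcR I JG (fun q => (Φ q).1.1) p w, mcR I J₁ (fun q => (Φ q).1.2) p w),
        (mcR I JG b p w, mcR I J₂ (fun q => (Φ q).2.2) p w)) := by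
  have h := D.qh.mdifferentiableAt hp
  rw [mcR_prod h, mcR_prod h.fst, mcR_prod h.snd]
  simp only [D.b_eq]
  rfl

theorem smooth_map (D : IsInternalFusion m S BG BH₁ BH₂ ρ σ Φ A b ρ' σ' Φ') :
    ContMDiffOn I (JG.prod (J₁.prod J₂)) ∞ Φ' S.Zᶜ := by
  rw [show Φ' = _ from funext D.map_eq]
  exact (((contMDiff_mul JG ∞).comp_contMDiffOn (D.smooth_a.prodMk D.smooth_b.contMDiffOn))).prodMk
    (((contMDiff_snd.comp contMDiff_fst).comp_contMDiffOn D.smooth_Φ).prodMk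
      ((contMDiff_snd.comp contMDiff_snd).comp_contMDiffOn D.smooth_Φ))

theorem mcL_Φ' (D : IsInternalFusion m S BG BH₁ BH₂ ρ σ Φ A b ρ' σ' Φ') {p : M}
    (hp : p ∉ S.Z) (w : E) : mcL I (JG.prod (J₁.prod J₂)) Φ' p w
      = (AdL JG (b p)⁻¹ (mcL I JG (fun q => (Φ q).1.1) p w) + mcL I JG b p w,
        mcL I J₁ (fun q => (Φ q).1.2) p w, mcL I J₂ (fun q => (Φ q).2.2) p w) := by
  have h := D.qh.mdifferentiableAt hp
  rw [show Φ' = _ from funext D.map_eq,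
    mcL_prodMk ((D.mdifferentiableAt_a hp).mul_lie (D.mdifferentiableAt_b p))
      (h.fst.snd.prodMk h.snd.snd), mcL_prodMk h.fst.snd h.snd.snd,
    mcL_mul (D.mdifferentiableAt_a hp) (D.mdifferentiableAt_b p)]
  rfl

theorem mcR_Φ' (D : IsInternalFusion m S BG BH₁ BH₂ ρ σ Φ A b ρ' σ' Φ') {p : M}
    (hp : p ∉ S.Z) (w : E) : mcR I (JG.prod (J₁.prod J₂)) Φ' p w
      = (mcR I JG (fun q => (Φ q).1.1) p w + AdL JG (Φ p).1.1 (mcR I JG b p w),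
        mcR I J₁ (fun q => (Φ q).1.2) p w, mcR I J₂ (fun q => (Φ q).2.2) p w) := by
  have h := D.qh.mdifferentiableAt hp
  rw [show Φ' = _ from funext D.map_eq,
    mcR_prodMk ((D.mdifferentiableAt_a hp).mul_lie (D.mdifferentiableAt_b p))
      (h.fst.snd.prodMk h.snd.snd), mcR_prodMk h.fst.snd h.snd.snd,
    mcR_mul (D.mdifferentiableAt_a hp) (D.mdifferentiableAt_b p)]
  rfl

theorem dlog_a (D : IsInternalFusion m S BG BH₁ BH₂ ρ σ Φ A b ρ' σ' Φ') {p : M}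
    (hp : p ∉ S.Z) (X : BmTangent m S p) :
    (A p X).1.1 = mcL I JG (fun q => (Φ q).1.1) p X.1.1 := by
  rw [D.qh.dlog_apply hp X]
  exact congrArg (fun z => z.1.1) (D.mcL_Φ hp X.1.1)

theorem offZ_eq (D : IsInternalFusion m S BG BH₁ BH₂ ρ σ Φ A b ρ' σ' Φ') {p : M}
    (hp : p ∉ S.Z) (u v : E) : offZ σ' p ![u, v] = offZ σ p ![u, v]
      + (1 / 2) * (BG.bil (mcL I JG (fun q => (Φ q).1.1) p u) (mcR I JG b p v)
        - BG.bil (mcL I JG (fun q => (Φ q).1.1) p v) (mcR I JG b p u)) := by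
  refine (offZ_apply σ' p u v).trans ((D.form_eq p _ _).trans ?_)
  rw [offZ_apply σ p u v, D.dlog_a hp, D.dlog_a hp]
  simp only [toBm_val hp]

theorem chartRep_offZ (D : IsInternalFusion m S BG BH₁ BH₂ ρ σ Φ A b ρ' σ' Φ') {x₀ : M} {y : E}
    (hy : y ∈ (extChartAt I x₀).target) (hyZ : (extChartAt I x₀).symm y ∉ S.Z) :
    chartRep I (offZ σ') x₀ =ᶠ[𝓝 y] fun z => chartRep I (offZ σ) x₀ z
      + (1 / 2 : ℝ) • wedgePair BG.bil
        (mcL 𝓘(ℝ, E) JG (fun z => (Φ ((extChartAt I x₀).symm z)).1.1) z)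
        (mcR 𝓘(ℝ, E) JG (fun z => b ((extChartAt I x₀).symm z)) z) := by
  filter_upwards [preimage_mem_nhds_chart S.isOpen_compl_Z hy hyZ] with z hz
  refine ContinuousAlternatingMap.ext fun v => ?_
  have hv : v = ![v 0, v 1] := by
    funext i
    fin_cases i <;> rfl
  rw [hv, mcL_comp_symm (φ := fun q => (Φ q).1.1) hz.1 (D.mdifferentiableAt_a hz.2),
    mcR_comp_symm hz.1 (D.mdifferentiableAt_b _)]
  refine (chartRep_two _ _ _ _ _).trans ((D.offZ_eq hz.2 _ _).trans ?_)
  rw [← chartRep_two]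
  rfl

theorem smooth_form (D : IsInternalFusion m S BG BH₁ BH₂ ρ σ Φ A b ρ' σ' Φ') :
    IsBmTwoForm σ' := by
  refine ⟨?_, fun p hp => ?_⟩
  · refine smoothFormOn_of_contDiffAt fun x₀ y hy hyZ v => ?_
    let τ : ∀ q : M, TangentSpace I q [⋀^Fin 2]→L[ℝ] ℝ := fun q =>
      (wedgePair BG.bil (mcL I JG (fun q => (Φ q).1.1) q) (mcR I JG b q) :)
    have h1 := (D.qh.smooth_form.1.add_const_smul (β := τ)
      ((smoothOneForm_mcL D.smooth_a S.isOpen_compl_Z).wedgePair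
        (smoothOneForm_mcR D.smooth_b.contMDiffOn S.isOpen_compl_Z) BG.bil) (1 / 2)).contDiffAt
      S.isOpen_compl_Z hy hyZ
    have h2 : ContDiffAt ℝ ∞
        (fun z => chartRep I (fun q => offZ σ q + (1 / 2 : ℝ) • τ q) x₀ z v) y :=
      (ContinuousAlternatingMap.apply ℝ E ℝ v).contDiff.contDiffAt.comp y h1
    refine h2.congr_of_eventuallyEq ?_
    filter_upwards [preimage_mem_nhds_chart S.isOpen_compl_Z hy hyZ] with z hz
    have hv : v = ![v 0, v 1] := by
      funext i
      fin_cases i <;> rfl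
    rw [hv, chartRep_two, chartRep_two]
    exact D.offZ_eq hz.2 _ _
  · obtain ⟨W₁, hW₁, hpW₁, α, β, hα, hβ, hσ⟩ := D.qh.smooth_form.2 p hp
    obtain ⟨W₂, hW₂, hpW₂, a, γ, ha, hγ, hA⟩ := D.qh.dlog_smooth p hp
    let π : (EG × EH₁) × (EG × EH₂) →L[ℝ] EG :=
      (ContinuousLinearMap.fst ℝ EG EH₁).comp (ContinuousLinearMap.fst ℝ (EG × EH₁) (EG × EH₂))
    let γ' : M → E →L[ℝ] EG := fun q => π.comp
      ((ContinuousAlternatingMap.ofSubsingleton ℝ E ((EG × EH₁) × (EG × EH₂)) (0 : Fin 1)).symm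
        (γ q))
    have hγv : ∀ q (v : E), (ContinuousAlternatingMap.ofSubsingleton ℝ E
        ((EG × EH₁) × (EG × EH₂)) (0 : Fin 1)).symm (γ q) v = γ q ![v] := by
      intro q v
      refine congrArg (γ q) ?_
      funext i
      fin_cases i
      rfl
    have hγ' : SmoothOneForm I γ' (W₁ ∩ W₂) :=
      ((hγ.smoothOneForm hW₂ fun q _ v => hγv q v).clm_comp π).mono inter_subset_right
    have hb : SmoothOneForm I (mcR I JG b) (W₁ ∩ W₂) :=
      (smoothOneForm_mcR D.smooth_b.contMDiffOn isOpen_univ).mono (subset_univ _)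
    have hπa : ContMDiffOn I 𝓘(ℝ, EG →L[ℝ] ℝ) ∞ (fun q => BG.bil (π (a q))) (W₁ ∩ W₂) :=
      (BG.bil.comp π).contDiff.contMDiff.comp_contMDiffOn (ha.mono inter_subset_right)
    let τ : ∀ q : M, TangentSpace I q [⋀^Fin 2]→L[ℝ] ℝ := fun q =>
      (wedgePair BG.bil (γ' q) (mcR I JG b q) :)
    refine ⟨W₁ ∩ W₂, hW₁.inter hW₂, ⟨hpW₁, hpW₂⟩,
      fun q => α q + (1 / 2 : ℝ) • oneForm (fun q => (BG.bil (π (a q))).comp (mcR I JG b q)) q,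
      fun q => β q + (1 / 2 : ℝ) • τ q,
      (hα.mono inter_subset_left).add_const_smul
        (hb.comp_clm (hW₁.inter hW₂) hπa).smoothFormOn _,
      (hβ.mono inter_subset_left).add_const_smul (hγ'.wedgePair hb BG.bil) _, ?_⟩
    intro q hq X Y
    have hAq : ∀ X : BmTangent m S q,
        (A q X).1.1 = X.1.2 • π (a q) + γ' q X.1.1 := by
      intro X
      refine (congrArg π (hA q hq.2 X)).trans ?_
      rw [map_add, map_smul]
      exact congrArg (fun z => X.1.2 • π (a q) + π z) (hγv q X.1.1).symm
    rw [D.form_eq, hσ q hq.1, hAq, hAq]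
    have key : ∀ (x y : E) (r s α₁ α₂ β₁ : ℝ), r * α₁ - s * α₂ + β₁
        + 1 / 2 * (BG.bil (r • π (a q) + γ' q x) (mcR I JG b q y)
          - BG.bil (s • π (a q) + γ' q y) (mcR I JG b q x))
        = r * (α₁ + (1 / 2) * BG.bil (π (a q)) (mcR I JG b q y))
          - s * (α₂ + (1 / 2) * BG.bil (π (a q)) (mcR I JG b q x))
          + (β₁ + (1 / 2) * (BG.bil (γ' q x) (mcR I JG b q y)
            - BG.bil (γ' q y) (mcR I JG b q x))) := by
      intro x y r s α₁ α₂ β₁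
      simp only [map_add, map_smul, add_apply, smul_apply, smul_eq_mul]
      ring
    exact key X.1.1 Y.1.1 X.1.2 Y.1.2 _ _ _

end IsInternalFusion

end InternalFusion

theorem extDeriv_add_const_smul {E : Type*} [NormedAddCommGroup E] [NormedSpace ℝ E] {k : ℕ}
    {η τ : E → E [⋀^Fin k]→L[ℝ] ℝ} {x : E} (hη : DifferentiableAt ℝ η x)
    (hτ : DifferentiableAt ℝ τ x) (c : ℝ) (v : Fin (k + 1) → E) :
    extDeriv (fun y => η y + c • τ y) x v = extDeriv η x v + c * extDeriv τ x v := by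
  have h : extDeriv (fun y => η y + c • τ y) x = extDeriv η x + c • extDeriv τ x :=
    (extDeriv_fun_add hη (hτ.fun_const_smul c)).trans (congrArg (_ + ·) (extDeriv_smul c τ))
  rw [h]
  rfl

section InternalFusion

variable {E : Type*} [NormedAddCommGroup E] [NormedSpace ℝ E] [FiniteDimensional ℝ E]
  {H : Type*} [TopologicalSpace H]
  {I : ModelWithCorners ℝ E H} [I.Boundaryless] {M : Type*} [TopologicalSpace M] [ChartedSpace H M]
  [IsManifold I ∞ M]
  {EG : Type*} [NormedAddCommGroup EG] [NormedSpace ℝ EG] [FiniteDimensional ℝ EG]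
  {HG : Type*} [TopologicalSpace HG] {JG : ModelWithCorners ℝ EG HG} [JG.Boundaryless]
  {G : Type*} [TopologicalSpace G] [ChartedSpace HG G] [Group G] [LieGroup JG ∞ G]
  {EH₁ : Type*} [NormedAddCommGroup EH₁] [NormedSpace ℝ EH₁] [FiniteDimensional ℝ EH₁]
  {HH₁ : Type*} [TopologicalSpace HH₁] {J₁ : ModelWithCorners ℝ EH₁ HH₁} [J₁.Boundaryless]
  {H₁ : Type*} [TopologicalSpace H₁] [ChartedSpace HH₁ H₁] [Group H₁] [LieGroup J₁ ∞ H₁]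
  {EH₂ : Type*} [NormedAddCommGroup EH₂] [NormedSpace ℝ EH₂] [FiniteDimensional ℝ EH₂]
  {HH₂ : Type*} [TopologicalSpace HH₂] {J₂ : ModelWithCorners ℝ EH₂ HH₂} [J₂.Boundaryless]
  {H₂ : Type*} [TopologicalSpace H₂] [ChartedSpace HH₂ H₂] [Group H₂] [LieGroup J₂ ∞ H₂]
  {m : ℕ} {S : BManifold I M} {BG : InvariantInner JG G}
  {BH₁ : InvariantInner J₁ H₁} {BH₂ : InvariantInner J₂ H₂}
  {ρ : MulAction ((G × H₁) × (G × H₂)) M} {σ : ∀ p : M, BmTangent m S p [⋀^Fin 2]→L[ℝ] ℝ}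
  {Φ : M → (G × H₁) × (G × H₂)}
  {A : ∀ p : M, BmTangent m S p →L[ℝ] (EG × EH₁) × (EG × EH₂)} {b : M → G}
  {ρ' : MulAction (G × H₁ × H₂) M} {σ' : ∀ p : M, BmTangent m S p [⋀^Fin 2]→L[ℝ] ℝ}
  {Φ' : M → G × H₁ × H₂}

namespace IsInternalFusion

theorem equivariant_a (D : IsInternalFusion m S BG BH₁ BH₂ ρ σ Φ A b ρ' σ' Φ')
    (k : (G × H₁) × (G × H₂)) {p : M} (hp : p ∉ S.Z) :
    (Φ (act ρ k p)).1.1 = k.1.1 * (Φ p).1.1 * k.1.1⁻¹ :=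
  congrArg (fun z => z.1.1) (D.qh.equivariant k p hp)

theorem equivariant_b (D : IsInternalFusion m S BG BH₁ BH₂ ρ σ Φ A b ρ' σ' Φ')
    (k : (G × H₁) × (G × H₂)) {p : M} (hp : p ∉ S.Z) :
    b (act ρ k p) = k.2.1 * b p * k.2.1⁻¹ := by
  rw [← D.b_eq, ← D.b_eq]
  exact congrArg (fun z => z.2.1) (D.qh.equivariant k p hp)

theorem equivariant (D : IsInternalFusion m S BG BH₁ BH₂ ρ σ Φ A b ρ' σ' Φ')
    (k : G × H₁ × H₂) {p : M} (hp : p ∉ S.Z) : Φ' (act ρ' k p) = k * Φ' p * k⁻¹ := by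
  have h := D.qh.equivariant (diagHom G H₁ H₂ k) p hp
  rw [D.act_eq, D.map_eq, D.map_eq, D.equivariant_a _ hp, D.equivariant_b _ hp, h]
  refine Prod.ext ?_ rfl
  change k.1 * (Φ p).1.1 * k.1⁻¹ * (k.1 * b p * k.1⁻¹) = k.1 * ((Φ p).1.1 * b p) * k.1⁻¹
  group

theorem invariant (D : IsInternalFusion m S BG BH₁ BH₂ ρ σ Φ A b ρ' σ' Φ')
    (k : G × H₁ × H₂) {p : M} (hp : p ∉ S.Z) (u v : E) :
    offZ σ' (act ρ' k p) ![dM I I (act ρ' k) p u, dM I I (act ρ' k) p v] = offZ σ' p ![u, v] := by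
  have hs : MDifferentiableAt I I (act ρ (diagHom G H₁ H₂ k)) p :=
    (D.qh.action.smooth.contMDiff_act _).mdifferentiableAt (by simp)
  have hp' : act ρ (diagHom G H₁ H₂ k) p ∉ S.Z := fun h => hp ((D.qh.action.map_Z _ p).1 h)
  have ha : ∀ w, mcL I JG (fun q => (Φ q).1.1) (act ρ (diagHom G H₁ H₂ k) p)
      (dM I I (act ρ (diagHom G H₁ H₂ k)) p w)
      = AdL JG k.1 (mcL I JG (fun q => (Φ q).1.1) p w) := by
    intro w
    have h1 := mcL_comp (φ := fun q => (Φ q).1.1) (D.mdifferentiableAt_a hp') hs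
    have h2 : (fun q => (Φ (act ρ (diagHom G H₁ H₂ k) q)).1.1)
        =ᶠ[𝓝 p] fun q => k.1 * (Φ q).1.1 * k.1⁻¹ := by
      filter_upwards [S.isOpen_compl_Z.mem_nhds hp] with q hq using D.equivariant_a _ hq
    rw [mcL_congr h2, mcL_conj (D.mdifferentiableAt_a hp)] at h1
    exact (congrArg (fun L : E →L[ℝ] EG => L w) h1).symm
  have hb : ∀ w, mcR I JG b (act ρ (diagHom G H₁ H₂ k) p)
      (dM I I (act ρ (diagHom G H₁ H₂ k)) p w) = AdL JG k.1 (mcR I JG b p w) := by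
    intro w
    have h1 := mcR_comp (D.mdifferentiableAt_b (act ρ (diagHom G H₁ H₂ k) p)) hs
    have h2 : (fun q => b (act ρ (diagHom G H₁ H₂ k) q)) =ᶠ[𝓝 p] fun q => k.1 * b q * k.1⁻¹ := by
      filter_upwards [S.isOpen_compl_Z.mem_nhds hp] with q hq using D.equivariant_b _ hq
    rw [mcR_congr h2, mcR_conj (D.mdifferentiableAt_b p)] at h1
    exact (congrArg (fun L : E →L[ℝ] EG => L w) h1).symm
  rw [D.act_eq']
  refine (D.offZ_eq hp' _ _).trans ((D.offZ_eq hp u v).trans ?_).symm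
  rw [ha, ha, hb, hb, BG.bil_AdL, BG.bil_AdL]
  exact congrArg (· + _) (D.qh.invariant (diagHom G H₁ H₂ k) p hp u v).symm

theorem dlog_smooth (D : IsInternalFusion m S BG BH₁ BH₂ ρ σ Φ A b ρ' σ' Φ') :
    IsBmOneFormNearZ (fun p => (fuseLie JG EH₁ EH₂ (b p)).comp (A p)) := by
  intro p hp
  obtain ⟨W, hW, hpW, a, γ, ha, hγ, hA⟩ := D.qh.dlog_smooth p hp
  have hT := contMDiffOn_fuseLie (EH₁ := EH₁) (EH₂ := EH₂) (D.smooth_b.contMDiffOn (s := W))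
  let γ' : M → E →L[ℝ] (EG × EH₁) × (EG × EH₂) := fun q =>
    (ContinuousAlternatingMap.ofSubsingleton ℝ E ((EG × EH₁) × (EG × EH₂)) (0 : Fin 1)).symm (γ q)
  have hγv : ∀ q (v : E), γ' q v = γ q ![v] := by
    intro q v
    refine congrArg (γ q) ?_
    funext i
    fin_cases i
    rfl
  refine ⟨W, hW, hpW, fun q => fuseLie JG EH₁ EH₂ (b q) (a q),
    oneForm fun q => (fuseLie JG EH₁ EH₂ (b q)).comp (γ' q), hT.clm_apply ha,
    ((hγ.smoothOneForm hW fun q _ v => hγv q v).comp_clm hW hT).smoothFormOn, fun q hq X => ?_⟩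
  refine (congrArg (fuseLie JG EH₁ EH₂ (b q)) (hA q hq X)).trans ?_
  rw [map_add, map_smul]
  exact congrArg (fun z => _ + fuseLie JG EH₁ EH₂ (b q) z) (hγv q X.1.1).symm

theorem moment (D : IsInternalFusion m S BG BH₁ BH₂ ρ σ Φ A b ρ' σ' Φ')
    (ξ : EG × EH₁ × EH₂) {p : M} (hp : p ∉ S.Z) (w : E) :
    offZ σ' p ![BmFusion.fundField I (JG.prod (J₁.prod J₂)) ρ' ξ p, w]
      = (1 / 2) * (BG.prod (BH₁.prod BH₂)).bil (mcL I (JG.prod (J₁.prod J₂)) Φ' p w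
        + mcR I (JG.prod (J₁.prod J₂)) Φ' p w) ξ := by
  have hΦ := D.qh.mdifferentiableAt hp
  have h1 := D.qh.moment_apply hp (diagLie EG EH₁ EH₂ ξ) w
  have e1 := D.mcL_Φ hp (BmFusion.fundField I ((JG.prod J₁).prod (JG.prod J₂)) ρ
    (diagLie EG EH₁ EH₂ ξ) p)
  have e2 := D.mcR_Φ hp (BmFusion.fundField I ((JG.prod J₁).prod (JG.prod J₂)) ρ
    (diagLie EG EH₁ EH₂ ξ) p)
  have f1 := mcL_fundField D.qh.action.smooth hΦ (fun g => D.qh.equivariant g p hp)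
    (diagLie EG EH₁ EH₂ ξ)
  have f2 := mcR_fundField D.qh.action.smooth hΦ (fun g => D.qh.equivariant g p hp)
    (diagLie EG EH₁ EH₂ ξ)
  rw [AdL_prod, AdL_prod, AdL_prod] at f1 f2
  have g1 : mcL I JG (fun q => (Φ q).1.1) p
      (BmFusion.fundField I ((JG.prod J₁).prod (JG.prod J₂)) ρ (diagLie EG EH₁ EH₂ ξ) p)
      = AdL JG (Φ p).1.1⁻¹ ξ.1 - ξ.1 := congrArg (fun z => z.1.1) (e1.symm.trans f1)
  have g2 : mcR I JG b p
      (BmFusion.fundField I ((JG.prod J₁).prod (JG.prod J₂)) ρ (diagLie EG EH₁ EH₂ ξ) p)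
      = ξ.1 - AdL JG (b p) ξ.1 := by
    rw [← D.b_eq]
    exact congrArg (fun z => z.2.1) (e2.symm.trans f2)
  rw [D.mcL_Φ hp, D.mcR_Φ hp] at h1
  rw [D.mcL_Φ' hp, D.mcR_Φ' hp]
  rw [show (BmFusion.fundField I (JG.prod (J₁.prod J₂)) ρ' ξ p : E) = _ from D.fundField ξ p]
  refine (D.offZ_eq hp _ w).trans ?_
  have s1 := BG.bil_symm ξ.1 (AdL JG (Φ p).1.1 (mcR I JG b p w))
  have s2 := BG.bil_symm ξ.1 (mcR I JG b p w)
  rw [BG.bil_AdL_left] at s1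
  rw [h1, g1, g2]
  simp only [InvariantInner.bil_prod, diagLie, map_add, map_sub,
    add_apply, sub_apply, BG.bil_AdL_left, inv_inv]
  linear_combination (1 / 2) * s1 - (1 / 2) * s2

theorem closed (D : IsInternalFusion m S BG BH₁ BH₂ ρ σ Φ A b ρ' σ' Φ')
    {p : M} (hp : p ∉ S.Z) (u v w : E) :
    extDerivM I (offZ σ') p ![u, v, w]
      = - cartan (BG.prod (BH₁.prod BH₂)) (mcL I (JG.prod (J₁.prod J₂)) Φ' p u)
        (mcL I (JG.prod (J₁.prod J₂)) Φ' p v) (mcL I (JG.prod (J₁.prod J₂)) Φ' p w) := by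
  have hy := mem_extChartAt_target (I := I) p
  have hs : (extChartAt I p).symm (extChartAt I p p) = p := extChartAt_to_inv p
  have hyZ : (extChartAt I p).symm (extChartAt I p p) ∉ S.Z := by rwa [hs]
  have h0 : extDerivM I (offZ σ) p ![u, v, w]
      = - cartan ((BG.prod BH₁).prod (BG.prod BH₂))
        (mcL I ((JG.prod J₁).prod (JG.prod J₂)) Φ p u)
        (mcL I ((JG.prod J₁).prod (JG.prod J₂)) Φ p v)
        (mcL I ((JG.prod J₁).prod (JG.prod J₂)) Φ p w) :=
    (D.qh.closed p hp u v w).trans (congrArg Neg.neg (chi_eq_cartan _ _ _ _ _))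
  have hds : DifferentiableAt ℝ (chartRep I (offZ σ) p) (extChartAt I p p) :=
    (D.qh.smooth_form.1.contDiffAt S.isOpen_compl_Z hy hyZ).differentiableAt (by simp)
  have ca : ContMDiffAt 𝓘(ℝ, E) JG ∞ (fun z => (Φ ((extChartAt I p).symm z)).1.1)
      (extChartAt I p p) :=
    (D.smooth_a.contMDiffAt (S.isOpen_compl_Z.mem_nhds hyZ)).comp _ (contMDiffAt_symm hy)
  have cb : ContMDiffAt 𝓘(ℝ, E) JG ∞ (fun z => b ((extChartAt I p).symm z))
      (extChartAt I p p) := D.smooth_b.contMDiffAt.comp _ (contMDiffAt_symm hy)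
  have va : mcL 𝓘(ℝ, E) JG (fun z => (Φ ((extChartAt I p).symm z)).1.1) (extChartAt I p p)
      = mcL I JG (fun q => (Φ q).1.1) p := by
    rw [mcL_comp_symm (φ := fun q => (Φ q).1.1) hy (D.mdifferentiableAt_a hyZ), dM_symm_self, hs]
    rfl
  have vb : mcR 𝓘(ℝ, E) JG (fun z => b ((extChartAt I p).symm z)) (extChartAt I p p)
      = mcR I JG b p := by
    rw [mcR_comp_symm hy (D.mdifferentiableAt_b _), dM_symm_self, hs]
    rfl
  have hwd := extDeriv_wedgePair BG.bil ((contDiffAt_mcL ca).of_le (by simp))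
    ((contDiffAt_mcR cb).of_le (by simp)) (fderiv_mcL_antisymm ca) (fderiv_mcR_antisymm cb) u v w
  have hwdiff : DifferentiableAt ℝ (fun z => wedgePair BG.bil
      (mcL 𝓘(ℝ, E) JG (fun z => (Φ ((extChartAt I p).symm z)).1.1) z)
      (mcR 𝓘(ℝ, E) JG (fun z => b ((extChartAt I p).symm z)) z)) (extChartAt I p p) := by
    refine ContDiffAt.differentiableAt (n := ∞) (contDiffAt_alternating fun v => ?_) (by simp)
    have h1 := fun v : E => (contDiffAt_mcL ca).clm_apply (contDiffAt_const (c := v))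
    have h2 := fun v : E => (contDiffAt_mcR cb).clm_apply (contDiffAt_const (c := v))
    exact ((contDiffAt_const.clm_apply (h1 (v 0))).clm_apply (h2 (v 1))).sub
      ((contDiffAt_const.clm_apply (h1 (v 1))).clm_apply (h2 (v 0)))
  rw [va, vb] at hwd
  have hsum : extDerivM I (offZ σ') p ![u, v, w] = extDerivM I (offZ σ) p ![u, v, w]
      + (1 / 2) * extDeriv (fun z => wedgePair BG.bil
      (mcL 𝓘(ℝ, E) JG (fun z => (Φ ((extChartAt I p).symm z)).1.1) z)
      (mcR 𝓘(ℝ, E) JG (fun z => b ((extChartAt I p).symm z)) z)) (extChartAt I p p)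
        ![u, v, w] := by
    refine (extDerivM_apply _ _ _).trans ?_
    refine Eq.trans ?_ (congrArg (· + _) (extDerivM_apply (offZ σ) p ![u, v, w]).symm)
    rw [(D.chartRep_offZ hy hyZ).extDeriv_eq]
    exact extDeriv_add_const_smul hds hwdiff _ _
  have hAb : ∀ z, mcL I JG b p z = AdL JG (b p)⁻¹ (mcR I JG b p z) := by
    intro z
    rw [mcR_eq_AdL_comp_mcL (D.mdifferentiableAt_b p)]
    exact (AdL_inv_apply _ _).symm
  rw [hsum, h0, hwd]
  simp only [D.mcL_Φ hp, D.mcL_Φ' hp, cartan_prod, hAb, ← map_add]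
  rw [cartan_AdL, cartan_AdL, cartan_add]
  simp only [map_neg, neg_apply]
  ring

theorem nondegenerate (D : IsInternalFusion m S BG BH₁ BH₂ ρ σ Φ A b ρ' σ' Φ') (hm : 1 ≤ m)
    (p : M) (X : BmTangent m S p) (hX : ∀ Y : BmTangent m S p, σ' p ![X, Y] = 0)
    (hA : fuseLie JG EH₁ EH₂ (b p) (A p X) = 0) : X = 0 := by
  rw [fuseLie_apply] at hA
  have h11 : AdL JG (b p)⁻¹ (A p X).1.1 + (A p X).2.1 = 0 := congrArg (fun z => z.1) hA
  have h12 : (A p X).1.2 = 0 := congrArg (fun z => z.2.1) hA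
  have h22 : (A p X).2.2 = 0 := congrArg (fun z => z.2.2) hA
  have hR : ∀ Y : BmTangent m S p, mcR I JG b p Y.1.1 = AdL JG (b p) (A p Y).2.1 := by
    intro Y
    rw [D.dlog_b, mcR_eq_AdL_comp_mcL (D.mdifferentiableAt_b p)]
    rfl
  have hRX : mcR I JG b p X.1.1 = - (A p X).1.1 := by
    rw [hR, eq_neg_of_add_eq_zero_right h11, map_neg, AdL_apply_inv]
  obtain ⟨Y, hY, hYL⟩ := D.qh.exists_fundamental hm (((A p X).1.1, 0), (0, 0)) p
  have hY0 : (A p Y).2 = 0 := by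
    refine hYL (ContinuousLinearMap.snd ℝ (EG × EH₁) (EG × EH₂)) fun q _ => ?_
    rw [AdL_prod, AdL_prod, AdL_prod]
    simp
  have hXY := hX Y
  rw [D.form_eq, two_form_swap, hY X, hRX, hR Y, hY0] at hXY
  simp only [InvariantInner.bil_prod, h12, h22, hY0, map_neg, map_zero, Prod.fst_zero,
    zero_apply] at hXY
  have hζ : (A p X).1.1 = 0 := by
    refine BG.eq_zero_of_bil ?_
    have := BG.bil_symm (A p X).1.1 (A p Y).1.1
    linarith
  have h21 : (A p X).2.1 = 0 := by
    rw [hζ, map_zero, zero_add] at h11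
    exact h11
  refine D.qh.nondegenerate p X (fun Z => ?_)
    (Prod.ext (Prod.ext hζ h12) (Prod.ext h21 h22))
  have hXZ := hX Z
  rw [D.form_eq, hRX, hζ] at hXZ
  simpa using hXZ

/-- Internal fusion of a singular quasi-Hamiltonian space. -/
theorem isBmQuasiHamiltonian (D : IsInternalFusion m S BG BH₁ BH₂ ρ σ Φ A b ρ' σ' Φ')
    (hm : 1 ≤ m) :
    IsBmQuasiHamiltonian I (JG.prod (J₁.prod J₂)) m S (BG.prod (BH₁.prod BH₂)) ρ' σ' Φ'
      (fun p => (fuseLie JG EH₁ EH₂ (b p)).comp (A p)) where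
  action := D.action
  smooth_form := D.smooth_form
  invariant k p hp u v := D.invariant k hp u v
  smooth_map := D.smooth_map
  dlog_eq p hp X := by
    refine Eq.trans ?_ (D.mcL_Φ' hp X.1.1).symm
    refine (congrArg (fuseLie JG EH₁ EH₂ (b p))
      ((D.qh.dlog_apply hp X).trans (D.mcL_Φ hp X.1.1))).trans ?_
    rw [fuseLie_apply]
  dlog_smooth := D.dlog_smooth
  equivariant k p hp := D.equivariant k hp
  closed p hp u v w := (D.closed hp u v w).trans (congrArg Neg.neg (chi_eq_cartan _ _ _ _ _).symm)
  moment ξ p hp w := D.moment ξ hp w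
  nondegenerate p X hX hA := D.nondegenerate hm p X hX hA

end IsInternalFusion

end InternalFusion

section ProductForms

variable {E : Type*} [NormedAddCommGroup E] [NormedSpace ℝ E] [FiniteDimensional ℝ E]
  {H : Type*} [TopologicalSpace H]
  {I : ModelWithCorners ℝ E H} [I.Boundaryless] {M : Type*} [TopologicalSpace M] [ChartedSpace H M]
  [IsManifold I ∞ M]
  {E' : Type*} [NormedAddCommGroup E'] [NormedSpace ℝ E'] [FiniteDimensional ℝ E']
  {H' : Type*} [TopologicalSpace H']
  {I' : ModelWithCorners ℝ E' H'} [I'.Boundaryless] {M' : Type*} [TopologicalSpace M']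
  [ChartedSpace H' M'] [IsManifold I' ∞ M']
  {F : Type*} [NormedAddCommGroup F] [NormedSpace ℝ F] {k : ℕ}

theorem dM_prodMap {D D' : Type*} [NormedAddCommGroup D] [NormedSpace ℝ D]
    [NormedAddCommGroup D'] [NormedSpace ℝ D'] {HN HN' : Type*} [TopologicalSpace HN]
    [TopologicalSpace HN'] {J : ModelWithCorners ℝ D HN} {J' : ModelWithCorners ℝ D' HN'}
    {N N' : Type*} [TopologicalSpace N] [ChartedSpace HN N] [TopologicalSpace N']
    [ChartedSpace HN' N'] {f : N → M} {g : N' → M'} {z : N × N'}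
    (hf : MDifferentiableAt J I f z.1) (hg : MDifferentiableAt J' I' g z.2) (v : D × D') :
    dM (J.prod J') (I.prod I') (fun z => (f z.1, g z.2)) z v
      = (dM J I f z.1 v.1, dM J' I' g z.2 v.2) := by
  have h := mfderiv_prodMap (p := z) hf hg
  exact congrArg (fun L : D × D' →L[ℝ] E × E' => L v) h

theorem mem_target_prod {z₀ : M × M'} {y : E × E'} :
    y ∈ (extChartAt (I.prod I') z₀).target ↔
      y.1 ∈ (extChartAt I z₀.1).target ∧ y.2 ∈ (extChartAt I' z₀.2).target := by
  rw [extChartAt_prod]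
  exact Iff.rfl

theorem extChartAt_prod_symm (z₀ : M × M') :
    ((extChartAt (I.prod I') z₀).symm : E × E' → M × M')
      = fun y => ((extChartAt I z₀.1).symm y.1, (extChartAt I' z₀.2).symm y.2) := by
  rw [extChartAt_prod]
  rfl

theorem extChartAt_prod_apply (z₀ z : M × M') :
    extChartAt (I.prod I') z₀ z = (extChartAt I z₀.1 z.1, extChartAt I' z₀.2 z.2) := by
  rw [extChartAt_prod]
  rfl

theorem dM_symm_prod {z₀ : M × M'} {y : E × E'} (hy : y ∈ (extChartAt (I.prod I') z₀).target)
    (v : E × E') : dM 𝓘(ℝ, E × E') (I.prod I') (extChartAt (I.prod I') z₀).symm y v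
      = (dM 𝓘(ℝ, E) I (extChartAt I z₀.1).symm y.1 v.1,
        dM 𝓘(ℝ, E') I' (extChartAt I' z₀.2).symm y.2 v.2) := by
  rw [mem_target_prod] at hy
  rw [extChartAt_prod_symm, modelWithCornersSelf_prod, ← chartedSpaceSelf_prod]
  exact dM_prodMap ((contMDiffAt_symm hy.1).mdifferentiableAt (by simp))
    ((contMDiffAt_symm hy.2).mdifferentiableAt (by simp)) v

variable (I') in
/-- The pullback of a form on the first factor. -/
noncomputable def pullFst (η : ∀ x : M, TangentSpace I x [⋀^Fin k]→L[ℝ] F) (z : M × M') :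
    TangentSpace (I.prod I') z [⋀^Fin k]→L[ℝ] F :=
  (η z.1).compContinuousLinearMap (ContinuousLinearMap.fst ℝ E E')

variable (I) in
/-- The pullback of a form on the second factor. -/
noncomputable def pullSnd (η : ∀ x : M', TangentSpace I' x [⋀^Fin k]→L[ℝ] F) (z : M × M') :
    TangentSpace (I.prod I') z [⋀^Fin k]→L[ℝ] F :=
  (η z.2).compContinuousLinearMap (ContinuousLinearMap.snd ℝ E E')

theorem pullFst_two (η : ∀ x : M, TangentSpace I x [⋀^Fin 2]→L[ℝ] F) (z : M × M')
    (u v : E × E') : pullFst I' η z ![u, v] = η z.1 ![u.1, v.1] := by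
  refine congrArg (η z.1) ?_
  funext i
  fin_cases i <;> rfl

theorem pullSnd_two (η : ∀ x : M', TangentSpace I' x [⋀^Fin 2]→L[ℝ] F) (z : M × M')
    (u v : E × E') : pullSnd I η z ![u, v] = η z.2 ![u.2, v.2] := by
  refine congrArg (η z.2) ?_
  funext i
  fin_cases i <;> rfl

theorem pullFst_one (η : ∀ x : M, TangentSpace I x [⋀^Fin 1]→L[ℝ] F) (z : M × M')
    (u : E × E') : pullFst I' η z ![u] = η z.1 ![u.1] := by
  refine congrArg (η z.1) ?_
  funext i
  fin_cases i
  rfl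

theorem chartRep_pullFst (η : ∀ x : M, TangentSpace I x [⋀^Fin k]→L[ℝ] F) {z₀ : M × M'}
    {y : E × E'} (hy : y ∈ (extChartAt (I.prod I') z₀).target) :
    chartRep (I.prod I') (pullFst I' η) z₀ y
      = (chartRep I η z₀.1 y.1).compContinuousLinearMap (ContinuousLinearMap.fst ℝ E E') := by
  refine ContinuousAlternatingMap.ext fun v => ?_
  refine (chartRep_apply _ _ _ _).trans ?_
  simp only [dM_symm_prod hy]
  rw [extChartAt_prod_symm]
  rfl

theorem chartRep_pullSnd (η : ∀ x : M', TangentSpace I' x [⋀^Fin k]→L[ℝ] F) {z₀ : M × M'}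
    {y : E × E'} (hy : y ∈ (extChartAt (I.prod I') z₀).target) :
    chartRep (I.prod I') (pullSnd I η) z₀ y
      = (chartRep I' η z₀.2 y.2).compContinuousLinearMap (ContinuousLinearMap.snd ℝ E E') := by
  refine ContinuousAlternatingMap.ext fun v => ?_
  refine (chartRep_apply _ _ _ _).trans ?_
  simp only [dM_symm_prod hy]
  rw [extChartAt_prod_symm]
  rfl

theorem contDiffAt_chartRep_pullFst {η : ∀ x : M, TangentSpace I x [⋀^Fin k]→L[ℝ] F} {V : Set M}
    (h : SmoothFormOn I η V) (hV : IsOpen V) {z₀ : M × M'} {y : E × E'}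
    (hy : y ∈ (extChartAt (I.prod I') z₀).target)
    (hyV : ((extChartAt (I.prod I') z₀).symm y).1 ∈ V) :
    ContDiffAt ℝ ∞ (chartRep (I.prod I') (pullFst I' η) z₀) y := by
  rw [extChartAt_prod_symm] at hyV
  have h1 : ContDiffAt ℝ ∞ (fun y : E × E' => chartRep I η z₀.1 y.1) y :=
    ContDiffAt.comp y (h.contDiffAt hV (mem_target_prod.1 hy).1 hyV) contDiffAt_fst
  refine ((ContinuousAlternatingMap.compContinuousLinearMapCLM
    (ContinuousLinearMap.fst ℝ E E')).contDiff.contDiffAt.comp y h1).congr_of_eventuallyEq ?_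
  filter_upwards [target_mem_nhds hy] with z hz
  exact chartRep_pullFst η hz

theorem contDiffAt_chartRep_pullSnd {η : ∀ x : M', TangentSpace I' x [⋀^Fin k]→L[ℝ] F}
    {V : Set M'} (h : SmoothFormOn I' η V) (hV : IsOpen V) {z₀ : M × M'} {y : E × E'}
    (hy : y ∈ (extChartAt (I.prod I') z₀).target)
    (hyV : ((extChartAt (I.prod I') z₀).symm y).2 ∈ V) :
    ContDiffAt ℝ ∞ (chartRep (I.prod I') (pullSnd I η) z₀) y := by
  rw [extChartAt_prod_symm] at hyV
  have h1 : ContDiffAt ℝ ∞ (fun y : E × E' => chartRep I' η z₀.2 y.2) y :=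
    ContDiffAt.comp y (h.contDiffAt hV (mem_target_prod.1 hy).2 hyV) contDiffAt_snd
  refine ((ContinuousAlternatingMap.compContinuousLinearMapCLM
    (ContinuousLinearMap.snd ℝ E E')).contDiff.contDiffAt.comp y h1).congr_of_eventuallyEq ?_
  filter_upwards [target_mem_nhds hy] with z hz
  exact chartRep_pullSnd η hz

theorem SmoothFormOn.pullFst {η : ∀ x : M, TangentSpace I x [⋀^Fin k]→L[ℝ] F} {V : Set M}
    (h : SmoothFormOn I η V) (hV : IsOpen V) :
    SmoothFormOn (I.prod I') (BmFusion.pullFst I' (M' := M') η) (Prod.fst ⁻¹' V) :=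
  fun _ _ hy => (contDiffAt_chartRep_pullFst h hV hy.1 hy.2).contDiffWithinAt

theorem SmoothFormOn.pullSnd {η : ∀ x : M', TangentSpace I' x [⋀^Fin k]→L[ℝ] F} {V : Set M'}
    (h : SmoothFormOn I' η V) (hV : IsOpen V) :
    SmoothFormOn (I.prod I') (BmFusion.pullSnd I (M := M) η) (Prod.snd ⁻¹' V) :=
  fun _ _ hy => (contDiffAt_chartRep_pullSnd h hV hy.1 hy.2).contDiffWithinAt

theorem extDerivM_pullFst {η : ∀ x : M, TangentSpace I x [⋀^Fin k]→L[ℝ] F} {V : Set M}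
    (h : SmoothFormOn I η V) (hV : IsOpen V) {z : M × M'} (hz : z.1 ∈ V)
    (v : Fin (k + 1) → E × E') :
    extDeriv (chartRep (I.prod I') (pullFst I' η) z) (extChartAt (I.prod I') z z) v
      = extDerivM I η z.1 (fun i => (v i).1) := by
  have hy := mem_extChartAt_target (I := I.prod I') z
  have e : chartRep (I.prod I') (pullFst I' η) z =ᶠ[𝓝 (extChartAt (I.prod I') z z)]
      fun y => (chartRep I η z.1 (ContinuousLinearMap.fst ℝ E E' y)).compContinuousLinearMap
        (ContinuousLinearMap.fst ℝ E E') := by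
    filter_upwards [target_mem_nhds hy] with y hy using chartRep_pullFst η hy
  have hd : DifferentiableAt ℝ (chartRep I η z.1) (extChartAt I z.1 z.1) :=
    (h.contDiffAt hV (mem_extChartAt_target z.1)
      (by rwa [extChartAt_to_inv])).differentiableAt (by simp)
  rw [e.extDeriv_eq, extChartAt_prod_apply,
    extDeriv_comp_clm (x := (extChartAt I z.1 z.1, extChartAt I' z.2 z.2)) _ hd]
  exact (extDerivM_apply η z.1 _).symm

theorem extDerivM_pullSnd {η : ∀ x : M', TangentSpace I' x [⋀^Fin k]→L[ℝ] F} {V : Set M'}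
    (h : SmoothFormOn I' η V) (hV : IsOpen V) {z : M × M'} (hz : z.2 ∈ V)
    (v : Fin (k + 1) → E × E') :
    extDeriv (chartRep (I.prod I') (pullSnd I η) z) (extChartAt (I.prod I') z z) v
      = extDerivM I' η z.2 (fun i => (v i).2) := by
  have hy := mem_extChartAt_target (I := I.prod I') z
  have e : chartRep (I.prod I') (pullSnd I η) z =ᶠ[𝓝 (extChartAt (I.prod I') z z)]
      fun y => (chartRep I' η z.2 (ContinuousLinearMap.snd ℝ E E' y)).compContinuousLinearMap
        (ContinuousLinearMap.snd ℝ E E') := by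
    filter_upwards [target_mem_nhds hy] with y hy using chartRep_pullSnd η hy
  have hd : DifferentiableAt ℝ (chartRep I' η z.2) (extChartAt I' z.2 z.2) :=
    (h.contDiffAt hV (mem_extChartAt_target z.2)
      (by rwa [extChartAt_to_inv])).differentiableAt (by simp)
  rw [e.extDeriv_eq, extChartAt_prod_apply,
    extDeriv_comp_clm (x := (extChartAt I z.1 z.1, extChartAt I' z.2 z.2)) _ hd]
  exact (extDerivM_apply η z.2 _).symm

theorem SmoothOneForm.pullFst {α : M → E →L[ℝ] F} {V : Set M} (h : SmoothOneForm I α V) :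
    SmoothOneForm (I.prod I') (fun z : M × M' => (α z.1).comp (ContinuousLinearMap.fst ℝ E E'))
      (Prod.fst ⁻¹' V) := by
  intro z₀ y hy hyV
  have hyV' : ((extChartAt (I.prod I') z₀).symm y).1 ∈ V := hyV
  rw [extChartAt_prod_symm] at hyV'
  have h1 := ContDiffAt.comp y (h z₀.1 y.1 (mem_target_prod.1 hy).1 hyV')
    (contDiffAt_fst (p := y))
  refine (h1.clm_comp (contDiffAt_const
    (c := ContinuousLinearMap.fst ℝ E E'))).congr_of_eventuallyEq ?_
  filter_upwards [target_mem_nhds hy] with z hz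
  refine ContinuousLinearMap.ext fun v => ?_
  have := dM_symm_prod hz v
  rw [extChartAt_prod_symm] at this ⊢
  exact congrArg (fun w : E × E' => α ((extChartAt I z₀.1).symm z.1) w.1) this

theorem SmoothOneForm.pullSnd {α : M' → E' →L[ℝ] F} {V : Set M'} (h : SmoothOneForm I' α V) :
    SmoothOneForm (I.prod I') (fun z : M × M' => (α z.2).comp (ContinuousLinearMap.snd ℝ E E'))
      (Prod.snd ⁻¹' V) := by
  intro z₀ y hy hyV
  have hyV' : ((extChartAt (I.prod I') z₀).symm y).2 ∈ V := hyV
  rw [extChartAt_prod_symm] at hyV'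
  have h1 := ContDiffAt.comp y (h z₀.2 y.2 (mem_target_prod.1 hy).2 hyV')
    (contDiffAt_snd (p := y))
  refine (h1.clm_comp (contDiffAt_const
    (c := ContinuousLinearMap.snd ℝ E E'))).congr_of_eventuallyEq ?_
  filter_upwards [target_mem_nhds hy] with z hz
  refine ContinuousLinearMap.ext fun v => ?_
  have := dM_symm_prod hz v
  rw [extChartAt_prod_symm] at this ⊢
  exact congrArg (fun w : E × E' => α ((extChartAt I' z₀.2).symm z.2) w.2) this

theorem SmoothOneForm.prod {D : Type*} [NormedAddCommGroup D] [NormedSpace ℝ D]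
    {α : M → E →L[ℝ] F} {β : M → E →L[ℝ] D} {V : Set M} (hα : SmoothOneForm I α V)
    (hβ : SmoothOneForm I β V) : SmoothOneForm I (fun q => (α q).prod (β q)) V :=
  fun x₀ y hy hyV => contDiffAt_clm fun _ =>
    ((hα x₀ y hy hyV).clm_apply contDiffAt_const).prodMk
      ((hβ x₀ y hy hyV).clm_apply contDiffAt_const)

theorem mcL_prodMap
    {EK : Type*} [NormedAddCommGroup EK] [NormedSpace ℝ EK]
    {HK : Type*} [TopologicalSpace HK] {J : ModelWithCorners ℝ EK HK}
    {K : Type*} [TopologicalSpace K] [ChartedSpace HK K] [Group K] [LieGroup J ∞ K]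
    {EK' : Type*} [NormedAddCommGroup EK'] [NormedSpace ℝ EK']
    {HK' : Type*} [TopologicalSpace HK'] {J' : ModelWithCorners ℝ EK' HK'}
    {K' : Type*} [TopologicalSpace K'] [ChartedSpace HK' K'] [Group K'] [LieGroup J' ∞ K']
    {φ : M → K} {ψ : M' → K'} {z : M × M'} (hφ : MDifferentiableAt I J φ z.1)
    (hψ : MDifferentiableAt I' J' ψ z.2) (v : E × E') :
    mcL (I.prod I') (J.prod J') (Prod.map φ ψ) z v
      = (mcL I J φ z.1 v.1, mcL I' J' ψ z.2 v.2) := by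
  have h1 : MDifferentiableAt (I.prod I') J (fun z : M × M' => φ z.1) z :=
    MDifferentiableAt.comp (I' := I) z hφ mdifferentiableAt_fst
  have h2 : MDifferentiableAt (I.prod I') J' (fun z : M × M' => ψ z.2) z :=
    MDifferentiableAt.comp (I' := I') z hψ mdifferentiableAt_snd
  refine (congrArg (fun L : E × E' →L[ℝ] EK × EK' => L v) (mcL_prodMk h1 h2)).trans ?_
  rw [mcL_comp (I' := I) (f := Prod.fst) hφ mdifferentiableAt_fst,
    mcL_comp (I' := I') (f := Prod.snd) hψ mdifferentiableAt_snd, dM_fst, dM_snd]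
  rfl

theorem mcR_prodMap
    {EK : Type*} [NormedAddCommGroup EK] [NormedSpace ℝ EK]
    {HK : Type*} [TopologicalSpace HK] {J : ModelWithCorners ℝ EK HK}
    {K : Type*} [TopologicalSpace K] [ChartedSpace HK K] [Group K] [LieGroup J ∞ K]
    {EK' : Type*} [NormedAddCommGroup EK'] [NormedSpace ℝ EK']
    {HK' : Type*} [TopologicalSpace HK'] {J' : ModelWithCorners ℝ EK' HK'}
    {K' : Type*} [TopologicalSpace K'] [ChartedSpace HK' K'] [Group K'] [LieGroup J' ∞ K']
    {φ : M → K} {ψ : M' → K'} {z : M × M'} (hφ : MDifferentiableAt I J φ z.1)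
    (hψ : MDifferentiableAt I' J' ψ z.2) (v : E × E') :
    mcR (I.prod I') (J.prod J') (Prod.map φ ψ) z v
      = (mcR I J φ z.1 v.1, mcR I' J' ψ z.2 v.2) := by
  have h1 : MDifferentiableAt (I.prod I') J (fun z : M × M' => φ z.1) z :=
    MDifferentiableAt.comp (I' := I) z hφ mdifferentiableAt_fst
  have h2 : MDifferentiableAt (I.prod I') J' (fun z : M × M' => ψ z.2) z :=
    MDifferentiableAt.comp (I' := I') z hψ mdifferentiableAt_snd
  refine (congrArg (fun L : E × E' →L[ℝ] EK × EK' => L v) (mcR_prodMk h1 h2)).trans ?_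
  rw [mcR_comp (I' := I) (f := Prod.fst) hφ mdifferentiableAt_fst,
    mcR_comp (I' := I') (f := Prod.snd) hψ mdifferentiableAt_snd, dM_fst, dM_snd]
  rfl

end ProductForms

section ProductSpaces

variable {E : Type*} [NormedAddCommGroup E] [NormedSpace ℝ E] [FiniteDimensional ℝ E]
  {H : Type*} [TopologicalSpace H]
  {I : ModelWithCorners ℝ E H} [I.Boundaryless] {M : Type*} [TopologicalSpace M] [ChartedSpace H M]
  [IsManifold I ∞ M]
  {E' : Type*} [NormedAddCommGroup E'] [NormedSpace ℝ E'] [FiniteDimensional ℝ E']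
  {H' : Type*} [TopologicalSpace H']
  {I' : ModelWithCorners ℝ E' H'} [I'.Boundaryless] {M' : Type*} [TopologicalSpace M']
  [ChartedSpace H' M'] [IsManifold I' ∞ M']
  {EK : Type*} [NormedAddCommGroup EK] [NormedSpace ℝ EK] [FiniteDimensional ℝ EK]
  {HK : Type*} [TopologicalSpace HK] {J : ModelWithCorners ℝ EK HK} [J.Boundaryless]
  {K : Type*} [TopologicalSpace K] [ChartedSpace HK K] [Group K] [LieGroup J ∞ K]
  {EK' : Type*} [NormedAddCommGroup EK'] [NormedSpace ℝ EK'] [FiniteDimensional ℝ EK']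
  {HK' : Type*} [TopologicalSpace HK'] {J' : ModelWithCorners ℝ EK' HK'} [J'.Boundaryless]
  {K' : Type*} [TopologicalSpace K'] [ChartedSpace HK' K'] [Group K'] [LieGroup J' ∞ K']
  {m : ℕ} {S : BManifold I M} {B : InvariantInner J K} {B' : InvariantInner J' K'}
  {ρ : MulAction K M} {σ : ∀ p : M, BmTangent m S p [⋀^Fin 2]→L[ℝ] ℝ} {Φ : M → K}
  {A : ∀ p : M, BmTangent m S p →L[ℝ] EK}
  {ρ' : MulAction K' M'} {σ' : ∀ q : M', TangentSpace I' q [⋀^Fin 2]→L[ℝ] ℝ} {Φ' : M' → K'}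

theorem eq_zero_of_mcL_eq_zero {φ : M → K} {p : M} {u : E} (h : mcL I J φ p u = 0) :
    dM I J φ p u = 0 := by
  have h1 : dM J J (fun h : K => (φ p)⁻¹ * h) (φ p) (dM I J φ p u) = 0 := h
  have h2 : (dM J J (fun h : K => φ p * h) ((φ p)⁻¹ * φ p)).comp
      (dM J J (fun h : K => (φ p)⁻¹ * h) (φ p)) = ContinuousLinearMap.id ℝ EK := by
    rw [← dM_comp (g := fun h : K => φ p * h) (mdifferentiableAt_mul_left _ _)
      (mdifferentiableAt_mul_left _ _)]
    simp only [mul_inv_cancel_left]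
    exact dM_id _
  have h3 := congrArg (fun L : EK →L[ℝ] EK => L (dM I J φ p u)) h2
  simpa [h1] using h3.symm

theorem dM_act_prod (hρ : IsSmoothAction I J ρ) (hρ' : IsSmoothAction I' J' ρ') (k : K × K')
    (z : M × M') (v : E × E') :
    dM (I.prod I') (I.prod I') (act (prodAction ρ ρ') k) z v
      = (dM I I (act ρ k.1) z.1 v.1, dM I' I' (act ρ' k.2) z.2 v.2) :=
  dM_prodMap ((hρ.contMDiff_act k.1).mdifferentiableAt (by simp))
    ((hρ'.contMDiff_act k.2).mdifferentiableAt (by simp)) v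

theorem fundField_prod (hρ : IsSmoothAction I J ρ) (hρ' : IsSmoothAction I' J' ρ')
    (ξ : EK × EK') (z : M × M') :
    (fundField (I.prod I') (J.prod J') (prodAction ρ ρ') ξ z : E × E')
      = (fundField I J ρ ξ.1 z.1, fundField I' J' ρ' ξ.2 z.2) :=
  dM_prodMap (f := fun k : K => act ρ k z.1) (g := fun k : K' => act ρ' k z.2) (z := (1 : K × K'))
    ((hρ.contMDiff_orbit z.1).mdifferentiableAt (by simp))
    ((hρ'.contMDiff_orbit z.2).mdifferentiableAt (by simp)) ξ

theorem df_prod (z : M × M') (v : E × E') : (S.prod I' M').df z v = S.df z.1 v.1 :=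
  df_comp_fst S.f z v

theorem isBmAction_prod (h : IsBmAction I J m S ρ) (h' : IsSmoothAction I' J' ρ') :
    IsBmAction (I.prod I') (J.prod J') m (S.prod I' M') (prodAction ρ ρ') where
  smooth := (h.smooth.comp ((contMDiff_fst.comp contMDiff_fst).prodMk
      (contMDiff_fst.comp contMDiff_snd))).prodMk
    (h'.comp ((contMDiff_snd.comp contMDiff_fst).prodMk (contMDiff_snd.comp contMDiff_snd)))
  map_Z k z := h.map_Z k.1 z.1
  map_bm k z hz := by
    obtain ⟨W, hW, hzW, a, β, ha, hβ, hdf⟩ := h.map_bm k.1 z.1 hz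
    refine ⟨Prod.fst ⁻¹' W, hW.preimage continuous_fst, hzW, fun z => a z.1, pullFst I' β,
      ha.comp contMDiffOn_fst fun _ h => h, hβ.pullFst hW, fun q hq X => ?_⟩
    refine (df_prod _ _).trans ?_
    refine (congrArg (fun v : E × E' => S.df (act ρ k.1 q.1) v.1)
      (dM_act_prod h.smooth h' k q X.1.1)).trans ?_
    refine (hdf q.1 hq (bmFst m S q X)).trans ?_
    exact congrArg (fun t => S.f (act ρ k.1 q.1) ^ m * (a q.1 * X.1.2 + t))
      (pullFst_one β q X.1.1).symm
  fund_bm ξ := by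
    obtain ⟨c, hc, hcv⟩ := h.fund_bm ξ.1
    refine ⟨fun z => c z.1, hc.comp contMDiffOn_fst fun _ h => h, fun q hq => ?_⟩
    refine (df_prod _ _).trans ?_
    refine (congrArg (fun v : E × E' => S.df q.1 v.1)
      (fundField_prod h.smooth h' ξ q)).trans ?_
    exact hcv q.1 hq

theorem prodForm_apply (z : M × M') (X Y : BmTangent m (S.prod I' M') z) :
    prodForm σ σ' z ![X, Y] = σ z.1 ![bmFst m S z X, bmFst m S z Y]
      + σ' z.2 ![bmSnd m S z X, bmSnd m S z Y] := by
  have h1 : (fun i => bmFst m S z ((![X, Y] : Fin 2 → _) i)) = ![bmFst m S z X, bmFst m S z Y] := by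
    funext i
    fin_cases i <;> rfl
  have h2 : (fun i => bmSnd m S z ((![X, Y] : Fin 2 → _) i)) = ![bmSnd m S z X, bmSnd m S z Y] := by
    funext i
    fin_cases i <;> rfl
  rw [← h1, ← h2]
  rfl

theorem bmFst_toBm {z : M × M'} (hz : z.1 ∉ S.Z) (v : E × E') :
    bmFst m S z (toBm m (S.prod I' M') z v) = toBm m S z.1 v.1 := by
  rw [← toBm_self hz (bmFst m S z (toBm m (S.prod I' M') z v))]
  refine congrArg (toBm m S z.1) ?_
  exact congrArg Prod.fst (toBm_val (S := S.prod I' M') (p := z) hz v)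

theorem bmSnd_toBm {z : M × M'} (hz : z.1 ∉ S.Z) (v : E × E') :
    bmSnd m S z (toBm m (S.prod I' M') z v) = v.2 :=
  congrArg Prod.snd (toBm_val (S := S.prod I' M') (p := z) hz v)

theorem offZ_prodForm {z : M × M'} (hz : z.1 ∉ S.Z) (u v : E × E') :
    offZ (prodForm σ σ') z ![u, v] = offZ σ z.1 ![u.1, v.1] + σ' z.2 ![u.2, v.2] := by
  refine (offZ_apply _ z u v).trans ((prodForm_apply z _ _).trans ?_)
  rw [bmFst_toBm hz, bmFst_toBm hz, bmSnd_toBm hz, bmSnd_toBm hz]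
  exact congrArg (· + _) (offZ_apply σ z.1 u.1 v.1).symm

theorem offZ_prodForm_eq {z : M × M'} (hz : z.1 ∉ S.Z) :
    offZ (prodForm σ σ') z = pullFst I' (offZ σ) z + pullSnd I σ' z := by
  refine ContinuousAlternatingMap.ext fun v => ?_
  have hv : v = ![v 0, v 1] := by
    funext i
    fin_cases i <;> rfl
  rw [hv]
  refine (offZ_prodForm hz _ _).trans ?_
  exact congrArg₂ (· + ·) (pullFst_two _ z _ _).symm (pullSnd_two _ z _ _).symm

/-- The form `(Φ, Φ')^* θˡ` on the product. -/
noncomputable def prodLog (J' : ModelWithCorners ℝ EK' HK')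
    (A : ∀ p : M, BmTangent m S p →L[ℝ] EK) (Φ' : M' → K') (z : M × M') :
    BmTangent m (S.prod I' M') z →L[ℝ] EK × EK' :=
  ((A z.1).comp (bmFst m S z)).prod ((mcL I' J' Φ' z.2).comp (bmSnd m S z))

theorem chartRep_offZ_prodForm {z₀ : M × M'} {y : E × E'}
    (hy : y ∈ (extChartAt (I.prod I') z₀).target)
    (hyZ : (extChartAt (I.prod I') z₀).symm y ∉ (S.prod I' M').Z) :
    chartRep (I.prod I') (offZ (prodForm σ σ')) z₀ =ᶠ[𝓝 y]
      fun y => chartRep (I.prod I') (pullFst I' (offZ σ)) z₀ y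
        + chartRep (I.prod I') (pullSnd I σ') z₀ y := by
  filter_upwards [preimage_mem_nhds_chart (S.prod I' M').isOpen_compl_Z hy hyZ] with w hw
  have h := offZ_prodForm_eq (σ := σ) (σ' := σ') (z := (extChartAt (I.prod I') z₀).symm w) hw.2
  simp only [chartRep]
  rw [h]
  rfl

theorem isBmTwoForm_prod (h : IsBmTwoForm σ) (h' : SmoothFormOn I' σ' univ) :
    IsBmTwoForm (prodForm σ σ') := by
  refine ⟨fun z₀ y hy => ?_, fun z hz => ?_⟩
  · refine ContDiffAt.contDiffWithinAt ?_
    refine ContDiffAt.congr_of_eventuallyEq ?_ (chartRep_offZ_prodForm hy.1 hy.2)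
    exact (contDiffAt_chartRep_pullFst h.1 S.isOpen_compl_Z hy.1 hy.2).add
      (contDiffAt_chartRep_pullSnd h' isOpen_univ hy.1 (mem_univ _))
  · obtain ⟨W, hW, hzW, α, β, hα, hβ, hσ⟩ := h.2 z.1 hz
    refine ⟨Prod.fst ⁻¹' W, hW.preimage continuous_fst, hzW, pullFst I' α,
      fun z => pullFst I' β z + pullSnd I σ' z, hα.pullFst hW,
      fun z₀ => (hβ.pullFst hW z₀).add
        (((h'.pullSnd isOpen_univ).mono fun _ _ => mem_univ _) z₀),
      fun q hq X Y => ?_⟩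
    refine (prodForm_apply q X Y).trans ?_
    rw [hσ q.1 hq]
    have e1 := pullFst_one (I' := I') α q X.1.1
    have e2 := pullFst_one (I' := I') α q Y.1.1
    have e3 := pullFst_two (I' := I') β q X.1.1 Y.1.1
    have e4 := pullSnd_two (I := I) σ' q X.1.1 Y.1.1
    refine Eq.trans ?_ (congrArg₂ (fun (s t : ℝ) => s + t)
      (congrArg₂ (fun (s t : ℝ) => X.1.2 * s - Y.1.2 * t) e2 e1)
      (congrArg₂ (fun (s t : ℝ) => s + t) e3 e4)).symm
    exact add_assoc _ _ _

theorem IsQuasiHamiltonian.mdifferentiableAt (h : IsQuasiHamiltonian I' J' B' ρ' σ' Φ') (q : M') :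
    MDifferentiableAt I' J' Φ' q := h.smooth_map.mdifferentiableAt (by simp)

theorem isBmOneFormNearZ_prodLog (h : IsBmOneFormNearZ A) (h' : ContMDiff I' J' ∞ Φ') :
    IsBmOneFormNearZ (prodLog (I' := I') J' A Φ') := by
  intro z hz
  obtain ⟨W, hW, hzW, a, γ, ha, hγ, hA⟩ := h z.1 hz
  let γ' : M → E →L[ℝ] EK := fun q =>
    (ContinuousAlternatingMap.ofSubsingleton ℝ E EK (0 : Fin 1)).symm (γ q)
  have hγv : ∀ q (v : E), γ' q v = γ q ![v] := by
    intro q v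
    refine congrArg (γ q) ?_
    funext i
    fin_cases i
    rfl
  have h1 : SmoothOneForm I γ' W := hγ.smoothOneForm hW fun q _ v => hγv q v
  have h2 : SmoothOneForm I' (mcL I' J' Φ') univ := smoothOneForm_mcL h'.contMDiffOn isOpen_univ
  refine ⟨Prod.fst ⁻¹' W, hW.preimage continuous_fst, hzW, fun z => (a z.1, 0),
    oneForm fun z => ((γ' z.1).comp (ContinuousLinearMap.fst ℝ E E')).prod
      ((mcL I' J' Φ' z.2).comp (ContinuousLinearMap.snd ℝ E E')),
    (ha.comp contMDiffOn_fst fun _ h => h).prodMk_space contMDiffOn_const,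
    (h1.pullFst.prod (h2.pullSnd.mono fun _ _ => mem_univ _)).smoothFormOn, fun q hq X => ?_⟩
  refine Prod.ext ?_ ?_
  · refine (hA q.1 hq (bmFst m S q X)).trans ?_
    exact congrArg (fun t => X.1.2 • a q.1 + t) (hγv q.1 (bmFst m S q X).1.1).symm
  · change mcL I' J' Φ' q.2 (bmSnd m S q X) = X.1.2 • (0 : EK') + mcL I' J' Φ' q.2 (bmSnd m S q X)
    rw [smul_zero, zero_add]

theorem nondegenerate_prod
    (h : ∀ (p : M) (X : BmTangent m S p), (∀ Y, σ p ![X, Y] = 0) → A p X = 0 → X = 0)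
    (h' : ∀ (q : M') (u : E'), (∀ w : E', σ' q ![u, w] = 0) → dM I' J' Φ' q u = 0 → u = 0)
    (z : M × M') (X : BmTangent m (S.prod I' M') z)
    (hX : ∀ Y : BmTangent m (S.prod I' M') z, prodForm σ σ' z ![X, Y] = 0)
    (hA : prodLog J' A Φ' z X = 0) : X = 0 := by
  have hdf : ∀ v : E × E', (S.prod I' M').df z v = S.df z.1 v.1 := df_prod z
  have hz1 : ∀ x : E' , σ' z.2 ![x, (0 : E')] = 0 := fun x =>
    (σ' z.2).map_coord_zero (m := ![x, (0 : E')]) 1 rfl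
  have hz2 : ∀ x, σ z.1 ![x, 0] = 0 := fun x => (σ z.1).map_coord_zero (m := ![x, 0]) 1 rfl
  have h1 : bmFst m S z X = 0 := by
    refine h z.1 _ (fun Y => ?_) (congrArg Prod.fst hA)
    let Y' : BmTangent m (S.prod I' M') z := ⟨(((Y.1.1, 0) : E × E'), Y.1.2),
      mem_BmTangent.2 ((hdf _).trans (mem_BmTangent.1 Y.2))⟩
    have hY := hX Y'
    rw [prodForm_apply] at hY
    exact (add_eq_left.2 (hz1 (bmSnd m S z X))).symm.trans hY
  have h2 : bmSnd m S z X = 0 := by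
    refine h' z.2 _ (fun w => ?_) (eq_zero_of_mcL_eq_zero (congrArg Prod.snd hA))
    let Y' : BmTangent m (S.prod I' M') z := ⟨(((0, w) : E × E'), 0),
      mem_BmTangent.2 ((hdf _).trans ((S.df z.1).map_zero.trans (mul_zero _).symm))⟩
    have hY := hX Y'
    rw [prodForm_apply] at hY
    exact (add_eq_right.2 (hz2 (bmFst m S z X))).symm.trans hY
  have h3 : ((X.1.1 : E × E').1 : E) = 0 := congrArg (fun Y => Y.1.1) h1
  have h4 : X.1.2 = 0 := congrArg (fun Y => Y.1.2) h1
  exact Subtype.ext (Prod.ext (Prod.ext h3 h2) h4)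

theorem closed_prod (h : IsBmQuasiHamiltonian I J m S B ρ σ Φ A)
    (h' : IsQuasiHamiltonian I' J' B' ρ' σ' Φ') {z : M × M'} (hz : z.1 ∉ S.Z) (u v w : E × E') :
    extDerivM (I.prod I') (offZ (prodForm σ σ')) z ![u, v, w]
      = - cartan (B.prod B') (mcL (I.prod I') (J.prod J') (Prod.map Φ Φ') z u)
        (mcL (I.prod I') (J.prod J') (Prod.map Φ Φ') z v)
        (mcL (I.prod I') (J.prod J') (Prod.map Φ Φ') z w) := by
  have hy := mem_extChartAt_target (I := I.prod I') z
  have hs : (extChartAt (I.prod I') z).symm (extChartAt (I.prod I') z z) = z :=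
    extChartAt_to_inv z
  have hyZ : (extChartAt (I.prod I') z).symm (extChartAt (I.prod I') z z) ∉ (S.prod I' M').Z := by
    rw [hs]
    exact hz
  have hd1 : DifferentiableAt ℝ (chartRep (I.prod I') (pullFst I' (offZ σ)) z)
      (extChartAt (I.prod I') z z) :=
    (contDiffAt_chartRep_pullFst h.smooth_form.1 S.isOpen_compl_Z hy hyZ).differentiableAt (by simp)
  have hd2 : DifferentiableAt ℝ (chartRep (I.prod I') (pullSnd I σ') z)
      (extChartAt (I.prod I') z z) :=
    (contDiffAt_chartRep_pullSnd h'.smooth_form isOpen_univ hy (mem_univ _)).differentiableAt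
      (by simp)
  have c1 : extDerivM I (offZ σ) z.1 ![u.1, v.1, w.1]
      = - cartan B (mcL I J Φ z.1 u.1) (mcL I J Φ z.1 v.1) (mcL I J Φ z.1 w.1) :=
    (h.closed z.1 hz u.1 v.1 w.1).trans (congrArg Neg.neg (chi_eq_cartan _ _ _ _ _))
  have c2 : extDerivM I' σ' z.2 ![u.2, v.2, w.2]
      = - cartan B' (mcL I' J' Φ' z.2 u.2) (mcL I' J' Φ' z.2 v.2) (mcL I' J' Φ' z.2 w.2) :=
    (h'.closed z.2 u.2 v.2 w.2).trans (congrArg Neg.neg (chi_eq_cartan _ _ _ _ _))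
  have e1 : (fun i => ((![u, v, w] : Fin 3 → E × E') i).1) = ![u.1, v.1, w.1] := by
    funext i
    fin_cases i <;> rfl
  have e2 : (fun i => ((![u, v, w] : Fin 3 → E × E') i).2) = ![u.2, v.2, w.2] := by
    funext i
    fin_cases i <;> rfl
  refine (extDerivM_apply _ _ _).trans ?_
  rw [(chartRep_offZ_prodForm hy hyZ).extDeriv_eq, extDeriv_fun_add hd1 hd2]
  refine (congrArg₂ (fun s t : ℝ => s + t)
    (extDerivM_pullFst h.smooth_form.1 S.isOpen_compl_Z hz ![u, v, w])
    (extDerivM_pullSnd h'.smooth_form isOpen_univ (mem_univ _) ![u, v, w])).trans ?_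
  rw [e1, e2]
  refine (congrArg₂ (fun s t : ℝ => s + t) c1 c2).trans ?_
  rw [cartan_prod]
  simp only [mcL_prodMap (h.mdifferentiableAt hz) (h'.mdifferentiableAt z.2)]
  exact (neg_add _ _).symm

/-- The product of a singular quasi-Hamiltonian space and a quasi-Hamiltonian space. -/
theorem IsBmQuasiHamiltonian.prod (h : IsBmQuasiHamiltonian I J m S B ρ σ Φ A)
    (h' : IsQuasiHamiltonian I' J' B' ρ' σ' Φ') :
    IsBmQuasiHamiltonian (I.prod I') (J.prod J') m (S.prod I' M') (B.prod B') (prodAction ρ ρ')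
      (prodForm σ σ') (Prod.map Φ Φ') (prodLog J' A Φ') where
  action := isBmAction_prod h.action h'.smooth_action
  smooth_form := isBmTwoForm_prod h.smooth_form h'.smooth_form
  invariant k z hz u v := by
    have hz' : (act (prodAction ρ ρ') k z).1 ∉ S.Z := fun hk => hz ((h.action.map_Z k.1 z.1).1 hk)
    have key : ∀ u v : E × E', offZ (prodForm σ σ') (act (prodAction ρ ρ') k z)
        ![dM (I.prod I') (I.prod I') (act (prodAction ρ ρ') k) z u,
          dM (I.prod I') (I.prod I') (act (prodAction ρ ρ') k) z v]
        = offZ (prodForm σ σ') z ![u, v] := by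
      intro u v
      refine (offZ_prodForm hz' _ _).trans ((offZ_prodForm hz u v).trans ?_).symm
      rw [dM_act_prod h.action.smooth h'.smooth_action,
        dM_act_prod h.action.smooth h'.smooth_action]
      exact (congrArg₂ (· + ·) (h.invariant k.1 z.1 hz u.1 v.1)
        (h'.invariant k.2 z.2 u.2 v.2)).symm
    exact key u v
  smooth_map := (h.smooth_map.comp contMDiffOn_fst fun _ h => h).prodMk
    (h'.smooth_map.comp_contMDiffOn contMDiffOn_snd)
  dlog_eq z hz X := by
    refine Eq.trans ?_ (mcL_prodMap (h.mdifferentiableAt hz) (h'.mdifferentiableAt z.2)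
      (X.1.1 : E × E')).symm
    exact Prod.ext (h.dlog_apply hz (bmFst m S z X)) rfl
  dlog_smooth := isBmOneFormNearZ_prodLog h.dlog_smooth h'.smooth_map
  equivariant k z hz := Prod.ext (h.equivariant k.1 z.1 hz) (h'.equivariant k.2 z.2)
  closed z hz u v w :=
    (closed_prod h h' hz u v w).trans (congrArg Neg.neg (chi_eq_cartan _ _ _ _ _).symm)
  moment ξ z hz w := by
    have e := fundField_prod h.action.smooth h'.smooth_action ξ z
    have m1 := h.moment_apply hz ξ.1 w.1
    have m2 : σ' z.2 ![fundField I' J' ρ' ξ.2 z.2, w.2] = (1 / 2) *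
      B'.bil (mcL I' J' Φ' z.2 w.2 + mcR I' J' Φ' z.2 w.2) ξ.2 := h'.moment ξ.2 z.2 w.2
    refine (offZ_prodForm hz (fundField (I.prod I') (J.prod J') (prodAction ρ ρ') ξ z) w).trans ?_
    rw [e]
    refine (congrArg₂ (fun s t : ℝ => s + t) m1 m2).trans ?_
    have l1 := mcL_prodMap (h.mdifferentiableAt hz) (h'.mdifferentiableAt z.2) w
    have l2 := mcR_prodMap (h.mdifferentiableAt hz) (h'.mdifferentiableAt z.2) w
    rw [← mul_add]
    refine congrArg (fun t : ℝ => (1 / 2) * t) ?_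
    refine Eq.trans ?_
      (congrArg₂ (fun s t : EK × EK' => (B.prod B').bil (s + t) ξ) l1 l2).symm
    rfl
  nondegenerate := nondegenerate_prod h.nondegenerate h'.nondegenerate

end ProductSpaces

section Fusion

variable {E₁ : Type*} [NormedAddCommGroup E₁] [NormedSpace ℝ E₁]
  {HM₁ : Type*} [TopologicalSpace HM₁] {I₁ : ModelWithCorners ℝ E₁ HM₁}
  {M₁ : Type*} [TopologicalSpace M₁] [ChartedSpace HM₁ M₁]
  {E₂ : Type*} [NormedAddCommGroup E₂] [NormedSpace ℝ E₂]
  {HM₂ : Type*} [TopologicalSpace HM₂] {I₂ : ModelWithCorners ℝ E₂ HM₂}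
  {M₂ : Type*} [TopologicalSpace M₂] [ChartedSpace HM₂ M₂]
  {EG : Type*} [NormedAddCommGroup EG] [NormedSpace ℝ EG] [FiniteDimensional ℝ EG]
  {HG : Type*} [TopologicalSpace HG] {JG : ModelWithCorners ℝ EG HG} [JG.Boundaryless]
  {G : Type*} [TopologicalSpace G] [ChartedSpace HG G] [Group G] [LieGroup JG ∞ G]
  {EH₁ : Type*} [NormedAddCommGroup EH₁] [NormedSpace ℝ EH₁] [FiniteDimensional ℝ EH₁]
  {HH₁ : Type*} [TopologicalSpace HH₁] {J₁ : ModelWithCorners ℝ EH₁ HH₁} [J₁.Boundaryless]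
  {H₁ : Type*} [TopologicalSpace H₁] [ChartedSpace HH₁ H₁] [Group H₁] [LieGroup J₁ ∞ H₁]
  {EH₂ : Type*} [NormedAddCommGroup EH₂] [NormedSpace ℝ EH₂] [FiniteDimensional ℝ EH₂]
  {HH₂ : Type*} [TopologicalSpace HH₂] {J₂ : ModelWithCorners ℝ EH₂ HH₂} [J₂.Boundaryless]
  {H₂ : Type*} [TopologicalSpace H₂] [ChartedSpace HH₂ H₂] [Group H₂] [LieGroup J₂ ∞ H₂]
  {Φ₂ : M₂ → G × H₂}

theorem mcL_snd_fst {z : M₁ × M₂} (h : MDifferentiableAt I₂ (JG.prod J₂) Φ₂ z.2) (v : E₁ × E₂) :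
    (mcL I₂ (JG.prod J₂) Φ₂ z.2 v.2).1
      = mcL (I₁.prod I₂) JG (fun z : M₁ × M₂ => (Φ₂ z.2).1) z v := by
  rw [mcL_prod h, mcL_comp (I' := I₂) (φ := fun q => (Φ₂ q).1) (f := Prod.snd) h.fst
    mdifferentiableAt_snd, dM_snd]
  rfl

theorem fusionForm_apply {m : ℕ} {S₁ : BManifold I₁ M₁} (B : InvariantInner JG G)
    {σ₁ : ∀ p : M₁, BmTangent m S₁ p [⋀^Fin 2]→L[ℝ] ℝ}
    {A₁ : ∀ p : M₁, BmTangent m S₁ p →L[ℝ] GroupLieAlgebra (JG.prod J₁) (G × H₁)}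
    {σ₂ : ∀ q : M₂, TangentSpace I₂ q [⋀^Fin 2]→L[ℝ] ℝ} {z : M₁ × M₂}
    (h : MDifferentiableAt I₂ (JG.prod J₂) Φ₂ z.2) (X Y : BmTangent m (S₁.prod I₂ M₂) z) :
    fusionForm B σ₁ A₁ σ₂ Φ₂ z ![X, Y] = prodForm σ₁ σ₂ z ![X, Y] + (1 / 2) *
      (B.form (lieFst (A₁ z.1 (bmFst m S₁ z X)))
        (mcR (I₁.prod I₂) JG (fun z : M₁ × M₂ => (Φ₂ z.2).1) z Y.1.1)
      - B.form (lieFst (A₁ z.1 (bmFst m S₁ z Y)))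
        (mcR (I₁.prod I₂) JG (fun z : M₁ × M₂ => (Φ₂ z.2).1) z X.1.1)) := by
  rw [mcR_comp (I' := I₂) (φ := fun q => (Φ₂ q).1) (f := Prod.snd) h.fst mdifferentiableAt_snd,
    dM_snd]
  rfl

end Fusion

end BmFusion

theorem mainTheorem9
    {EG : Type*} [NormedAddCommGroup EG] [NormedSpace ℝ EG] [FiniteDimensional ℝ EG]
    {HG : Type*} [TopologicalSpace HG] {JG : ModelWithCorners ℝ EG HG} [JG.Boundaryless]
    {G : Type*} [TopologicalSpace G] [ChartedSpace HG G] [Group G] [LieGroup JG ∞ G]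
    {EH₁ : Type*} [NormedAddCommGroup EH₁] [NormedSpace ℝ EH₁] [FiniteDimensional ℝ EH₁]
    {HH₁ : Type*} [TopologicalSpace HH₁] {J₁ : ModelWithCorners ℝ EH₁ HH₁} [J₁.Boundaryless]
    {H₁ : Type*} [TopologicalSpace H₁] [ChartedSpace HH₁ H₁] [Group H₁] [LieGroup J₁ ∞ H₁]
    {EH₂ : Type*} [NormedAddCommGroup EH₂] [NormedSpace ℝ EH₂] [FiniteDimensional ℝ EH₂]
    {HH₂ : Type*} [TopologicalSpace HH₂] {J₂ : ModelWithCorners ℝ EH₂ HH₂} [J₂.Boundaryless]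
    {H₂ : Type*} [TopologicalSpace H₂] [ChartedSpace HH₂ H₂] [Group H₂] [LieGroup J₂ ∞ H₂]
    {E₁ : Type*} [NormedAddCommGroup E₁] [NormedSpace ℝ E₁] [FiniteDimensional ℝ E₁]
    {HM₁ : Type*} [TopologicalSpace HM₁] {I₁ : ModelWithCorners ℝ E₁ HM₁} [I₁.Boundaryless]
    {M₁ : Type*} [TopologicalSpace M₁] [ChartedSpace HM₁ M₁] [IsManifold I₁ ∞ M₁]
    {E₂ : Type*} [NormedAddCommGroup E₂] [NormedSpace ℝ E₂] [FiniteDimensional ℝ E₂]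
    {HM₂ : Type*} [TopologicalSpace HM₂] {I₂ : ModelWithCorners ℝ E₂ HM₂} [I₂.Boundaryless]
    {M₂ : Type*} [TopologicalSpace M₂] [ChartedSpace HM₂ M₂] [IsManifold I₂ ∞ M₂]
    (BG : BmFusion.InvariantInner JG G) (BH₁ : BmFusion.InvariantInner J₁ H₁)
    (BH₂ : BmFusion.InvariantInner J₂ H₂)
    (m : ℕ) (hm : 1 ≤ m) (S₁ : BmFusion.BManifold I₁ M₁)
    (ρ₁ : MulAction (G × H₁) M₁)
    (σ₁ : ∀ p : M₁, BmFusion.BmTangent m S₁ p [⋀^Fin 2]→L[ℝ] ℝ)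
    (Φ₁ : M₁ → G × H₁)
    (A₁ : ∀ p : M₁, BmFusion.BmTangent m S₁ p →L[ℝ] GroupLieAlgebra (JG.prod J₁) (G × H₁))
    (h₁ : BmFusion.IsBmQuasiHamiltonian I₁ (JG.prod J₁) m S₁ (BG.prod BH₁) ρ₁ σ₁ Φ₁ A₁)
    (ρ₂ : MulAction (G × H₂) M₂)
    (σ₂ : ∀ q : M₂, TangentSpace I₂ q [⋀^Fin 2]→L[ℝ] ℝ)
    (Φ₂ : M₂ → G × H₂)
    (h₂ : BmFusion.IsQuasiHamiltonian I₂ (JG.prod J₂) (BG.prod BH₂) ρ₂ σ₂ Φ₂) :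
    (∃ A : ∀ z : M₁ × M₂, BmFusion.BmTangent m (S₁.prod I₂ M₂) z →L[ℝ]
        GroupLieAlgebra ((JG.prod J₁).prod (JG.prod J₂)) ((G × H₁) × (G × H₂)),
      BmFusion.IsBmQuasiHamiltonian (I₁.prod I₂) ((JG.prod J₁).prod (JG.prod J₂)) m
        (S₁.prod I₂ M₂) ((BG.prod BH₁).prod (BG.prod BH₂)) (BmFusion.prodAction ρ₁ ρ₂)
        (BmFusion.prodForm σ₁ σ₂) (Prod.map Φ₁ Φ₂) A) ∧
    (∃ A : ∀ z : M₁ × M₂, BmFusion.BmTangent m (S₁.prod I₂ M₂) z →L[ℝ]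
        GroupLieAlgebra (JG.prod (J₁.prod J₂)) (G × H₁ × H₂),
      BmFusion.IsBmQuasiHamiltonian (I₁.prod I₂) (JG.prod (J₁.prod J₂)) m
        (S₁.prod I₂ M₂) (BG.prod (BH₁.prod BH₂)) (BmFusion.fusionAction ρ₁ ρ₂)
        (BmFusion.fusionForm BG σ₁ A₁ σ₂ Φ₂) (BmFusion.fusionMap Φ₁ Φ₂) A) ∧
    (ContMDiff I₁ (JG.prod J₁) ∞ Φ₁ →
      ContMDiff (I₁.prod I₂) (JG.prod (J₁.prod J₂)) ∞ (BmFusion.fusionMap Φ₁ Φ₂)) := by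
  have hsmooth : ContMDiff (I₁.prod I₂) JG ∞ (fun z : M₁ × M₂ => (Φ₂ z.2).1) :=
    contMDiff_fst.comp (h₂.smooth_map.comp contMDiff_snd)
  have hprod := h₁.prod h₂
  refine ⟨⟨_, hprod⟩, ⟨_, BmFusion.IsInternalFusion.isBmQuasiHamiltonian (b := fun z => (Φ₂ z.2).1)
    { qh := hprod
      smooth_b := hsmooth
      b_eq := fun _ => rfl
      dlog_b := fun z X => ?_
      act_eq := fun _ _ => rfl
      form_eq := fun z X Y => ?_
      map_eq := fun _ => rfl } hm⟩, fun h => ?_⟩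
  · exact BmFusion.mcL_snd_fst (h₂.mdifferentiableAt z.2) X.1.1
  · exact BmFusion.fusionForm_apply BG (h₂.mdifferentiableAt z.2) X Y
  · have ha := h.comp (contMDiff_fst (I := I₁) (J := I₂) (M := M₁) (N := M₂))
    have hb := h₂.smooth_map.comp (contMDiff_snd (I := I₁) (J := I₂) (M := M₁) (N := M₂))
    exact ((contMDiff_mul JG ∞).comp ((contMDiff_fst.comp ha).prodMk
      (contMDiff_fst.comp hb))).prodMk ((contMDiff_snd.comp ha).prodMk (contMDiff_snd.comp hb))
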